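/- Let $K$ be an algebraically closed field, $Q$ a finite quiver, $I$ an admissible ideal of the path algebra $KQ$ (that is, $R^m\subseteq I\subseteq R^2$ for some $m\ge 2$, where $R$ is the arrow ideal), and $\Lambda=KQ/I$. Paths are composed from left to right. Write $Q^{\mathrm{op}}$ for the opposite quiver and $I^{\mathrm{op}}\subseteq KQ^{\mathrm{op}}$ for the ideal obtained from $I$ by reversing paths. Suppose that there is an isomorphism of quivers $\iota:Q^{\mathrm{op}}\to Q$ such that $I^{\mathrm{op}}=\iota^{-1}(I)$ under the induced isomorphism $\iota: KQ^{\mathrm{op}}\to KQ$, and such that $\iota(v)=v$ for a vertex $v$; let $P:=e_v\Lambda$ be the corresponding projective right $\Lambda$-module. In $\mathcal K_\Lambda=\mathsf K^{\mathrm b}(\mathsf{proj}\,\Lambda)$, the bounded homotopy category of finitely generated projective right $\Lambda$-modules, write $T\ge U$ if $\operatorname{Hom}(T,U[i])=0$ for all $i>0$. An object $T$ is silting if $T\ge T$ and the smallest triangulated subcategory containing $T$ and closed under direct summands is $\mathcal K_\Lambda$; it is basic if its indecomposable direct summands are pairwise non-isomorphic. Let $\mathsf{2silt}\,\Lambda$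 be the set of isomorphism classes of basic silting objects $T$ with $\Lambda\ge T\ge\Lambda[1]$. Writing $\Lambda\cong P\oplus M$, let $\mu_P^-(\Lambda)=Y\oplus M$, where $Y$ is the mapping cone of a minimal left $\mathsf{add}\,M$-approximation $P\to M'$; dually, let $\mu^+_{P[1]}(\Lambda[1])=Z\oplus M[1]$, where $Z$ is the cocone of a minimal right $\mathsf{add}\,M[1]$-approximation $M''\to P[1]$. Put $$\mathcal T_P^-=\{T\in\mathsf{2silt}\,\Lambda\mid \mu_P^-(\Lambda)\ge T\ge\Lambda[1]\},\qquad \mathcal T_P^+=\{T\in\mathsf{2silt}\,\Lambda\mid \Lambda\ge T\ge\mu_{P[1]}^+(\Lambda[1])\}.$$ Then there is an order-reversing bijection between $\mathcal T_P^-$ and $\mathcal T_P^+$ (that is, a bijection $\varphi:\mathcal T_P^-\to\mathcal T_P^+$ with $S\ge T$ if and only if $\varphi(T)\ge\varphi(S)$). In particular, $|\mathsf{2silt}\,\Lambda|=2\cdot|\mathcal T_P^-|$ (as cardinal numbers). -/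

import Mathlib

open CategoryTheory CategoryTheory.Limits CategoryTheory.Pretriangulated
open scoped ZeroObject

universe u v w

namespace Silting

/-! ### Path algebras of quivers -/

section PathAlgebra

/-- All paths of a quiver (including the trivial paths). -/
abbrev QPath (V : Type u) [Quiver.{v} V] : Type (max u v) :=
  Σ a : V, Σ b : V, Quiver.Path a b

/-- The path algebra `KQ`: the `K`-vector space with basis the paths of the quiver. -/
def PathAlgebra (K : Type w) [Field K] (V : Type u) [Quiver.{v} V] : Type (max u v w) :=
  QPath V →₀ K

variable (K : Type w) [Field K] {V : Type u} [Quiver.{v} V]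

noncomputable instance : AddCommGroup (PathAlgebra K V) :=
  inferInstanceAs (AddCommGroup (QPath V →₀ K))

noncomputable instance : Module K (PathAlgebra K V) :=
  inferInstanceAs (Module K (QPath V →₀ K))

/-- The element of the path algebra given by a path. -/
noncomputable def ofPath {a b : V} (p : Quiver.Path a b) : PathAlgebra K V :=
  Finsupp.single (⟨a, b, p⟩ : QPath V) (1 : K)

/-- The product of two paths `p : a ⟶ b` and `q : c ⟶ d`: the concatenation "first `p`, then `q`"
if `b = c`, and zero otherwise. -/
noncomputable def pathMul (p q : QPath V) : PathAlgebra K V :=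
  open Classical in
  if h : q.1 = p.2.1 then ofPath K (p.2.2.comp (q.2.2.cast h rfl)) else 0

/-- The bilinear multiplication of the path algebra, extending the product of paths. -/
noncomputable def mulLin : PathAlgebra K V →ₗ[K] PathAlgebra K V →ₗ[K] PathAlgebra K V :=
  Finsupp.linearCombination K fun p : QPath V => Finsupp.linearCombination K (pathMul K p)

noncomputable instance : Mul (PathAlgebra K V) := ⟨fun x y => mulLin K x y⟩

/-- The idempotent `e_v` of the path algebra: the trivial path at the vertex `v`. -/
noncomputable def vertexIdem (v : V) : PathAlgebra K V :=
  ofPath K (Quiver.Path.nil : Quiver.Path v v)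

noncomputable instance [Fintype V] : One (PathAlgebra K V) := ⟨∑ v : V, vertexIdem K v⟩

variable {K}

theorem mul_def (x y : PathAlgebra K V) : x * y = mulLin K x y := rfl

theorem ofPath_mul_ofPath {a b c : V} (p : Quiver.Path a b) (q : Quiver.Path b c) :
    ofPath K p * ofPath K q = ofPath K (p.comp q) := by
  rw [mul_def, mulLin, ofPath, ofPath]
  erw [Finsupp.linearCombination_single, one_smul, Finsupp.linearCombination_single, one_smul]
  simp [pathMul]

theorem ofPath_mul_ofPath_of_ne {a b c d : V} (p : Quiver.Path a b) (q : Quiver.Path c d)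
    (h : c ≠ b) : ofPath K p * ofPath K q = 0 := by
  rw [mul_def, mulLin, ofPath, ofPath]
  erw [Finsupp.linearCombination_single, one_smul, Finsupp.linearCombination_single, one_smul]
  simp [pathMul, h]

theorem pathAlgebra_induction {motive : PathAlgebra K V → Prop} (x : PathAlgebra K V)
    (h0 : motive 0) (hadd : ∀ x y, motive x → motive y → motive (x + y))
    (hpath : ∀ (c : K) {a b : V} (p : Quiver.Path a b), motive (c • ofPath K p)) : motive x := by
  induction x using Finsupp.induction_linear with
  | zero => exact h0
  | add f g hf hg => exact hadd f g hf hg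
  | single a b =>
    have := hpath b a.2.2
    rw [ofPath] at this
    erw [Finsupp.smul_single, smul_eq_mul, mul_one] at this
    exact this

theorem pa_add_mul (x y z : PathAlgebra K V) : (x + y) * z = x * z + y * z := by
  simp [mul_def]

theorem pa_mul_add (x y z : PathAlgebra K V) : x * (y + z) = x * y + x * z := by
  simp [mul_def]

theorem pa_smul_mul (c : K) (x y : PathAlgebra K V) : (c • x) * y = c • (x * y) := by
  simp [mul_def]

theorem pa_mul_smul (c : K) (x y : PathAlgebra K V) : x * (c • y) = c • (x * y) := by
  simp [mul_def]

theorem pa_zero_mul (x : PathAlgebra K V) : 0 * x = 0 := by simp [mul_def]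

theorem pa_mul_zero (x : PathAlgebra K V) : x * 0 = 0 := by simp [mul_def]

theorem pa_mul_assoc (x y z : PathAlgebra K V) : x * y * z = x * (y * z) := by
  induction x using pathAlgebra_induction with
  | h0 => simp only [pa_zero_mul]
  | hadd x x' hx hx' => simp only [pa_add_mul, hx, hx']
  | hpath r p =>
  simp only [pa_smul_mul]
  congr 1
  induction y using pathAlgebra_induction with
  | h0 => simp only [pa_zero_mul, pa_mul_zero]
  | hadd y y' hy hy' => simp only [pa_add_mul, pa_mul_add, hy, hy']
  | hpath s q =>
  simp only [pa_smul_mul, pa_mul_smul]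
  congr 1
  induction z using pathAlgebra_induction with
  | h0 => simp only [pa_mul_zero]
  | hadd z z' hz hz' => simp only [pa_mul_add, hz, hz']
  | hpath t l =>
  simp only [pa_mul_smul]
  congr 1
  rename_i a b c d e f
  by_cases h1 : c = b
  · subst h1
    by_cases h2 : e = d
    · subst h2
      simp only [ofPath_mul_ofPath, Quiver.Path.comp_assoc]
    · rw [ofPath_mul_ofPath, ofPath_mul_ofPath_of_ne _ _ h2, ofPath_mul_ofPath_of_ne _ _ h2,
        pa_mul_zero]
  · by_cases h2 : e = d
    · subst h2
      rw [ofPath_mul_ofPath, ofPath_mul_ofPath_of_ne _ _ h1, ofPath_mul_ofPath_of_ne _ _ h1,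
        pa_zero_mul]
    · rw [ofPath_mul_ofPath_of_ne _ _ h1, ofPath_mul_ofPath_of_ne _ _ h2, pa_mul_zero,
        pa_zero_mul]

theorem pa_sum_mul {α : Type*} (s : Finset α) (f : α → PathAlgebra K V) (x : PathAlgebra K V) :
    (∑ i ∈ s, f i) * x = ∑ i ∈ s, f i * x := by
  simp [mul_def]

theorem pa_mul_sum {α : Type*} (s : Finset α) (f : α → PathAlgebra K V) (x : PathAlgebra K V) :
    x * (∑ i ∈ s, f i) = ∑ i ∈ s, x * f i := by
  simp [mul_def]

theorem pa_one_mul [Fintype V] (x : PathAlgebra K V) : 1 * x = x := by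
  induction x using pathAlgebra_induction with
  | h0 => simp only [pa_mul_zero]
  | hadd x x' hx hx' => simp only [pa_mul_add, hx, hx']
  | hpath r p =>
  rename_i a b
  rw [pa_mul_smul]
  congr 1
  change (∑ v : V, vertexIdem K v) * _ = _
  rw [pa_sum_mul, Finset.sum_eq_single a]
  · rw [vertexIdem, ofPath_mul_ofPath, Quiver.Path.nil_comp]
  · intro v _ hv
    exact ofPath_mul_ofPath_of_ne _ _ hv.symm
  · simp

theorem pa_mul_one [Fintype V] (x : PathAlgebra K V) : x * 1 = x := by
  induction x using pathAlgebra_induction with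
  | h0 => simp only [pa_zero_mul]
  | hadd x x' hx hx' => simp only [pa_add_mul, hx, hx']
  | hpath r p =>
  rename_i a b
  rw [pa_smul_mul]
  congr 1
  change _ * (∑ v : V, vertexIdem K v) = _
  rw [pa_mul_sum, Finset.sum_eq_single b]
  · rw [vertexIdem, ofPath_mul_ofPath, Quiver.Path.comp_nil]
  · intro v _ hv
    exact ofPath_mul_ofPath_of_ne _ _ hv
  · simp

/-- The ring structure of the path algebra of a quiver with finitely many vertices; the unit is the
sum of the trivial paths. -/
noncomputable instance [Fintype V] : Ring (PathAlgebra K V) :=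
  { (inferInstance : AddCommGroup (PathAlgebra K V)) with
    mul := (· * ·)
    one := 1
    left_distrib := pa_mul_add
    right_distrib := pa_add_mul
    zero_mul := pa_zero_mul
    mul_zero := pa_mul_zero
    mul_assoc := pa_mul_assoc
    one_mul := pa_one_mul
    mul_one := pa_mul_one }

noncomputable instance [Fintype V] : Algebra K (PathAlgebra K V) :=
  Algebra.ofModule pa_smul_mul fun c x y => pa_mul_smul c x y

theorem vertexIdem_isIdempotentElem [Fintype V] (v : V) :
    IsIdempotentElem (vertexIdem K v : PathAlgebra K V) :=
  ofPath_mul_ofPath _ _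

variable (K V) in
/-- The arrow ideal of the path algebra: the span of all paths of positive length. -/
noncomputable def arrowIdeal : Submodule K (PathAlgebra K V) :=
  Submodule.span K {x | ∃ (a b : V) (p : Quiver.Path a b), 0 < p.length ∧ x = ofPath K p}

/-- A (two-sided) ideal `I` is admissible if `R ^ m ⊆ I ⊆ R ^ 2` for some `m ≥ 2`, where `R` is the
arrow ideal. -/
def IsAdmissible [Fintype V] (I : Ideal (PathAlgebra K V)) : Prop :=
  ∃ m : ℕ, 2 ≤ m ∧ arrowIdeal K V ^ m ≤ I.restrictScalars K ∧
    I.restrictScalars K ≤ arrowIdeal K V ^ 2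

/-- The linear map `KQ → KQ'` sending each path to its image under a morphism of quivers
`Q → Q'`. -/
noncomputable def mapPathAlgebra {W : Type u} [Quiver.{v} W] (F : V ⥤q W) :
    PathAlgebra K V →ₗ[K] PathAlgebra K W :=
  Finsupp.lmapDomain K K fun p : QPath V => (⟨F.obj p.1, F.obj p.2.1, F.mapPath p.2.2⟩ : QPath W)

/-- The reversed path `p*` in the opposite quiver. -/
def opPath {a : V} : ∀ {b : V}, Quiver.Path a b → Quiver.Path (Opposite.op b) (Opposite.op a)
  | _, .nil => .nil
  | _, .cons p e => (Quiver.Hom.toPath e.op).comp (opPath p)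

/-- The linear map `KQ → KQᵒᵖ`, `p ↦ p*`, reversing paths. -/
noncomputable def reversePaths : PathAlgebra K V →ₗ[K] PathAlgebra K Vᵒᵖ :=
  Finsupp.lmapDomain K K
    fun p : QPath V => (⟨Opposite.op p.2.1, Opposite.op p.1, opPath p.2.2⟩ : QPath Vᵒᵖ)

/-- The ideal `Iᵒᵖ` of `KQᵒᵖ` obtained from an ideal `I` of `KQ` by reversing paths (as a
subspace). -/
noncomputable def opIdeal [Fintype V] (I : Ideal (PathAlgebra K V)) :
    Submodule K (PathAlgebra K Vᵒᵖ) :=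
  (I.restrictScalars K).map reversePaths

end PathAlgebra

/-- A morphism of quivers is an isomorphism if it has a two-sided inverse. -/
def IsQuiverIso {V W : Type u} [Quiver.{v} V] [Quiver.{v} W] (F : V ⥤q W) : Prop :=
  ∃ G : W ⥤q V, F ⋙q G = 𝟭q V ∧ G ⋙q F = 𝟭q W

/-! ### Silting objects and mutation in a triangulated category -/

section Triangulated

variable {C : Type u} [Category.{v} C] [Preadditive C] [HasShift C ℤ]

/-- `T ≥ U`: there are no nonzero morphisms `T ⟶ U[i]` for `i > 0`. -/
def Geq (T U : C) : Prop :=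
  ∀ i : ℤ, 0 < i → ∀ f : T ⟶ U⟦i⟧, f = 0

theorem Geq.of_iso {T T' U U' : C} (e : T ≅ T') (e' : U ≅ U') (h : Geq T U) : Geq T' U' := by
  intro i hi f
  have h1 := h i hi (e.hom ≫ f ≫ (shiftFunctor C i).map e'.inv)
  have h2 : f = e.inv ≫ (e.hom ≫ f ≫ (shiftFunctor C i).map e'.inv) ≫
      (shiftFunctor C i).map e'.hom := by
    simp [← Functor.map_comp]
  rw [h2, h1]
  simp

variable [HasZeroObject C] [∀ n : ℤ, (shiftFunctor C n).Additive] [Pretriangulated C]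

/-- `T` is silting: `Hom(T, T[i]) = 0` for all `i > 0`, and the smallest triangulated subcategory
containing `T` and closed under direct summands is everything. -/
structure IsSilting (T : C) : Prop where
  geq_self : Geq T T
  thick_eq_top : (ObjectProperty.singleton T).triangEnvelope = ⊤

/-- `T` is basic: no indecomposable object occurs twice as a direct summand of `T`. -/
def IsBasic (T : C) : Prop :=
  ∀ X : C, Indecomposable X → IsEmpty (Retract (X ⊞ X) T)

/-- `add M`: the direct summands of finite direct sums of copies of `M`. -/
def Add (M : C) : ObjectProperty C :=
  fun N => ∃ n : ℕ, Nonempty (Retract N (⨁ fun _ : Fin n => M))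

/-- `f : X ⟶ M'` is a minimal left `add M`-approximation of `X`. -/
structure IsMinLeftApprox (M : C) {X M' : C} (f : X ⟶ M') : Prop where
  mem : Add M M'
  factors : ∀ N : C, Add M N → ∀ g : X ⟶ N, ∃ h : M' ⟶ N, f ≫ h = g
  minimal : ∀ h : M' ⟶ M', f ≫ h = f → IsIso h

/-- `f : M' ⟶ X` is a minimal right `add M`-approximation of `X`. -/
structure IsMinRightApprox (M : C) {X M' : C} (f : M' ⟶ X) : Prop where
  mem : Add M M'
  factors : ∀ N : C, Add M N → ∀ g : N ⟶ X, ∃ h : N ⟶ M', h ≫ f = g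
  minimal : ∀ h : M' ⟶ M', h ≫ f = f → IsIso h

/-- `U` is (isomorphic to) the left mutation of `T` with respect to its direct summand `X`:
`T ≅ X ⊞ M` and `U ≅ Y ⊞ M`, where `Y` is the cone of a minimal left `add M`-approximation
of `X`. -/
def IsLeftMutation (T X U : C) : Prop :=
  ∃ (M M' Y : C) (f : X ⟶ M') (g : M' ⟶ Y) (d : Y ⟶ X⟦(1 : ℤ)⟧),
    Nonempty (T ≅ X ⊞ M) ∧ IsMinLeftApprox M f ∧ Triangle.mk f g d ∈ distTriang C ∧
      Nonempty (U ≅ Y ⊞ M)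

/-- `U` is (isomorphic to) the right mutation of `T` with respect to its direct summand `X`:
`T ≅ X ⊞ M` and `U ≅ Y ⊞ M`, where `Y` is the cocone of a minimal right `add M`-approximation
of `X`. -/
def IsRightMutation (T X U : C) : Prop :=
  ∃ (M M' Y : C) (f : M' ⟶ X) (g : Y ⟶ M') (d : X ⟶ Y⟦(1 : ℤ)⟧),
    Nonempty (T ≅ X ⊞ M) ∧ IsMinRightApprox M f ∧ Triangle.mk g f d ∈ distTriang C ∧
      Nonempty (U ≅ Y ⊞ M)

variable (C) in
/-- Isomorphism classes of objects. -/
abbrev IsoClass : Type u := Quotient (isIsomorphicSetoid C)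

/-- The isomorphism class of an object. -/
abbrev isoClass (T : C) : IsoClass C := Quotient.mk (isIsomorphicSetoid C) T

/-- The relation `≥` on isomorphism classes of objects. -/
def GeqClass (x y : IsoClass C) : Prop :=
  Quotient.liftOn₂ x y Geq fun _ _ _ _ ⟨e⟩ ⟨e'⟩ =>
    propext ⟨fun h => h.of_iso e e', fun h => h.of_iso e.symm e'.symm⟩

end Triangulated

/-! ### The category `Kᵇ(proj A)` -/

section Kb

variable (A : Type u) [Ring A]

/-- Finitely generated projective right `A`-modules, as a property of right `A`-modules (that is,
of modules over the opposite ring). -/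
def isFGProj : ObjectProperty (ModuleCat.{u} Aᵐᵒᵖ) :=
  fun M => Module.Finite Aᵐᵒᵖ M ∧ Module.Projective Aᵐᵒᵖ M

/-- The category `proj A` of finitely generated projective right `A`-modules. -/
abbrev FGProj := (isFGProj A).FullSubcategory

theorem isFGProj_of_linearEquiv {M N : ModuleCat.{u} Aᵐᵒᵖ} (e : M ≃ₗ[Aᵐᵒᵖ] N)
    (h : isFGProj A M) : isFGProj A N := by
  obtain ⟨h1, h2⟩ := h
  exact ⟨Module.Finite.equiv e, Module.Projective.of_equiv e⟩

instance : (isFGProj A).IsClosedUnderIsomorphisms where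
  of_iso e h := isFGProj_of_linearEquiv A e.toLinearEquiv h

instance : (isFGProj A).ContainsZero where
  exists_zero := ⟨ModuleCat.of Aᵐᵒᵖ PUnit.{u + 1}, ModuleCat.isZero_of_subsingleton _,
    ⟨inferInstanceAs (Module.Finite Aᵐᵒᵖ PUnit.{u + 1}), inferInstanceAs (Module.Projective Aᵐᵒᵖ PUnit.{u + 1})⟩⟩

instance : (isFGProj A).IsClosedUnderBinaryProducts where
  limitsOfShape_le := by
    rintro X ⟨p⟩
    have h1 := p.prop_diag_obj ⟨WalkingPair.left⟩
    have h2 := p.prop_diag_obj ⟨WalkingPair.right⟩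
    let M := p.diag.obj ⟨WalkingPair.left⟩
    let N := p.diag.obj ⟨WalkingPair.right⟩
    have e : X ≅ ModuleCat.of Aᵐᵒᵖ (M × N) :=
      (p.isLimit.conePointsIsoOfNatIso (ModuleCat.binaryProductLimitCone M N).isLimit
        (diagramIsoPair p.diag))
    refine (isFGProj A).prop_of_iso e.symm ?_
    obtain ⟨h11, h12⟩ := h1
    obtain ⟨h21, h22⟩ := h2
    exact ⟨inferInstanceAs (Module.Finite Aᵐᵒᵖ (M × N)),
      inferInstanceAs (Module.Projective Aᵐᵒᵖ (M × N))⟩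

instance : (isFGProj A).IsClosedUnderFiniteProducts := .mk'

instance : HasBinaryBiproducts (FGProj A) := HasBinaryBiproducts.of_hasBinaryProducts

/-- Bounded complexes of finitely generated projective modules, as objects of the homotopy
category of all complexes of such modules. -/
def isBounded : ObjectProperty (HomotopyCategory (FGProj A) (ComplexShape.up ℤ)) :=
  fun X => ∃ a b : ℤ, CochainComplex.IsStrictlyGE X.as a ∧ CochainComplex.IsStrictlyLE X.as b

theorem isBounded_quotient_iff (X : CochainComplex (FGProj A) ℤ) :
    isBounded A ((HomotopyCategory.quotient _ _).obj X) ↔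
      ∃ a b : ℤ, X.IsStrictlyGE a ∧ X.IsStrictlyLE b := Iff.rfl

instance : (isBounded A).ContainsZero where
  exists_zero := ⟨(HomotopyCategory.quotient _ _).obj 0, Functor.map_isZero _ (isZero_zero _),
    (isBounded_quotient_iff A _).2 ⟨0, 0, inferInstance, inferInstance⟩⟩

instance : (isBounded A).IsStableUnderShift ℤ where
  isStableUnderShiftBy n :=
    { le_shift K hK := by
        obtain ⟨K : CochainComplex _ _, rfl⟩ := K.quotient_obj_surjective
        rw [isBounded_quotient_iff] at hK
        obtain ⟨p, q, hp, hq⟩ := hK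
        rw [ObjectProperty.prop_shift_iff, HomotopyCategory.shift_quotient_obj,
          isBounded_quotient_iff]
        exact ⟨p - n, q - n, K.isStrictlyGE_shift p n (p - n) (by lia),
          K.isStrictlyLE_shift q n (q - n) (by lia)⟩ }

theorem isBounded_mappingCone {X Y : CochainComplex (FGProj A) ℤ} (f : X ⟶ Y)
    (hX : ∃ a b : ℤ, X.IsStrictlyGE a ∧ X.IsStrictlyLE b)
    (hY : ∃ a b : ℤ, Y.IsStrictlyGE a ∧ Y.IsStrictlyLE b) :
    ∃ a b : ℤ, (CochainComplex.mappingCone f).IsStrictlyGE a ∧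
      (CochainComplex.mappingCone f).IsStrictlyLE b := by
  obtain ⟨a₁, b₁, ha₁, hb₁⟩ := hX
  obtain ⟨a₂, b₂, ha₂, hb₂⟩ := hY
  refine ⟨min (a₁ - 1) a₂, max b₁ b₂, ?_, ?_⟩
  · rw [CochainComplex.isStrictlyGE_iff]
    intro i hi
    rw [CochainComplex.mappingCone.isZero_X_iff]
    exact ⟨X.isZero_of_isStrictlyGE a₁ _ (by lia), Y.isZero_of_isStrictlyGE a₂ _ (by lia)⟩
  · rw [CochainComplex.isStrictlyLE_iff]
    intro i hi
    rw [CochainComplex.mappingCone.isZero_X_iff]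
    exact ⟨X.isZero_of_isStrictlyLE b₁ _ (by lia), Y.isZero_of_isStrictlyLE b₂ _ (by lia)⟩

instance : (isBounded A).IsTriangulatedClosed₃ where
  ext₃' T hT h₁ h₂ := by
    obtain ⟨f : T.obj₁.as ⟶ T.obj₂.as, hf⟩ :=
      (HomotopyCategory.quotient _ _).map_surjective T.mor₁
    exact ⟨_, (isBounded_quotient_iff A _).2 (isBounded_mappingCone A f h₁ h₂),
      ⟨Triangle.π₃.mapIso (isoTriangleOfIso₁₂ T _ hT
        (HomotopyCategory.mappingCone_triangleh_distinguished f) (Iso.refl _) (Iso.refl _)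
        (((Category.comp_id _).trans hf.symm).trans (Category.id_comp _).symm))⟩⟩

instance : (isBounded A).IsTriangulated where
  toIsTriangulatedClosed₂ := .of_isTriangulatedClosed₃

/-- The perfect derived category `Kᵇ(proj A)`: bounded complexes of finitely generated projective
right `A`-modules, up to homotopy. -/
abbrev Kb := (isBounded A).FullSubcategory

variable {A}

/-- A finitely generated projective module as a complex concentrated in degree `0`. -/
noncomputable def stalk (M : FGProj A) : Kb A :=
  ⟨(HomotopyCategory.singleFunctor (FGProj A) 0).obj M,
    ⟨0, 0, inferInstanceAs (((CochainComplex.singleFunctor (FGProj A) 0).obj M).IsStrictlyGE 0),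
      inferInstanceAs (((CochainComplex.singleFunctor (FGProj A) 0).obj M).IsStrictlyLE 0)⟩⟩

variable (A) in
/-- `A` as a right module over itself. -/
noncomputable def regular : FGProj A :=
  ⟨ModuleCat.of Aᵐᵒᵖ A, isFGProj_of_linearEquiv A (M := ModuleCat.of Aᵐᵒᵖ Aᵐᵒᵖ)
    (N := ModuleCat.of Aᵐᵒᵖ A)
    { MulOpposite.opAddEquiv.symm with map_smul' := fun _ _ => rfl }
    ⟨inferInstanceAs (Module.Finite Aᵐᵒᵖ Aᵐᵒᵖ), inferInstanceAs (Module.Projective Aᵐᵒᵖ Aᵐᵒᵖ)⟩⟩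

/-- The right `A`-module `eA` given by an idempotent `e` of `A`. -/
noncomputable def idemModule (e : A) (he : IsIdempotentElem e) : FGProj A :=
  ⟨ModuleCat.of Aᵐᵒᵖ (Submodule.span Aᵐᵒᵖ {e}), by
    have h := (regular A).property
    have : Module.Projective Aᵐᵒᵖ A := h.2
    refine ⟨inferInstanceAs (Module.Finite Aᵐᵒᵖ (Submodule.span Aᵐᵒᵖ {e})), ?_⟩
    refine Module.Projective.of_split (P := Submodule.span Aᵐᵒᵖ {e}) (M := A)
      (Submodule.subtype _)
      { toFun := fun x => ⟨e * x, Submodule.mem_span_singleton.2 ⟨MulOpposite.op x, rfl⟩⟩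
        map_add' := fun x y => Subtype.ext (mul_add e x y)
        map_smul' := fun r x => Subtype.ext (mul_assoc e x r.unop).symm } ?_
    ext ⟨x, hx⟩
    obtain ⟨r, rfl⟩ := Submodule.mem_span_singleton.1 hx
    change e * (e * r.unop) = e * r.unop
    rw [← mul_assoc, he.eq]⟩

variable (A) in
/-- `2silt A`: the isomorphism classes of basic silting objects `T` with `A ≥ T ≥ A[1]`. -/
def twoSilt : Set (IsoClass (Kb A)) :=
  {x | ∃ T : Kb A, isoClass T = x ∧ IsSilting T ∧ IsBasic T ∧
    Geq (stalk (regular A)) T ∧ Geq T ((stalk (regular A))⟦(1 : ℤ)⟧)}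

/-- `𝒯⁻_P`: the elements `T` of `2silt A` with `μ⁻_P(A) ≥ T ≥ A[1]`. -/
def TMinus (P : FGProj A) : Set (IsoClass (Kb A)) :=
  {x | x ∈ twoSilt A ∧ ∃ U : Kb A, IsLeftMutation (stalk (regular A)) (stalk P) U ∧
    GeqClass (isoClass U) x ∧ GeqClass x (isoClass ((stalk (regular A))⟦(1 : ℤ)⟧))}

/-- `𝒯⁺_P`: the elements `T` of `2silt A` with `A ≥ T ≥ μ⁺_{P[1]}(A[1])`. -/
def TPlus (P : FGProj A) : Set (IsoClass (Kb A)) :=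
  {x | x ∈ twoSilt A ∧ ∃ U : Kb A,
    IsRightMutation ((stalk (regular A))⟦(1 : ℤ)⟧) ((stalk P)⟦(1 : ℤ)⟧) U ∧
    GeqClass (isoClass (stalk (regular A))) x ∧ GeqClass x (isoClass U)}

end Kb

/-- The right module `e_v Λ` over `Λ = KQ/I`. -/
noncomputable def vertexProj {K : Type w} [Field K] {V : Type u} [Quiver.{v} V] [Fintype V]
    (I : Ideal (PathAlgebra K V)) [I.IsTwoSided] (x : V) : FGProj (PathAlgebra K V ⧸ I) :=
  idemModule (Ideal.Quotient.mk I (vertexIdem K x))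
    ((vertexIdem_isIdempotentElem x).map (Ideal.Quotient.mk I))

end Silting

namespace Silting

/-! ### Maps and cancellation in the homotopy category of complexes -/

section HomotopyGeneral

open HomotopyCategory CochainComplex CochainComplex.HomComplex

variable {C : Type u} [Category.{v} C] [Preadditive C] [HasZeroObject C]

/-! Write `e` for the idempotent of the vertex `v`, so that `P = eΛ` and `M = (1 - e)Λ`. Let `ε : Λ
→ K` read off the coefficient of the trivial path at `v`, and let `F` be the "top at `v`", sending
`X` to `X / X · ker ε`. Then `F P` is simple, `F M = 0`, `F` is full, and endomorphisms of `P`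
killed by `F` are nilpotent in the uniform sense recorded in `IsLocalTop`.

An object `T` with `Λ ≥ T ≥ Λ[1]` is the cone of a map `d : X₁ ⟶ X₀` of projectives
(`isTwoTerm_of_geq`), so `F T` has homology only in degrees `0` and `-1`, namely the cokernel and
the kernel of `F d`. A Nakayama argument shows that `H⁰(F T) = 0` exactly when every map `P ⟶ T` is
a sum of maps through `M`; by the long exact sequence of the approximation triangle, this is
membership in `𝒯⁻` for silting `T` (`TMinus_eq`). Dually, `H⁻¹(F T) = 0` describes `𝒯⁺`
(`TPlus_eq`).

For basic two-term silting `T` exactly one of the two homologies vanishes. If neither did, there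
would be maps `T ⟶ P[1]` and `P ⟶ T` which are nonzero on homology. Since `F P` is simple, the
composite `T ⟶ P[1] ⟶ T[1]` would be nonzero too, against `T ≥ T` (`factorsLeft_or_factorsRight`).
If both vanished, `F` would have no homology on the thick closure of `T`, which contains `P`
(`not_factorsLeft_and_factorsRight`). Hence `2silt Λ` is the disjoint union of `𝒯⁻` and `𝒯⁺`.

The symmetry `ι` together with path reversal gives an anti-automorphism of `Λ` fixing `e`
(`exists_antiAutomorphism`). Twisting `Hom(-, Λ)` by it yields a duality of `proj Λ` which fixes
`Λ`, `P` and `M` up to isomorphism. On `Kᵇ(proj Λ)`, this duality followed by `[1]` exchanges `Λ`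
with `Λ[1]`, `P` with `P[1]` and `M` with `M[1]`, and it reverses `≥`. It therefore carries `𝒯⁻`
onto `𝒯⁺`, which gives the bijection, and the cardinality follows from the disjoint union. -/

theorem forall_shift_eq_zero_iff (K L : CochainComplex C ℤ) (n : ℤ) :
    (∀ f : (HomotopyCategory.quotient C (ComplexShape.up ℤ)).obj K ⟶
        ((HomotopyCategory.quotient C (ComplexShape.up ℤ)).obj L)⟦n⟧, f = 0) ↔
      ∀ a : Cocycle K L n, a ∈ coboundaries _ _ _ := by
  let i := ((HomotopyCategory.quotient C (ComplexShape.up ℤ)).commShiftIso n).app L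
  constructor
  · intro h a
    rw [← CohomologyClass.toHom_mk_eq_zero_iff]
    have h1 := h (CohomologyClass.toHom (CohomologyClass.mk a) ≫ i.hom)
    rwa [← cancel_mono i.hom, zero_comp]
  · intro h f
    obtain ⟨c, hc⟩ := (CohomologyClass.toHom_bijective K L n).2 (f ≫ i.inv)
    obtain ⟨a, rfl⟩ := c.mk_surjective
    have h1 := hc.symm.trans ((CohomologyClass.toHom_mk_eq_zero_iff a).2 (h a))
    rwa [← cancel_mono i.inv, zero_comp]

/-- A cochain out of a complex concentrated in degree `0` has a single component, so the vanishing
of all maps is exactness of `Hom(X, K)` in degree `n`. -/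
theorem forall_single_to_shift_eq_zero_iff (X : C) (K : CochainComplex C ℤ) (n p q : ℤ)
    (hp : p + 1 = n) (hq : n + 1 = q) :
    (∀ f : (HomotopyCategory.singleFunctor C 0).obj X ⟶
        ((HomotopyCategory.quotient C (ComplexShape.up ℤ)).obj K)⟦n⟧, f = 0) ↔
      ∀ z : X ⟶ K.X n, z ≫ K.d n q = 0 → ∃ y : X ⟶ K.X p, y ≫ K.d p n = z := by
  have key : (∀ f : (HomotopyCategory.singleFunctor C 0).obj X ⟶
        ((HomotopyCategory.quotient C (ComplexShape.up ℤ)).obj K)⟦n⟧, f = 0) ↔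
      ∀ a : Cocycle ((CochainComplex.singleFunctor C 0).obj X) K n, a ∈ coboundaries _ _ _ := by
    exact forall_shift_eq_zero_iff _ _ _
  rw [key]
  constructor
  · intro h z hz
    exact (Cocycle.fromSingleMk_mem_coboundaries_iff z (zero_add n) q hq hz p hp).1 (h _)
  · intro h a
    obtain ⟨z, hz, rfl⟩ := Cocycle.fromSingleMk_surjective a n (zero_add n) q hq
    exact (Cocycle.fromSingleMk_mem_coboundaries_iff z (zero_add n) q hq hz p hp).2 (h z hz)

theorem forall_to_single_shift_eq_zero_iff (X : C) (K : CochainComplex C ℤ) (n m p q : ℤ)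
    (hm : m + n = 0) (hp : p + 1 = m) (hq : m + 1 = q) :
    (∀ f : (HomotopyCategory.quotient C (ComplexShape.up ℤ)).obj K ⟶
        ((HomotopyCategory.singleFunctor C 0).obj X)⟦n⟧, f = 0) ↔
      ∀ z : K.X m ⟶ X, K.d p m ≫ z = 0 → ∃ y : K.X q ⟶ X, K.d m q ≫ y = z := by
  have key : (∀ f : (HomotopyCategory.quotient C (ComplexShape.up ℤ)).obj K ⟶
        ((HomotopyCategory.singleFunctor C 0).obj X)⟦n⟧, f = 0) ↔
      ∀ a : Cocycle K ((CochainComplex.singleFunctor C 0).obj X) n, a ∈ coboundaries _ _ _ := by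
    exact forall_shift_eq_zero_iff _ _ _
  rw [key]
  constructor
  · intro h z hz
    exact (Cocycle.toSingleMk_mem_coboundaries_iff z hm p hp hz q hq).1 (h _)
  · intro h a
    obtain ⟨z, hz, rfl⟩ := Cocycle.toSingleMk_surjective a m hm p hp
    exact (Cocycle.toSingleMk_mem_coboundaries_iff z hm p hp hz q hq).2 (h z hz)

/-- An idempotent endomorphism of a complex that is homotopic to the identity splits off a
homotopy equivalent direct summand. -/
theorem exists_iso_of_homotopy_id [IsIdempotentComplete C] (K : CochainComplex C ℤ) (e : K ⟶ K)
    (he : e ≫ e = e) (h : Homotopy e (𝟙 K)) :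
    ∃ L : CochainComplex C ℤ, Nonempty ((HomotopyCategory.quotient C (ComplexShape.up ℤ)).obj K ≅
        (HomotopyCategory.quotient C (ComplexShape.up ℤ)).obj L) ∧
      ∀ n, (IsZero (K.X n) ∨ e.f n = 0) → IsZero (L.X n) := by
  obtain ⟨L, i, p, hip, hpi⟩ := IsIdempotentComplete.idempotents_split K e he
  refine ⟨L, ⟨⟨(HomotopyCategory.quotient _ _).map p, (HomotopyCategory.quotient _ _).map i,
    ?_, ?_⟩⟩, fun n hn => ?_⟩
  · rw [← Functor.map_comp, hpi, HomotopyCategory.eq_of_homotopy _ _ h, CategoryTheory.Functor.map_id]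
  · rw [← Functor.map_comp, hip, CategoryTheory.Functor.map_id]
  · have h1 : i.f n ≫ p.f n = 𝟙 _ := by
      rw [← HomologicalComplex.comp_f, hip, HomologicalComplex.id_f]
    rw [IsZero.iff_id_eq_zero, ← h1]
    rcases hn with hn | hn
    · rw [hn.eq_of_tgt (i.f n) 0, zero_comp]
    · have h2 : p.f n ≫ i.f n = 0 := by
        rw [← HomologicalComplex.comp_f, hpi, hn]
      calc i.f n ≫ p.f n = i.f n ≫ (p.f n ≫ i.f n) ≫ p.f n := by
            simp only [Category.assoc, h1, reassoc_of% h1]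
        _ = 0 := by rw [h2, zero_comp, comp_zero]

/-- Cancellation of a contractible summand. Taking `s` as the only component of a homotopy, the
null-homotopic map `N` equals `ds` and `sd` in the two degrees concerned, and the two regularity
equations make it idempotent. Then `1 - N` is an idempotent homotopic to the identity, and its image
is zero wherever `N` is the identity. -/
theorem exists_iso_of_regular [IsIdempotentComplete C] (K : CochainComplex C ℤ) (a b : ℤ)
    (hab : a + 1 = b) (s : K.X b ⟶ K.X a) (h1 : K.d a b ≫ s ≫ K.d a b = K.d a b)
    (h2 : s ≫ K.d a b ≫ s = s) :
    ∃ L : CochainComplex C ℤ, Nonempty ((HomotopyCategory.quotient C (ComplexShape.up ℤ)).obj K ≅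
        (HomotopyCategory.quotient C (ComplexShape.up ℤ)).obj L) ∧
      (∀ n, IsZero (K.X n) → IsZero (L.X n)) ∧
      (s ≫ K.d a b = 𝟙 _ → IsZero (L.X b)) ∧ (K.d a b ≫ s = 𝟙 _ → IsZero (L.X a)) := by
  let c : ∀ i j, (ComplexShape.up ℤ).Rel j i → (K.X i ⟶ K.X j) := fun i j _ =>
    if h : i = b ∧ j = a then eqToHom (by rw [h.1]) ≫ s ≫ eqToHom (by rw [h.2]) else 0
  let N := Homotopy.nullHomotopicMap' (C := K) (D := K) c
  have hNb : N.f b = s ≫ K.d a b := by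
    rw [Homotopy.nullHomotopicMap'_f (k₂ := a) (k₁ := b) (k₀ := b + 1) hab rfl]
    simp [c, ← hab]
  have hNa : N.f a = K.d a b ≫ s := by
    rw [Homotopy.nullHomotopicMap'_f (k₂ := a - 1) (k₁ := a) (k₀ := b) (by simp) hab]
    simp [c, ← hab]
  have hN0 : ∀ n, n ≠ a → n ≠ b → N.f n = 0 := by
    intro n hna hnb
    rw [Homotopy.nullHomotopicMap'_f (k₂ := n - 1) (k₁ := n) (k₀ := n + 1) (by simp) rfl]
    simp [c, hna, hnb]
  have hNN : N ≫ N = N := by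
    ext n
    rw [HomologicalComplex.comp_f]
    by_cases hb : n = b
    · subst hb
      rw [hNb, Category.assoc, h1]
    by_cases ha : n = a
    · subst ha
      rw [hNa, Category.assoc, h2]
    rw [hN0 n ha hb, zero_comp]
  obtain ⟨L, hL, h⟩ := exists_iso_of_homotopy_id K (𝟙 K - N)
    (by simp [Preadditive.sub_comp, Preadditive.comp_sub, hNN])
    (Homotopy.equivSubZero.symm ((Homotopy.ofEq (by abel)).trans
      (Homotopy.nullHomotopy' (C := K) (D := K) c))).symm
  refine ⟨L, hL, fun n hn => h n (Or.inl hn), fun hs => h b (Or.inr ?_), fun hs => h a (Or.inr ?_)⟩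
  · rw [HomologicalComplex.sub_f_apply, hNb, hs, HomologicalComplex.id_f, sub_self]
  · rw [HomologicalComplex.sub_f_apply, hNa, hs, HomologicalComplex.id_f, sub_self]

end HomotopyGeneral

/-! ### Finitely generated projective modules and the modules `eA` -/

section ProjectiveModules

variable {A : Type u} [Ring A]

/-- The linear map underlying a morphism of finitely generated projective modules. -/
def lin {X Y : FGProj A} (f : X ⟶ Y) : X.obj →ₗ[Aᵐᵒᵖ] Y.obj := f.hom.hom

/-- The morphism of finitely generated projective modules given by a linear map. -/
def ofLin {X Y : FGProj A} (f : X.obj →ₗ[Aᵐᵒᵖ] Y.obj) : X ⟶ Y := ⟨ModuleCat.ofHom f⟩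

theorem lin_injective {X Y : FGProj A} {f g : X ⟶ Y} (h : ∀ x, lin f x = lin g x) : f = g := by
  ext x
  exact h x

@[simp] theorem lin_comp_apply {X Y Z : FGProj A} (f : X ⟶ Y) (g : Y ⟶ Z) (x : X.obj) :
    lin (f ≫ g) x = lin g (lin f x) := rfl

@[simp] theorem lin_id_apply {X : FGProj A} (x : X.obj) : lin (𝟙 X) x = x := rfl

@[simp] theorem lin_add_apply {X Y : FGProj A} (f g : X ⟶ Y) (x : X.obj) :
    lin (f + g) x = lin f x + lin g x := rfl

@[simp] theorem lin_sum_apply {X Y : FGProj A} {α : Type*} (s : Finset α) (f : α → (X ⟶ Y))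
    (x : X.obj) : lin (∑ i ∈ s, f i) x = ∑ i ∈ s, lin (f i) x := by
  classical
  induction s using Finset.induction_on with
  | empty => rfl
  | insert a s ha ih => rw [Finset.sum_insert ha, Finset.sum_insert ha, lin_add_apply, ih]

instance : HasFiniteBiproducts (FGProj A) :=
  HasFiniteBiproducts.of_hasFiniteProducts

instance : IsIdempotentComplete (FGProj A) where
  idempotents_split X p hp := by
    have hX := X.property
    have hp' : ∀ x, lin p (lin p x) = lin p x := fun x => congr(lin $hp x)
    have : Module.Finite Aᵐᵒᵖ X.obj := hX.1
    have : Module.Projective Aᵐᵒᵖ X.obj := hX.2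
    let Y : FGProj A := ⟨ModuleCat.of Aᵐᵒᵖ (LinearMap.range (lin p)),
      inferInstanceAs (Module.Finite Aᵐᵒᵖ (LinearMap.range (lin p))),
      Module.Projective.of_split (LinearMap.range (lin p)).subtype (lin p).rangeRestrict (by
        ext ⟨_, x, rfl⟩
        exact hp' x)⟩
    refine ⟨Y, ofLin (LinearMap.range (lin p)).subtype, ofLin (lin p).rangeRestrict, ?_, ?_⟩
    · apply lin_injective
      rintro ⟨_, x, rfl⟩
      exact Subtype.ext (hp' x)
    · exact lin_injective fun x => rfl

/-- The morphism `A ⟶ X` given by an element of `X`. -/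
noncomputable def ofElement {X : FGProj A} (x : X.obj) : regular A ⟶ X :=
  ofLin (X := regular A)
    { toFun := fun a : A => MulOpposite.op a • x
      map_add' := fun a b : A => add_smul (MulOpposite.op a) (MulOpposite.op b) x
      map_smul' := fun r a => (mul_smul r (MulOpposite.op a) x) }

/-- A finitely generated projective module is a summand of some `A ^ n`. Recording this as a
decomposition of the identity into maps through `A` lets additive statements be checked on `regular
A` alone. -/
theorem exists_sum_comp_regular (X : FGProj A) :
    ∃ (n : ℕ) (f : Fin n → (X ⟶ regular A)) (g : Fin n → (regular A ⟶ X)),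
      ∑ j, f j ≫ g j = 𝟙 X := by
  have hX := X.property
  have : Module.Finite Aᵐᵒᵖ X.obj := hX.1
  have : Module.Projective Aᵐᵒᵖ X.obj := hX.2
  obtain ⟨n, f, g, -, -, h⟩ := Module.Finite.exists_comp_eq_id_of_projective Aᵐᵒᵖ X.obj
  refine ⟨n, fun j => ofLin (Y := regular A)
    { toFun := fun x => (g x j).unop
      map_add' := fun x y => by simp; rfl
      map_smul' := fun r x => by simp; rfl },
    fun j => ofElement (f (Pi.single j 1)), lin_injective fun x => ?_⟩
  rw [lin_sum_apply]
  have h1 : f (g x) = x := congr($h x)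
  conv_rhs => rw [lin_id_apply, ← h1, ← Finset.univ_sum_single (g x), map_sum]
  refine Finset.sum_congr rfl fun j _ => ?_
  rw [lin_comp_apply]
  change g x j • f (Pi.single j 1) = _
  rw [← map_smul]
  congr 1
  ext i
  by_cases hij : i = j
  · subst hij; simp
  · simp [hij]

variable (e : A) (he : IsIdempotentElem e)

/-- The inclusion `eA ⟶ A`. -/
noncomputable def idemIncl : idemModule e he ⟶ regular A :=
  ofLin (Submodule.subtype (Submodule.span Aᵐᵒᵖ {e}))

/-- The projection `A ⟶ eA`. -/
noncomputable def idemProj : regular A ⟶ idemModule e he :=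
  ofLin (X := regular A) (Y := idemModule e he)
    (LinearMap.codRestrict (Submodule.span Aᵐᵒᵖ {e})
      { toFun := fun x : A => e * x
        map_add' := fun x y => mul_add e x y
        map_smul' := fun r x => (mul_assoc e x r.unop).symm }
      fun x => Submodule.mem_span_singleton.2 ⟨MulOpposite.op x, rfl⟩)

theorem mul_coe_idemModule (x : (idemModule e he).obj) :
    e * (Subtype.val (p := (· ∈ Submodule.span Aᵐᵒᵖ {e})) x) =
      Subtype.val (p := (· ∈ Submodule.span Aᵐᵒᵖ {e})) x := by
  obtain ⟨x, hx⟩ := x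
  obtain ⟨r, rfl⟩ := Submodule.mem_span_singleton.1 hx
  change e * (e * r.unop) = e * r.unop
  rw [← mul_assoc, he.eq]

@[simp]
theorem idemIncl_idemProj : idemIncl e he ≫ idemProj e he = 𝟙 _ :=
  lin_injective fun x => Subtype.ext (mul_coe_idemModule e he x)

theorem idemProj_idemIncl_add :
    idemProj e he ≫ idemIncl e he + idemProj (1 - e) he.one_sub ≫ idemIncl (1 - e) he.one_sub =
      𝟙 (regular A) :=
  lin_injective fun (x : A) => by
    change e * x + (1 - e) * x = x
    rw [← add_mul, add_sub_cancel, one_mul]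

theorem idemIncl_idemProj_one_sub : idemIncl e he ≫ idemProj (1 - e) he.one_sub = 0 := by
  refine lin_injective fun x => Subtype.ext ?_
  change (1 - e) * Subtype.val (p := (· ∈ Submodule.span Aᵐᵒᵖ {e})) x = 0
  rw [sub_mul, mul_coe_idemModule e he, one_mul, sub_self]

theorem idemIncl_one_sub_idemProj : idemIncl (1 - e) he.one_sub ≫ idemProj e he = 0 := by
  refine lin_injective fun x => Subtype.ext ?_
  change e * Subtype.val (p := (· ∈ Submodule.span Aᵐᵒᵖ {1 - e})) x = 0
  have h := mul_coe_idemModule (1 - e) he.one_sub x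
  rw [← h, ← mul_assoc, mul_sub, he.eq, mul_one, sub_self, zero_mul]

end ProjectiveModules

/-! ### The top of a projective module at a vertex -/

section Top

variable {A : Type u} [Ring A]

/-- The functor `X ↦ X / X N` for an ideal `N`. -/
noncomputable def topFunctor (N : Ideal Aᵐᵒᵖ) : FGProj A ⥤ ModuleCat.{u} Aᵐᵒᵖ where
  obj X := ModuleCat.of Aᵐᵒᵖ (X.obj ⧸ (N • ⊤ : Submodule Aᵐᵒᵖ X.obj))
  map f := ModuleCat.ofHom (Submodule.mapQ _ _ (lin f) (by
    rw [← Submodule.map_le_iff_le_comap, Submodule.map_smul'']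
    exact Submodule.smul_mono le_rfl le_top))
  map_id X := by
    ext x
    rfl
  map_comp f g := by
    ext x
    rfl

instance (N : Ideal Aᵐᵒᵖ) : (topFunctor N).Additive where
  map_add {X Y f g} := by
    ext x
    obtain ⟨x, rfl⟩ := Submodule.Quotient.mk_surjective _ x
    rfl

theorem topFunctor_map_mk (N : Ideal Aᵐᵒᵖ) {X Y : FGProj A} (f : X ⟶ Y) (x : X.obj) :
    ((topFunctor N).map f).hom (Submodule.Quotient.mk x) = Submodule.Quotient.mk (lin f x) := rfl

/-- A map between tops lifts because the source module is projective. -/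
instance (N : Ideal Aᵐᵒᵖ) : (topFunctor N).Full where
  map_surjective {X Y} g := by
    have : Module.Projective Aᵐᵒᵖ X.obj := X.property.2
    obtain ⟨f, hf⟩ := Module.projective_lifting_property
      (Submodule.mkQ (N • ⊤ : Submodule Aᵐᵒᵖ Y.obj)) (g.hom ∘ₗ Submodule.mkQ _)
      (Submodule.mkQ_surjective _)
    refine ⟨ofLin f, ?_⟩
    ext x
    obtain ⟨x, rfl⟩ := Submodule.mkQ_surjective _ x
    exact congr($hf x)

/-- Two objects `P`, `M` generate the additive category `C`, and `F` is a full functor to modules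
which kills `M`, sends `P` to a simple module, and has nilpotent kernel on `End P`. -/
structure IsLocalTop {C : Type*} [Category* C] [Preadditive C] {R : Type*} [Ring R]
    (F : C ⥤ ModuleCat.{v} R) (P M : C) : Prop where
  decomp : ∀ X : C, ∃ (n : ℕ) (a : Fin n → (X ⟶ P)) (b : Fin n → (P ⟶ X))
    (a' : Fin n → (X ⟶ M)) (b' : Fin n → (M ⟶ X)),
    ∑ j, a j ≫ b j + ∑ j, a' j ≫ b' j = 𝟙 X
  isZero : IsZero (F.obj M)
  simple : IsSimpleModule R (F.obj P)
  full : F.Full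
  nilpotent : ∃ m : ℕ, ∀ l : List (End P), l.length = m → (∀ r ∈ l, F.map r = 0) → l.prod = 0

/-- The elements of a ring killed by a ring homomorphism, as an ideal of the opposite ring. -/
def kerOp {K : Type*} [Field K] (ε : A →+* K) : Ideal Aᵐᵒᵖ := RingHom.ker (RingHom.op ε)

theorem mem_kerOp {K : Type*} [Field K] (ε : A →+* K) (a : Aᵐᵒᵖ) :
    a ∈ kerOp ε ↔ ε a.unop = 0 := by
  rw [kerOp, RingHom.mem_ker, RingHom.op_apply_apply, MulOpposite.op_eq_zero_iff]


variable {K : Type*} [Field K] (ε : A →+* K) {e : A} (he : IsIdempotentElem e)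

/-- The underlying element of `A` of an element of `eA`. -/
def idemVal (x : (idemModule e he).obj) : A := Subtype.val (p := (· ∈ Submodule.span Aᵐᵒᵖ {e})) x

/-- The generator of `eA`. -/
noncomputable def idemGen : (idemModule e he).obj :=
  (⟨e, Submodule.mem_span_singleton_self e⟩ : Submodule.span Aᵐᵒᵖ {e})

theorem idemVal_smul_gen (x : (idemModule e he).obj) :
    MulOpposite.op (idemVal he x) • idemGen he = x :=
  Subtype.ext (mul_coe_idemModule e he x)

/-- An element `x` of `eA` is the generator times `x`, so `ε x = 0` already places it in `eA · ker
ε`; the converse is multiplicativity of `ε`. -/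
theorem mem_smul_top_idemModule_iff (x : (idemModule e he).obj) :
    x ∈ (kerOp ε • ⊤ : Submodule Aᵐᵒᵖ (idemModule e he).obj) ↔ ε (idemVal he x) = 0 := by
  constructor
  · intro hx
    induction hx using Submodule.smul_induction_on' with
    | smul r hr n _ =>
      change ε (idemVal he n * r.unop) = 0
      rw [map_mul, (mem_kerOp ε r).1 hr, mul_zero]
    | add x _ y _ hx hy =>
      change ε (idemVal he x + idemVal he y) = 0
      rw [map_add, hx, hy, add_zero]
  · intro hx
    rw [← idemVal_smul_gen he x]
    exact Submodule.smul_mem_smul ((mem_kerOp ε _).2 hx) Submodule.mem_top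

theorem isSimpleModule_topFunctor (hε : ε e = 1) (hsurj : Function.Surjective ε) :
    IsSimpleModule Aᵐᵒᵖ ((topFunctor (kerOp ε)).obj (idemModule e he)) := by
  refine (isSimpleModule_iff_isCoatom
    (m := (kerOp ε • ⊤ : Submodule Aᵐᵒᵖ (idemModule e he).obj))).2 ?_
  refine ⟨fun h => ?_, fun W hW => ?_⟩
  · have h1 : idemGen he ∈ (kerOp ε • ⊤ : Submodule Aᵐᵒᵖ (idemModule e he).obj) :=
      by rw [h]; exact Submodule.mem_top
    rw [mem_smul_top_idemModule_iff ε he] at h1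
    exact one_ne_zero (hε.symm.trans h1)
  · obtain ⟨hle, w, hw, hw'⟩ := SetLike.lt_iff_le_and_exists.1 hW
    rw [mem_smul_top_idemModule_iff ε he] at hw'
    -- Here `a` lifts the inverse of `ε w`, so `e - w a` lies in the submodule being shown maximal,
    -- and the larger submodule `W` contains the generator.
    obtain ⟨a, ha⟩ := hsurj (ε (idemVal he w))⁻¹
    have h1 : idemGen he - MulOpposite.op a • w ∈ W := by
      apply hle
      rw [mem_smul_top_idemModule_iff ε he]
      change ε (e - idemVal he w * a) = 0
      rw [map_sub, map_mul, ha, hε, mul_inv_cancel₀ hw', sub_self]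
    have h2 : idemGen he ∈ W := by
      have := W.add_mem h1 (W.smul_mem (MulOpposite.op a) hw)
      rwa [sub_add_cancel] at this
    rw [eq_top_iff]
    intro x _
    rw [← idemVal_smul_gen he x]
    exact W.smul_mem _ h2

theorem isZero_topFunctor (hε : ε e = 0) :
    IsZero ((topFunctor (kerOp ε)).obj (idemModule e he)) := by
  have h : (kerOp ε • ⊤ : Submodule Aᵐᵒᵖ (idemModule e he).obj) = ⊤ := by
    rw [eq_top_iff]
    intro x _
    rw [← idemVal_smul_gen he x]
    refine Submodule.smul_mem_smul ((mem_kerOp ε _).2 ?_) Submodule.mem_top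
    have h1 : e * idemVal he x = idemVal he x := mul_coe_idemModule e he x
    change ε (idemVal he x) = 0
    rw [← h1, map_mul, hε, zero_mul]
  have : Subsingleton ((idemModule e he).obj ⧸
      (kerOp ε • ⊤ : Submodule Aᵐᵒᵖ (idemModule e he).obj)) :=
    Submodule.Quotient.subsingleton_iff.2 h
  exact ModuleCat.isZero_of_subsingleton (ModuleCat.of Aᵐᵒᵖ ((idemModule e he).obj ⧸
      (kerOp ε • ⊤ : Submodule Aᵐᵒᵖ (idemModule e he).obj)))

theorem idemVal_map_of_topFunctor_map_eq_zero (r : End (idemModule e he)) (hr : (topFunctor (kerOp ε)).map r = 0) :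
    ε (idemVal he (lin r (idemGen he))) = 0 := by
  rw [← mem_smul_top_idemModule_iff ε he, ← Submodule.Quotient.mk_eq_zero]
  exact (topFunctor_map_mk (kerOp ε) r (idemGen he)).symm.trans (by rw [hr]; rfl)

theorem idemVal_lin_gen_mul (r : End (idemModule e he)) :
    idemVal he (lin r (idemGen he)) * e = idemVal he (lin r (idemGen he)) := by
  have h : MulOpposite.op e • idemGen he = idemGen he := Subtype.ext he.eq
  conv_rhs => rw [← h, map_smul]
  rfl

theorem idemVal_lin (r : End (idemModule e he)) (x : (idemModule e he).obj) :
    idemVal he (lin r x) = idemVal he (lin r (idemGen he)) * idemVal he x := by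
  conv_lhs => rw [← idemVal_smul_gen he x, map_smul]
  rfl

/-- Endomorphisms of `eA` are left multiplications by elements of `eAe`, and those killed by the top
functor come from elements of `eAe ∩ ker ε`. Nilpotency is thus a statement about products in the
ring, which is `hnil`. -/
theorem isLocalTop_topFunctor (hε : ε e = 1) (hsurj : Function.Surjective ε)
    (m : ℕ)
    (hnil : ∀ l : List A, l.length = m → (∀ a ∈ l, e * a * e = a ∧ ε a = 0) → l.prod = 0) :
    IsLocalTop (topFunctor (kerOp ε)) (idemModule e he) (idemModule (1 - e) he.one_sub) where
  decomp X := by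
    obtain ⟨n, f, g, h⟩ := exists_sum_comp_regular X
    refine ⟨n, fun j => f j ≫ idemProj e he, fun j => idemIncl e he ≫ g j,
      fun j => f j ≫ idemProj _ he.one_sub, fun j => idemIncl _ he.one_sub ≫ g j, ?_⟩
    rw [← h, ← Finset.sum_add_distrib]
    refine Finset.sum_congr rfl fun j _ => ?_
    have h1 := idemProj_idemIncl_add e he
    calc _ = f j ≫ (idemProj e he ≫ idemIncl e he +
        idemProj (1 - e) he.one_sub ≫ idemIncl (1 - e) he.one_sub) ≫ g j := by
          simp [Preadditive.add_comp, Preadditive.comp_add]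
      _ = _ := by rw [h1, Category.id_comp]
  isZero := isZero_topFunctor ε he.one_sub (by rw [map_sub, map_one, hε, sub_self])
  simple := isSimpleModule_topFunctor ε he hε hsurj
  full := inferInstance
  nilpotent := by
    refine ⟨m, fun l hl hr => ?_⟩
    -- Multiplication in `End` is composition of functions, so the factors keep their order; the
    -- trailing `e` is the value of the identity at the generator.
    have key : ∀ l : List (End (idemModule e he)), idemVal he (lin (l.prod) (idemGen he)) =
        (l.map fun r => idemVal he (lin r (idemGen he))).prod * e := by
      intro l
      induction l with
      | nil => exact (one_mul e).symm
      | cons r l ih =>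
        rw [List.prod_cons, List.map_cons, List.prod_cons, mul_assoc, ← ih]
        exact idemVal_lin he r _
    have h1 := key l
    rw [hnil _ (by simpa using hl), zero_mul] at h1
    · refine lin_injective fun x => Subtype.ext ?_
      change idemVal he (lin l.prod x) = 0
      rw [idemVal_lin, h1, zero_mul]
    · intro a ha
      obtain ⟨r, hrl, rfl⟩ := List.mem_map.1 ha
      refine ⟨?_, idemVal_map_of_topFunctor_map_eq_zero ε he r (hr r hrl)⟩
      rw [mul_assoc, idemVal_lin_gen_mul]
      exact mul_coe_idemModule e he _

end Top

/-! ### Nakayama's lemma modulo maps through `M` -/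

section Nakayama

/-- The group of morphisms `X ⟶ Y` generated by those that factor through `M`. -/
def through {C : Type*} [Category* C] [Preadditive C] (M X Y : C) : AddSubgroup (X ⟶ Y) :=
  AddSubgroup.closure {f | ∃ (a : X ⟶ M) (b : M ⟶ Y), f = a ≫ b}

section

variable {C : Type*} [Category* C] [Preadditive C] {M : C}

theorem comp_mem_through {X Y : C} (a : X ⟶ M) (b : M ⟶ Y) : a ≫ b ∈ through M X Y :=
  AddSubgroup.subset_closure ⟨a, b, rfl⟩

theorem precomp_mem_through {X Y Z : C} (g : X ⟶ Y) {f : Y ⟶ Z} (hf : f ∈ through M Y Z) :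
    g ≫ f ∈ through M X Z := by
  induction hf using AddSubgroup.closure_induction with
  | mem f hf =>
    obtain ⟨a, b, rfl⟩ := hf
    rw [← Category.assoc]
    exact comp_mem_through _ _
  | zero => rw [comp_zero]; exact zero_mem _
  | add f f' _ _ h h' => rw [Preadditive.comp_add]; exact add_mem h h'
  | neg f _ h => rw [Preadditive.comp_neg]; exact neg_mem h

theorem postcomp_mem_through {X Y Z : C} {f : X ⟶ Y} (hf : f ∈ through M X Y) (g : Y ⟶ Z) :
    f ≫ g ∈ through M X Z := by
  induction hf using AddSubgroup.closure_induction with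
  | mem f hf =>
    obtain ⟨a, b, rfl⟩ := hf
    rw [Category.assoc]
    exact comp_mem_through _ _
  | zero => rw [zero_comp]; exact zero_mem _
  | add f f' _ _ h h' => rw [Preadditive.add_comp]; exact add_mem h h'
  | neg f _ h => rw [Preadditive.neg_comp]; exact neg_mem h

end

section

variable {C : Type*} [Category* C] {P : C}

/-- The product of a list of endomorphisms. -/
def prodHom (l : List (End P)) : P ⟶ P := l.prod

theorem prodHom_cons (r : End P) (l : List (End P)) : prodHom (r :: l) = prodHom l ≫ r :=
  List.prod_cons (α := End P)

theorem prodHom_append (r : End P) (l : List (End P)) : prodHom (l ++ [r]) = r ≫ prodHom l :=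
  (List.prod_append (α := End P)).trans
    (congrArg (fun s : End P => l.prod * s) (List.prod_singleton (α := End P)))

end

namespace IsLocalTop

variable {C : Type*} [Category* C] [Preadditive C] {R : Type*} [Ring R]
  {F : C ⥤ ModuleCat.{v} R} [F.Additive] {P M : C}

/-- Apply `F` to the decomposition of the identity of `X`: the terms through `M` die, which exhibits
`F X` as a summand of a power of `F P`. -/
theorem sum_map_comp_map (h : IsLocalTop F P M) (X : C) :
    ∃ (n : ℕ) (a : Fin n → (X ⟶ P)) (b : Fin n → (P ⟶ X)),
      ∑ j, F.map (a j) ≫ F.map (b j) = 𝟙 (F.obj X) ∧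
      𝟙 X - ∑ j, a j ≫ b j ∈ through M X X := by
  obtain ⟨n, a, b, a', b', hab⟩ := h.decomp X
  refine ⟨n, a, b, ?_, ?_⟩
  · have h1 := congr(F.map $hab)
    rw [Functor.map_add, Functor.map_sum, Functor.map_sum, CategoryTheory.Functor.map_id] at h1
    have h2 : ∑ j, F.map (a' j ≫ b' j) = 0 := by
      refine Finset.sum_eq_zero fun j _ => ?_
      rw [Functor.map_comp, h.isZero.eq_of_src (F.map (b' j)) 0, comp_zero]
    rw [h2, add_zero] at h1
    simpa only [Functor.map_comp] using h1
  · rw [← hab, add_sub_cancel_left]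
    exact sum_mem fun j _ => comp_mem_through _ _

theorem isSemisimpleModule (h : IsLocalTop F P M) (X : C) : IsSemisimpleModule R (F.obj X) := by
  obtain ⟨n, a, b, hab, -⟩ := h.sum_map_comp_map X
  have := h.simple
  refine IsSemisimpleModule.of_surjective
    (∑ j, (F.map (b j)).hom ∘ₗ LinearMap.proj j : (Fin n → F.obj P) →ₗ[R] F.obj X) fun y => ?_
  refine ⟨fun j => (F.map (a j)).hom y, ?_⟩
  have h1 := congr(ModuleCat.Hom.hom $hab y)
  rw [ModuleCat.hom_sum] at h1
  simpa using h1

/-- A map `P ⟶ X₀` can be lifted along `d` on tops, since these are semisimple, and fullness of `F`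
realises the lift. The error is killed by `F`; expanding it along the identity of `X₀` leaves terms
`r ≫ b` with `r` in the kernel of `F` on `End P`. Iterating accumulates such factors until
nilpotency makes their product zero. -/
theorem exists_sub_mem_through_of_epi (h : IsLocalTop F P M) {X₁ X₀ : C} (d : X₁ ⟶ X₀)
    (hd : Function.Surjective (F.map d)) (f : P ⟶ X₀) :
    ∃ y : P ⟶ X₁, f - y ≫ d ∈ through M P X₀ := by
  have := h.full
  have := h.isSemisimpleModule X₁
  obtain ⟨n, a, b, hab, hab'⟩ := h.sum_map_comp_map X₀
  -- The maps already of the required form: those factoring through `d`, plus sums of maps through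
  -- `M`.
  let U : AddSubgroup (P ⟶ X₀) := AddMonoidHom.range (Preadditive.rightComp P d) ⊔ through M P X₀
  have hU : ∀ (r : P ⟶ P) {g}, g ∈ U → r ≫ g ∈ U := by
    intro r g hg
    obtain ⟨_, ⟨y, rfl⟩, t, ht, rfl⟩ := AddSubgroup.mem_sup.1 hg
    rw [Preadditive.comp_add]
    refine AddSubgroup.add_mem_sup ⟨r ≫ y, ?_⟩ (precomp_mem_through r ht)
    simp [Preadditive.rightComp]
  have step : ∀ g : P ⟶ X₀, ∃ r : Fin n → End P, (∀ j, F.map (r j) = 0) ∧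
      g - ∑ j, r j ≫ b j ∈ U := by
    intro g
    obtain ⟨y', hy'⟩ := IsSemisimpleModule.lifting_property (F.map d).hom hd (F.map g).hom
    obtain ⟨y, hy⟩ := F.map_surjective (ModuleCat.ofHom y')
    have h0 : F.map (g - y ≫ d) = 0 := by
      rw [F.map_sub, F.map_comp, hy, sub_eq_zero]
      ext1
      exact hy'.symm
    refine ⟨fun j => (g - y ≫ d) ≫ a j, fun j => by rw [F.map_comp, h0, zero_comp], ?_⟩
    have h1 : g - ∑ j, ((g - y ≫ d) ≫ a j) ≫ b j =
        y ≫ d + (g - y ≫ d) ≫ (𝟙 X₀ - ∑ j, a j ≫ b j) := by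
      rw [Preadditive.comp_sub, Preadditive.comp_sum, Category.comp_id]
      simp only [Category.assoc]
      abel
    rw [h1]
    exact AddSubgroup.add_mem_sup ⟨y, rfl⟩ (precomp_mem_through _ hab')
  obtain ⟨m, hm⟩ := h.nilpotent
  -- The induction variable `k` counts the factors killed by `F` that are still missing from `l`; at
  -- `k = 0` the product of `l` vanishes.
  have key : ∀ k ≤ m, ∀ l : List (End P), l.length + k = m → (∀ r ∈ l, F.map r = 0) →
      ∀ g : P ⟶ X₀, prodHom l ≫ g ∈ U := by
    intro k
    induction k with
    | zero =>
      intro _ l hl hr g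
      rw [show prodHom l = 0 from hm l hl hr, zero_comp]
      exact zero_mem _
    | succ k ih =>
      intro hk l hl hr g
      obtain ⟨r, hr0, hrU⟩ := step g
      have h1 : prodHom l ≫ g = prodHom l ≫ (g - ∑ j, r j ≫ b j) +
          ∑ j, prodHom (r j :: l) ≫ b j := by
        rw [Preadditive.comp_sub, Preadditive.comp_sum]
        simp only [prodHom_cons, Category.assoc]
        abel
      rw [h1]
      refine add_mem (hU _ hrU) (sum_mem fun j _ => ih (by lia) _ ?_ ?_ _)
      · rw [List.length_cons]; lia
      · intro s hs
        rcases List.mem_cons.1 hs with rfl | hs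
        · exact hr0 j
        · exact hr s hs
  have h2 := key m le_rfl [] (by simp) (by simp) f
  obtain ⟨_, ⟨y, rfl⟩, t, ht, h3⟩ := AddSubgroup.mem_sup.1 h2
  refine ⟨y, ?_⟩
  have h4 : f = y ≫ d + t := by
    refine Eq.trans ?_ h3.symm
    exact (Category.id_comp f).symm
  rw [h4, add_sub_cancel_left]
  exact ht

/-- The dual argument: maps on tops extend along an injection into a semisimple module, the identity
of `X₁` is expanded, and each new factor is composed before the existing product, hence appended to
the list. -/
theorem exists_sub_mem_through_of_mono (h : IsLocalTop F P M) {X₁ X₀ : C} (d : X₁ ⟶ X₀)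
    (hd : Function.Injective (F.map d)) (f : X₁ ⟶ P) :
    ∃ y : X₀ ⟶ P, f - d ≫ y ∈ through M X₁ P := by
  have := h.full
  have := h.isSemisimpleModule X₀
  obtain ⟨n, a, b, hab, hab'⟩ := h.sum_map_comp_map X₁
  let U : AddSubgroup (X₁ ⟶ P) := AddMonoidHom.range (Preadditive.leftComp P d) ⊔ through M X₁ P
  have hU : ∀ (r : P ⟶ P) {g}, g ∈ U → g ≫ r ∈ U := by
    intro r g hg
    obtain ⟨_, ⟨y, rfl⟩, t, ht, rfl⟩ := AddSubgroup.mem_sup.1 hg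
    rw [Preadditive.add_comp]
    refine AddSubgroup.add_mem_sup ⟨y ≫ r, ?_⟩ (postcomp_mem_through ht r)
    simp [Preadditive.leftComp]
  have step : ∀ g : X₁ ⟶ P, ∃ r : Fin n → End P, (∀ j, F.map (r j) = 0) ∧
      g - ∑ j, a j ≫ r j ∈ U := by
    intro g
    obtain ⟨y', hy'⟩ := IsSemisimpleModule.extension_property (F.map d).hom hd (F.map g).hom
    obtain ⟨y, hy⟩ := F.map_surjective (ModuleCat.ofHom y')
    have h0 : F.map (g - d ≫ y) = 0 := by
      rw [F.map_sub, F.map_comp, hy, sub_eq_zero]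
      ext1
      exact hy'.symm
    refine ⟨fun j => b j ≫ (g - d ≫ y), fun j => by rw [F.map_comp, h0, comp_zero], ?_⟩
    have h1 : g - ∑ j, a j ≫ b j ≫ (g - d ≫ y) =
        d ≫ y + (𝟙 X₁ - ∑ j, a j ≫ b j) ≫ (g - d ≫ y) := by
      rw [Preadditive.sub_comp, Preadditive.sum_comp, Category.id_comp]
      simp only [Category.assoc]
      abel
    rw [h1]
    exact AddSubgroup.add_mem_sup ⟨y, rfl⟩ (postcomp_mem_through hab' _)
  obtain ⟨m, hm⟩ := h.nilpotent
  have key : ∀ k ≤ m, ∀ l : List (End P), l.length + k = m → (∀ r ∈ l, F.map r = 0) →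
      ∀ g : X₁ ⟶ P, g ≫ prodHom l ∈ U := by
    intro k
    induction k with
    | zero =>
      intro _ l hl hr g
      rw [show prodHom l = 0 from hm l hl hr, comp_zero]
      exact zero_mem _
    | succ k ih =>
      intro hk l hl hr g
      obtain ⟨r, hr0, hrU⟩ := step g
      have h1 : g ≫ prodHom l = (g - ∑ j, a j ≫ r j) ≫ prodHom l +
          ∑ j, a j ≫ prodHom (l ++ [r j]) := by
        rw [Preadditive.sub_comp, Preadditive.sum_comp]
        simp only [prodHom_append, Category.assoc]
        abel
      rw [h1]
      refine add_mem (hU _ hrU) (sum_mem fun j _ => ih (by lia) _ ?_ ?_ _)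
      · rw [List.length_append, List.length_singleton]; lia
      · intro s hs
        rcases List.mem_append.1 hs with hs | hs
        · exact hr s hs
        · rw [List.mem_singleton.1 hs]
          exact hr0 j
  have h2 := key m le_rfl [] (by simp) (by simp) f
  obtain ⟨_, ⟨y, rfl⟩, t, ht, h3⟩ := AddSubgroup.mem_sup.1 h2
  refine ⟨y, ?_⟩
  have h4 : f = d ≫ y + t := by
    refine Eq.trans ?_ h3.symm
    exact (Category.comp_id f).symm
  rw [h4, add_sub_cancel_left]
  exact ht

end IsLocalTop

end Nakayama

/-! ### Stalk complexes and the homology of `F T` -/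

section Homology

variable {A : Type u} [Ring A]

/-- The functor `stalk`. -/
noncomputable def stalkFunctor (A : Type u) [Ring A] : FGProj A ⥤ Kb A :=
  (isBounded A).lift (HomotopyCategory.singleFunctor (FGProj A) 0) fun M => (stalk M).property

instance : (stalkFunctor A).Additive where
  map_add {X Y f g} := by
    apply ObjectProperty.hom_ext
    exact (HomotopyCategory.singleFunctor (FGProj A) 0).map_add

section
variable {C : Type*} [Category* C] [Preadditive C]

/-- Both correction terms of a homotopy in degree `0` contain one of the two vanishing
differentials. This gives faithfulness of the embedding in degree `0`. -/
theorem _root_.Homotopy.f_eq_of_d_eq_zero {K L : CochainComplex C ℤ} {f g : K ⟶ L}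
    (h : Homotopy f g) (hK : K.d 0 1 = 0) (hL : L.d (-1) 0 = 0) : f.f 0 = g.f 0 := by
  rw [h.comm 0, dNext_eq _ (i' := 1) (by simp), prevD_eq _ (j' := -1) (by simp), hK, hL,
    zero_comp, comp_zero, zero_add, zero_add]

variable [HasZeroObject C]

instance (n : ℤ) : (HomotopyCategory.singleFunctor C n).Full :=
  inferInstanceAs (CochainComplex.singleFunctor C n ⋙ HomotopyCategory.quotient C (ComplexShape.up ℤ)).Full

theorem homotopyCategory_single_faithful : (HomotopyCategory.singleFunctor C 0).Faithful where
  map_injective {X Y f g} h := by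
    have h1 : (HomotopyCategory.quotient C (ComplexShape.up ℤ)).map
      ((CochainComplex.singleFunctor C 0).map f) = (HomotopyCategory.quotient C (ComplexShape.up ℤ)).map
      ((CochainComplex.singleFunctor C 0).map g) := h
    have h2 := HomotopyCategory.homotopyOfEq _ _ h1
    apply (CochainComplex.singleFunctor C 0).map_injective
    apply HomologicalComplex.from_single_hom_ext
    exact h2.f_eq_of_d_eq_zero rfl rfl

end

instance : (HomotopyCategory.singleFunctor (FGProj A) 0).Faithful := homotopyCategory_single_faithful

instance : (stalkFunctor A).Full where
  map_surjective {X Y} f := by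
    obtain ⟨g, hg⟩ := (HomotopyCategory.singleFunctor (FGProj A) 0).map_surjective f.hom
    exact ⟨g, ObjectProperty.hom_ext _ hg⟩

instance : (stalkFunctor A).Faithful where
  map_injective h :=
    (HomotopyCategory.singleFunctor (FGProj A) 0).map_injective congr(($h).hom)

variable {R : Type u} [Ring R] (F : FGProj A ⥤ ModuleCat.{u} R) [F.Additive]

/-- The homology of the image of a complex under an additive functor. -/
noncomputable def homologyOf (n : ℤ) : Kb A ⥤ ModuleCat.{u} R :=
  ((isBounded A).ι ⋙ F.mapHomotopyCategory (ComplexShape.up ℤ)) ⋙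
    HomotopyCategory.homologyFunctor (ModuleCat.{u} R) (ComplexShape.up ℤ) n

instance (n : ℤ) : (homologyOf F n).Additive := by unfold homologyOf; infer_instance

theorem homologyOf_exact (n : ℤ) (T : Triangle (Kb A)) (hT : T ∈ distTriang _) :
    Function.Exact ((homologyOf F n).map T.mor₁) ((homologyOf F n).map T.mor₂) := by
  have h1 := Functor.map_distinguished ((isBounded A).ι ⋙ F.mapHomotopyCategory (ComplexShape.up ℤ)) T hT
  have h2 := (HomotopyCategory.homologyFunctor (ModuleCat.{u} R) (ComplexShape.up ℤ) 0).homologySequence_exact₂ _ h1 n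
  exact (ShortComplex.ShortExact.moduleCat_exact_iff_function_exact _).1 h2

instance : (homologyOf F 0).IsHomological := by unfold homologyOf; infer_instance

/-- `Hⁿ(X⟦a⟧) ≅ Hᵃ⁺ⁿ(X)`. -/
noncomputable def homologyOfShift (a n m : ℤ) (h : a + n = m) :
    shiftFunctor (Kb A) a ⋙ homologyOf F n ≅ homologyOf F m :=
  Functor.isoWhiskerRight
    (((isBounded A).ι ⋙ F.mapHomotopyCategory (ComplexShape.up ℤ)).commShiftIso a)
    (HomotopyCategory.homologyFunctor (ModuleCat.{u} R) (ComplexShape.up ℤ) n) ≪≫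
    Functor.isoWhiskerLeft ((isBounded A).ι ⋙ F.mapHomotopyCategory (ComplexShape.up ℤ))
      ((HomotopyCategory.homologyFunctor (ModuleCat.{u} R) (ComplexShape.up ℤ) 0).shiftIso a n m h)

/-- The homology of the image of a stalk complex. -/
noncomputable def stalkHomology (n : ℤ) : stalkFunctor A ⋙ homologyOf F n ≅
    F ⋙ HomologicalComplex.single _ (ComplexShape.up ℤ) 0 ⋙ HomologicalComplex.homologyFunctor (ModuleCat.{u} R) (ComplexShape.up ℤ) n :=
  show CochainComplex.singleFunctor (FGProj A) 0 ⋙ F.mapHomologicalComplex (ComplexShape.up ℤ) ⋙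
    HomotopyCategory.quotient (ModuleCat.{u} R) (ComplexShape.up ℤ) ⋙ HomotopyCategory.homologyFunctor (ModuleCat.{u} R) (ComplexShape.up ℤ) n ≅ _ from
  Functor.isoWhiskerLeft (CochainComplex.singleFunctor (FGProj A) 0 ⋙ F.mapHomologicalComplex (ComplexShape.up ℤ)) (HomotopyCategory.homologyFunctorFactors _ _ _)  ≪≫
   Functor.isoWhiskerRight (HomologicalComplex.singleMapHomologicalComplex F (ComplexShape.up ℤ) 0) (HomologicalComplex.homologyFunctor (ModuleCat.{u} R) (ComplexShape.up ℤ) n)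

/-- The zeroth homology of the image of a stalk complex. -/
noncomputable def stalkHomologyZero : stalkFunctor A ⋙ homologyOf F 0 ≅ F :=
  stalkHomology F 0 ≪≫ Functor.isoWhiskerLeft F (HomologicalComplex.homologyFunctorSingleIso _ _ _) ≪≫ F.rightUnitor

theorem isZero_homologyOf_stalk (n : ℤ) (hn : n ≠ 0) (X : FGProj A) : IsZero ((homologyOf F n).obj (stalk X)) :=
  (HomologicalComplex.isZero_single_obj_homology _ _ _ _ hn).of_iso ((stalkHomology F n).app X)

end Homology

/-! ### Objects between `A` and `A[1]` are two-term complexes -/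

section TwoTerm

section

variable {C : Type*} [Category* C] [Preadditive C] [HasZeroObject C] [HasShift C ℤ]
  [∀ n : ℤ, (shiftFunctor C n).Additive] [Pretriangulated C]

theorem mk_distinguished_of_iso₃ {X Y Z Z' : C} {f : X ⟶ Y} {g : Y ⟶ Z} {w : Z ⟶ X⟦(1 : ℤ)⟧}
    (h : Triangle.mk f g w ∈ distTriang C) (e : Z ≅ Z') :
    Triangle.mk f (g ≫ e.hom) (e.inv ≫ w) ∈ distTriang C :=
  isomorphic_distinguished _ h _
    (Triangle.isoMk _ _ (Iso.refl _) (Iso.refl _) e.symm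
      ((Category.comp_id _).trans (Category.id_comp _).symm) (show (g ≫ e.hom) ≫ e.inv = 𝟙 Y ≫ g by simp)
      (show (e.inv ≫ w) ≫ (𝟙 X)⟦(1 : ℤ)⟧' = e.inv ≫ w by simp))

/-- The sign in `-d` cancels the one that rotation puts on the shifted first map. -/
theorem mk_distinguished_of_rotate {X Y Z W : C} {g : X ⟶ Y} {w : Y ⟶ Z} {δ : Z ⟶ X⟦(1 : ℤ)⟧}
    (h : Triangle.mk g w δ ∈ distTriang C) (i : Z ≅ W⟦(1 : ℤ)⟧) (d : W ⟶ X)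
    (hd : d⟦(1 : ℤ)⟧' = i.inv ≫ δ) : Triangle.mk (-d) g (w ≫ i.hom) ∈ distTriang C :=
  (rotate_distinguished_triangle _).2 (isomorphic_distinguished _ h _
    (Triangle.isoMk _ _ (Iso.refl _) (Iso.refl _) i.symm
      ((Category.comp_id _).trans (Category.id_comp _).symm) (show (w ≫ i.hom) ≫ i.inv = 𝟙 Y ≫ w by simp)
      (show (-(-d)⟦(1 : ℤ)⟧') ≫ (𝟙 X)⟦(1 : ℤ)⟧' = i.inv ≫ δ by simp [hd])))

end

open HomotopyCategory

variable {A : Type u} [Ring A]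

/-- Objects of the form `cone (X₁ ⟶ X₀)` for `X₁`, `X₀` finitely generated projective modules. -/
def IsTwoTerm (T : Kb A) : Prop :=
  ∃ (X₁ X₀ : FGProj A) (d : X₁ ⟶ X₀) (g : (stalkFunctor A).obj X₀ ⟶ T)
    (w : T ⟶ ((stalkFunctor A).obj X₁)⟦(1 : ℤ)⟧),
    Triangle.mk ((stalkFunctor A).map d) g w ∈ distTriang (Kb A)

theorem IsTwoTerm.of_iso {T T' : Kb A} (e : T ≅ T') (h : IsTwoTerm T) : IsTwoTerm T' := by
  obtain ⟨X₁, X₀, d, g, w, hT⟩ := h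
  exact ⟨X₁, X₀, d, g ≫ e.hom, e.inv ≫ w, mk_distinguished_of_iso₃ hT e⟩

theorem forall_hom_obj_eq_zero {X Y : Kb A} {n : ℤ} (h : ∀ f : X ⟶ Y⟦n⟧, f = 0)
    (f : X.obj ⟶ Y.obj⟦n⟧) : f = 0 := by
  have h1 := h ⟨f ≫ (((isBounded A).ι.commShiftIso n).inv.app Y)⟩
  have h2 := congr(($h1).hom)
  change f ≫ (((isBounded A).ι.commShiftIso n).inv.app Y) = 0 at h2
  rwa [← cancel_mono (((isBounded A).ι.commShiftIso n).inv.app Y), zero_comp]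

/-- The vanishing of `Hom(A, T[n])` is the lifting property for `Q = A`; the decomposition of the
identity of `Q` through `A` spreads it to every projective, in particular to the terms of `T`. -/
theorem Geq.exists_lift {T : Kb A} (h : Geq (stalk (regular A)) T) (n p q : ℤ) (hn : 0 < n)
    (hp : p + 1 = n) (hq : n + 1 = q) (Q : FGProj A) (z : Q ⟶ T.obj.as.X n)
    (hz : z ≫ T.obj.as.d n q = 0) : ∃ y : Q ⟶ T.obj.as.X p, y ≫ T.obj.as.d p n = z := by
  have h1 := (forall_single_to_shift_eq_zero_iff (regular A) T.obj.as n p q hp hq).1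
    fun f => forall_hom_obj_eq_zero (X := stalk (regular A)) (Y := T) (h n hn) f
  obtain ⟨k, f, g, hfg⟩ := exists_sum_comp_regular Q
  have h2 : ∀ j, ∃ y, y ≫ T.obj.as.d p n = g j ≫ z := fun j =>
    h1 (g j ≫ z) (by rw [Category.assoc, hz, comp_zero])
  choose y hy using h2
  refine ⟨∑ j, f j ≫ y j, ?_⟩
  rw [Preadditive.sum_comp]
  simp only [Category.assoc, hy]
  simp only [← Category.assoc]
  rw [← Preadditive.sum_comp, hfg, Category.id_comp]

theorem Geq.exists_extension {T : Kb A} (h : Geq T ((stalk (regular A))⟦(1 : ℤ)⟧)) (m p q : ℤ)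
    (hm : m < -1) (hp : p + 1 = m) (hq : m + 1 = q) (Q : FGProj A) (z : T.obj.as.X m ⟶ Q)
    (hz : T.obj.as.d p m ≫ z = 0) : ∃ y : T.obj.as.X q ⟶ Q, T.obj.as.d m q ≫ y = z := by
  -- Since `A[-m] = A[1][-m - 1]`, the bound `m < -1` is precisely positivity of the remaining
  -- shift.
  have h0 : ∀ f : T ⟶ (stalk (regular A))⟦(-m : ℤ)⟧, f = 0 := by
    intro f
    let e := (shiftFunctorAdd' (Kb A) 1 (-m - 1) (-m) (by lia)).app (stalk (regular A))
    have := h (-m - 1) (by lia) (f ≫ e.hom)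
    rwa [← cancel_mono e.hom, zero_comp]
  have h1 := (forall_to_single_shift_eq_zero_iff (regular A) T.obj.as (-m) m p q (by lia) hp hq).1
    fun f => forall_hom_obj_eq_zero (X := T) (Y := stalk (regular A)) h0 f
  obtain ⟨k, f, g, hfg⟩ := exists_sum_comp_regular Q
  have h2 : ∀ j, ∃ y, T.obj.as.d m q ≫ y = z ≫ f j := fun j =>
    h1 (z ≫ f j) (by rw [← Category.assoc, hz, zero_comp])
  choose y hy using h2
  refine ⟨∑ j, y j ≫ g j, ?_⟩
  rw [Preadditive.comp_sum]
  simp only [← Category.assoc, hy]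
  simp only [Category.assoc]
  rw [← Preadditive.comp_sum, hfg, Category.comp_id]

/-- Induction on the top degree. The identity of the top term is a cocycle there, so it lifts along
the differential; the resulting split epimorphism cancels and the top degree drops. The lower bound
`a` is carried along untouched. -/
theorem exists_iso_isStrictlyLE (a : ℤ) (N : ℕ) : ∀ T : Kb A, Geq (stalk (regular A)) T →
    (∀ i : ℤ, N < i → IsZero (T.obj.as.X i)) → (∀ i : ℤ, i < a → IsZero (T.obj.as.X i)) →
    ∃ T' : Kb A, Nonempty (T ≅ T') ∧
      (∀ i : ℤ, 0 < i → IsZero (T'.obj.as.X i)) ∧ (∀ i : ℤ, i < a → IsZero (T'.obj.as.X i)) := by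
  induction N with
  | zero => exact fun T _ h1 h2 => ⟨T, ⟨Iso.refl T⟩, by simpa using h1, h2⟩
  | succ N ih =>
    intro T hT h1 h2
    obtain ⟨s, hs⟩ := hT.exists_lift (N + 1) N (N + 1 + 1) (by lia) rfl rfl _
      (𝟙 (T.obj.as.X (N + 1))) ((h1 _ (by push_cast; lia)).eq_of_tgt _ _)
    obtain ⟨L, ⟨e⟩, hL, hL', -⟩ := exists_iso_of_regular T.obj.as N (N + 1) rfl s
      (by rw [hs, Category.comp_id]) (by rw [← Category.assoc, hs, Category.id_comp])
    have hL1 : ∀ i : ℤ, N < i → IsZero (L.X i) := by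
      intro i hi
      rcases eq_or_ne i (N + 1) with rfl | hi'
      · exact hL' hs
      · exact hL i (h1 i (by push_cast; lia))
    have hL2 : ∀ i : ℤ, i < a → IsZero (L.X i) := fun i hi => hL i (h2 i hi)
    let T₁ : Kb A := ⟨(HomotopyCategory.quotient _ _).obj L, a, N,
      (CochainComplex.isStrictlyGE_iff _ _).2 hL2, (CochainComplex.isStrictlyLE_iff _ _).2 hL1⟩
    have e₁ : T ≅ T₁ := (isBounded A).isoMk e
    obtain ⟨T', ⟨e'⟩, h⟩ := ih T₁ (hT.of_iso (Iso.refl _) e₁) hL1 hL2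
    exact ⟨T', ⟨e₁ ≪≫ e'⟩, h⟩

/-- The same cancellation at the bottom: the identity of the lowest term extends along the
differential, which is then a split monomorphism. Here `N` bounds the number of terms below degree
`-1`. -/
theorem exists_iso_isStrictlyGE (N : ℕ) : ∀ T : Kb A, Geq T ((stalk (regular A))⟦(1 : ℤ)⟧) →
    (∀ i : ℤ, 0 < i → IsZero (T.obj.as.X i)) → (∀ i : ℤ, i < -1 - N → IsZero (T.obj.as.X i)) →
    ∃ T' : Kb A, Nonempty (T ≅ T') ∧
      (∀ i : ℤ, 0 < i → IsZero (T'.obj.as.X i)) ∧ (∀ i : ℤ, i < -1 → IsZero (T'.obj.as.X i)) := by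
  induction N with
  | zero => exact fun T _ h1 h2 => ⟨T, ⟨Iso.refl T⟩, h1, by simpa using h2⟩
  | succ N ih =>
    intro T hT h1 h2
    have hN : (-1 - N - 1 : ℤ) + 1 = -1 - N := by lia
    obtain ⟨s, hs⟩ := hT.exists_extension (-1 - N - 1) (-1 - N - 1 - 1) (-1 - N) (by lia) (by lia)
      hN _ (𝟙 (T.obj.as.X (-1 - N - 1))) ((h2 _ (by push_cast; lia)).eq_of_src _ _)
    obtain ⟨L, ⟨e⟩, hL, -, hL'⟩ := exists_iso_of_regular T.obj.as (-1 - N - 1) (-1 - N) hN s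
      (by rw [← Category.assoc, hs, Category.id_comp]) (by rw [hs, Category.comp_id])
    have hL1 : ∀ i : ℤ, i < -1 - N → IsZero (L.X i) := by
      intro i hi
      rcases eq_or_ne i (-1 - N - 1) with rfl | hi'
      · exact hL' hs
      · exact hL i (h2 i (by push_cast; lia))
    have hL2 : ∀ i : ℤ, 0 < i → IsZero (L.X i) := fun i hi => hL i (h1 i hi)
    let T₁ : Kb A := ⟨(HomotopyCategory.quotient _ _).obj L, -1 - N, 0,
      (CochainComplex.isStrictlyGE_iff _ _).2 hL1, (CochainComplex.isStrictlyLE_iff _ _).2 hL2⟩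
    have e₁ : T ≅ T₁ := (isBounded A).isoMk e
    obtain ⟨T', ⟨e'⟩, h⟩ := ih T₁ (hT.of_iso e₁ (Iso.refl _)) hL2 hL1
    exact ⟨T', ⟨e₁ ≪≫ e'⟩, h⟩

section

variable {C : Type*} [Category* C] [Preadditive C] [HasZeroObject C]

/-- A short complex whose first map is an isomorphism and whose last term vanishes is split. -/
noncomputable def splittingOfIsIsoLeft (S : ShortComplex C) [IsIso S.f] (h : IsZero S.X₃) :
    S.Splitting where
  r := inv S.f
  s := 0
  s_g := h.eq_of_src _ _

/-- A short complex whose last map is an isomorphism and whose first term vanishes is split. -/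
noncomputable def splittingOfIsIsoRight (S : ShortComplex C) [IsIso S.g] (h : IsZero S.X₁) :
    S.Splitting where
  r := 0
  s := inv S.g
  f_r := h.eq_of_src _ _

/-- The degreewise split short exact sequence attached to a complex in degrees `-1` and `0`. -/
noncomputable def stupidShortComplex (K : CochainComplex C ℤ) (h0 : IsZero (K.X 1))
    (h1 : IsZero (K.X (-2))) : ShortComplex (CochainComplex C ℤ) where
  X₁ := (CochainComplex.singleFunctor C 0).obj (K.X 0)
  X₂ := K
  X₃ := (CochainComplex.singleFunctor C (-1)).obj (K.X (-1))
  f := HomologicalComplex.mkHomFromSingle (𝟙 _) fun k hk => by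
    obtain rfl : 1 = k := by simpa using hk
    exact h0.eq_of_tgt _ _
  g := HomologicalComplex.mkHomToSingle (𝟙 _) fun k hk => by
    obtain rfl : k = -2 := by
      have : k + 1 = -1 := hk
      lia
    exact h1.eq_of_src _ _
  zero := by
    apply HomologicalComplex.from_single_hom_ext
    exact (HomologicalComplex.isZero_single_obj_X _ _ _ _ (by lia)).eq_of_tgt _ _

theorem exists_splitting_stupidShortComplex (K : CochainComplex C ℤ)
    (h0 : ∀ i : ℤ, 0 < i → IsZero (K.X i)) (h1 : ∀ i : ℤ, i < -1 → IsZero (K.X i)) (n : ℤ) :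
    Nonempty ((((stupidShortComplex K (h0 _ (by lia)) (h1 _ (by lia)))).map
      (HomologicalComplex.eval C _ n)).Splitting) := by
  have hX₁ : n ≠ 0 → IsZero (((stupidShortComplex K (h0 _ (by lia)) (h1 _ (by lia))).X₁).X n) :=
    HomologicalComplex.isZero_single_obj_X _ _ _ _
  have hX₃ : n ≠ -1 → IsZero (((stupidShortComplex K (h0 _ (by lia)) (h1 _ (by lia))).X₃).X n) :=
    HomologicalComplex.isZero_single_obj_X _ _ _ _
  rcases eq_or_ne n 0 with rfl | hn0
  · have : IsIso (((stupidShortComplex K (h0 _ (by lia)) (h1 _ (by lia)))).map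
      (HomologicalComplex.eval C _ 0)).f := by
      change IsIso ((stupidShortComplex K _ _).f.f 0)
      unfold stupidShortComplex
      rw [HomologicalComplex.mkHomFromSingle_f]
      exact @IsIso.comp_isIso _ _ _ _ _ _ _ (Iso.isIso_hom _) (IsIso.id _)
    exact ⟨splittingOfIsIsoLeft _ (hX₃ (by lia))⟩
  rcases eq_or_ne n (-1) with rfl | hn1
  · have : IsIso (((stupidShortComplex K (h0 _ (by lia)) (h1 _ (by lia)))).map
      (HomologicalComplex.eval C _ (-1))).g := by
      change IsIso ((stupidShortComplex K _ _).g.f (-1))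
      unfold stupidShortComplex
      rw [HomologicalComplex.mkHomToSingle_f]
      exact @IsIso.comp_isIso _ _ _ _ _ _ _ (IsIso.id _) (Iso.isIso_inv _)
    exact ⟨splittingOfIsIsoRight _ (hX₁ (by lia))⟩
  · have hK : IsZero (K.X n) := by
      rcases lt_or_ge 0 n with h | h
      · exact h0 n h
      · exact h1 n (by lia)
    exact ⟨{ r := 0, s := 0, f_r := (hX₁ hn0).eq_of_src _ _, s_g := (hX₃ hn1).eq_of_src _ _
             id := hK.eq_of_src _ _ }⟩

end

/-- The brutal truncation of a complex in degrees `-1` and `0` is a degreewise split sequence. Its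
triangle, rotated back, exhibits `T` as the cone of a map of stalk complexes, and such a map comes
from a module map by fullness. -/
theorem isTwoTerm_of_isZero (T : Kb A) (h0 : ∀ i : ℤ, 0 < i → IsZero (T.obj.as.X i))
    (h1 : ∀ i : ℤ, i < -1 → IsZero (T.obj.as.X i)) : IsTwoTerm T := by
  let S := stupidShortComplex T.obj.as (h0 _ (by lia)) (h1 _ (by lia))
  let σ : ∀ n, (S.map (HomologicalComplex.eval _ _ n)).Splitting := fun n =>
    (exists_splitting_stupidShortComplex T.obj.as h0 h1 n).some
  have hS : CochainComplex.trianglehOfDegreewiseSplit S σ ∈ distTriang _ :=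
    (HomotopyCategory.distinguished_iff_iso_trianglehOfDegreewiseSplit _).2
      ⟨S, σ, ⟨Iso.refl _⟩⟩
  let g : stalk (T.obj.as.X 0) ⟶ T := ⟨(HomotopyCategory.quotient _ _).map S.f⟩
  -- The truncation triangle lives among unbounded complexes. Completing `g` inside `Kb A` and
  -- comparing the two cones brings it into the bounded category.
  obtain ⟨Z, w, δ, hZ⟩ := distinguished_cocone_triangle g
  have hZ' := (isBounded A).ι.map_distinguished _ hZ
  have e : Z.obj ≅ (HomotopyCategory.singleFunctor (FGProj A) (-1)).obj (T.obj.as.X (-1)) :=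
    Triangle.π₃.mapIso (isoTriangleOfIso₁₂ _ _ hZ' hS (Iso.refl _) (Iso.refl _)
      ((Category.comp_id _).trans (Category.id_comp _).symm))
  let X₁ := T.obj.as.X (-1)
  have e' : Z.obj ≅ ((stalk X₁)⟦(1 : ℤ)⟧).obj :=
    e ≪≫ ((HomotopyCategory.singleFunctors (FGProj A)).shiftIso 1 (-1) 0 (by lia)).symm.app X₁ ≪≫
      ((isBounded A).ι.commShiftIso (1 : ℤ)).symm.app (stalk X₁)
  let i : Z ≅ (stalk X₁)⟦(1 : ℤ)⟧ := (isBounded A).isoMk e'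
  obtain ⟨b, hb⟩ := (shiftFunctor (Kb A) (1 : ℤ)).map_surjective (i.inv ≫ δ)
  obtain ⟨d, rfl⟩ := (stalkFunctor A).map_surjective b
  refine ⟨X₁, _, -d, g, w ≫ i.hom, ?_⟩
  rw [Functor.map_neg]
  exact mk_distinguished_of_rotate hZ i _ hb

theorem isTwoTerm_of_geq (T : Kb A) (h : Geq (stalk (regular A)) T)
    (h' : Geq T ((stalk (regular A))⟦(1 : ℤ)⟧)) : IsTwoTerm T := by
  obtain ⟨a, b, ha, hb⟩ := T.property
  rw [CochainComplex.isStrictlyGE_iff] at ha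
  rw [CochainComplex.isStrictlyLE_iff] at hb
  obtain ⟨T₁, ⟨e₁⟩, h1, h2⟩ := exists_iso_isStrictlyLE a b.toNat T h
    (fun i hi => hb i (by lia)) (fun i hi => ha i hi)
  obtain ⟨T₂, ⟨e₂⟩, h3, h4⟩ := exists_iso_isStrictlyGE (-1 - a).toNat T₁
    (h'.of_iso e₁ (Iso.refl _)) h1 (fun i hi => h2 i (by lia))
  exact (isTwoTerm_of_isZero T₂ h3 h4).of_iso (e₁ ≪≫ e₂).symm

end TwoTerm

/-! ### The relation `≥` under summands, sums and cones -/

section Triangulated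

variable {C : Type*} [Category* C] [Preadditive C]

theorem map_mem_through {D : Type*} [Category* D] [Preadditive D] (F : C ⥤ D) [F.Additive]
    {M X Y : C} {f : X ⟶ Y} (hf : f ∈ through M X Y) :
    F.map f ∈ through (F.obj M) (F.obj X) (F.obj Y) := by
  induction hf using AddSubgroup.closure_induction with
  | mem f hf =>
    obtain ⟨a, b, rfl⟩ := hf
    rw [F.map_comp]
    exact comp_mem_through _ _
  | zero => rw [F.map_zero]; exact zero_mem _
  | add f f' _ _ h h' => rw [F.map_add]; exact add_mem h h'
  | neg f _ h => rw [F.map_neg]; exact neg_mem h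

theorem map_eq_zero_of_mem_through {D : Type*} [Category* D] [Preadditive D] (F : C ⥤ D)
    [F.Additive] {M X Y : C} (hM : IsZero (F.obj M)) {f : X ⟶ Y} (hf : f ∈ through M X Y) :
    F.map f = 0 := by
  induction hf using AddSubgroup.closure_induction with
  | mem f hf =>
    obtain ⟨a, b, rfl⟩ := hf
    rw [F.map_comp, hM.eq_of_src (F.map b) 0, comp_zero]
  | zero => rw [F.map_zero]
  | add f f' _ _ h h' => rw [F.map_add, h, h', add_zero]
  | neg f _ h => rw [F.map_neg, h, neg_zero]

/-- A morphism which factors through `M` remains so if `M` is replaced by an isomorphic object. -/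
theorem mem_through_of_iso {M M' X Y : C} (e : M ≅ M') {f : X ⟶ Y} (hf : f ∈ through M X Y) :
    f ∈ through M' X Y := by
  induction hf using AddSubgroup.closure_induction with
  | mem f hf =>
    obtain ⟨a, b, rfl⟩ := hf
    have : a ≫ b = (a ≫ e.hom) ≫ e.inv ≫ b := by simp
    rw [this]
    exact comp_mem_through _ _
  | zero => exact zero_mem _
  | add f f' _ _ h h' => exact add_mem h h'
  | neg f _ h => exact neg_mem h

variable [HasShift C ℤ]

theorem Geq.of_retract {T T' U : C} (r : Retract T' T) (h : Geq T U) : Geq T' U := by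
  intro i hi f
  have h1 := h i hi (r.r ≫ f)
  calc f = r.i ≫ r.r ≫ f := by simp
    _ = 0 := by rw [h1, comp_zero]

theorem Geq.of_retract_right {T U U' : C} (r : Retract U' U) (h : Geq T U) : Geq T U' := by
  intro i hi f
  have h1 := h i hi (f ≫ r.i⟦i⟧')
  calc f = (f ≫ r.i⟦i⟧') ≫ r.r⟦i⟧' := by simp [← Functor.map_comp]
    _ = 0 := by rw [h1, zero_comp]

variable [∀ n : ℤ, (shiftFunctor C n).Additive]

theorem forall_hom_shift_eq_zero_iff (X Y : C) (a b n : ℤ) (h : n + a = b) :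
    (∀ f : X⟦a⟧ ⟶ Y⟦b⟧, f = 0) ↔ ∀ f : X ⟶ Y⟦n⟧, f = 0 := by
  let e := (shiftFunctorAdd' C n a b h).app Y
  constructor
  · intro H f
    apply (shiftFunctor C a).map_injective
    have h1 := H (f⟦a⟧' ≫ e.inv)
    rw [Functor.map_zero, ← cancel_mono e.inv, h1, zero_comp]
  · intro H f
    obtain ⟨g, hg⟩ := (shiftFunctor C a).map_surjective (f ≫ e.hom)
    rw [H g, Functor.map_zero] at hg
    rw [← cancel_mono e.hom, ← hg, zero_comp]

variable [HasZeroObject C] [Pretriangulated C]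

theorem isZero_of_add [HasFiniteBiproducts C] {D : Type*} [Category* D] [Preadditive D] (F : C ⥤ D)
    [F.Additive] {M N : C} (hM : IsZero (F.obj M)) (hN : Add M N) : IsZero (F.obj N) := by
  obtain ⟨n, ⟨r⟩⟩ := hN
  have h := biproduct.total (f := fun _ : Fin n => M)
  have h1 : 𝟙 N = ∑ j, (r.i ≫ biproduct.π (fun _ : Fin n => M) j) ≫
      (biproduct.ι (fun _ : Fin n => M) j ≫ r.r) := by
    have h2 : 𝟙 N = r.i ≫ 𝟙 _ ≫ r.r := by simp
    rw [h2, ← h, Preadditive.sum_comp, Preadditive.comp_sum]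
    simp
  rw [IsZero.iff_id_eq_zero, ← CategoryTheory.Functor.map_id, h1]
  exact map_eq_zero_of_mem_through F hM (sum_mem fun j _ => comp_mem_through _ _)

/-- `⨁ M ≥ U` if `M ≥ U`. -/
theorem Geq.biproduct [HasFiniteBiproducts C] {M U : C} (h : Geq M U) (n : ℕ) :
    Geq (⨁ fun _ : Fin n => M) U := fun i hi f =>
  biproduct.hom_ext' _ _ fun j => (h i hi _).trans comp_zero.symm

theorem Geq.add_left [HasFiniteBiproducts C] {M N U : C} (h : Geq M U) (hN : Add M N) :
    Geq N U := by
  obtain ⟨n, ⟨r⟩⟩ := hN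
  exact (h.biproduct n).of_retract r

theorem Geq.biproduct_right [HasFiniteBiproducts C] {T M : C} (h : Geq T M) (n : ℕ) :
    Geq T (⨁ fun _ : Fin n => M) := fun i hi f => by
  have h1 : 𝟙 (⨁ fun _ : Fin n => M) = _ := (biproduct.total (f := fun _ : Fin n => M)).symm
  have h2 : f = f ≫ (𝟙 (⨁ fun _ : Fin n => M))⟦i⟧' := by simp
  rw [h2, h1, Functor.map_sum, Preadditive.comp_sum]
  refine Finset.sum_eq_zero fun j _ => ?_
  rw [Functor.map_comp, ← Category.assoc, h i hi (f ≫ _), zero_comp]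

theorem Geq.add_right [HasFiniteBiproducts C] {T M N : C} (h : Geq T M) (hN : Add M N) :
    Geq T N := by
  obtain ⟨n, ⟨r⟩⟩ := hN
  exact (h.biproduct_right n).of_retract_right r

theorem Geq.biprod_left [HasBinaryBiproducts C] {X Y U : C} (h : Geq X U) (h' : Geq Y U) :
    Geq (X ⊞ Y) U := fun i hi f => by
  ext
  · exact (h i hi _).trans comp_zero.symm
  · exact (h' i hi _).trans comp_zero.symm

theorem Geq.biprod_right [HasBinaryBiproducts C] {T X Y : C} (h : Geq T X) (h' : Geq T Y) :
    Geq T (X ⊞ Y) := fun i hi f => by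
  have h2 : f = f ≫ (𝟙 (X ⊞ Y))⟦i⟧' := by simp
  rw [h2, ← biprod.total, Functor.map_add, Preadditive.comp_add, Functor.map_comp, Functor.map_comp,
    ← Category.assoc, ← Category.assoc, h i hi (f ≫ _), h' i hi (f ≫ _), zero_comp, zero_comp,
    add_zero]

section

variable {X Y Z T : C} {f : X ⟶ Y} {g : Y ⟶ Z} {d : Z ⟶ X⟦(1 : ℤ)⟧}

theorem exists_eq_mor₃_comp (h : Triangle.mk f g d ∈ distTriang C) (x : Z ⟶ T) (hx : g ≫ x = 0) :
    ∃ y : X⟦(1 : ℤ)⟧ ⟶ T, x = d ≫ y :=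
  Triangle.yoneda_exact₃ _ h x hx

theorem exists_eq_shift_mor₁_comp (h : Triangle.mk f g d ∈ distTriang C) (x : X⟦(1 : ℤ)⟧ ⟶ T)
    (hx : d ≫ x = 0) : ∃ y : Y⟦(1 : ℤ)⟧ ⟶ T, x = -f⟦(1 : ℤ)⟧' ≫ y := by
  obtain ⟨y, hy⟩ := Triangle.yoneda_exact₂ _
    (rot_of_distTriang _ (rot_of_distTriang _ h)) x hx
  exact ⟨y, hy.trans (Preadditive.neg_comp ..)⟩

theorem exists_eq_comp_mor₂ (h : Triangle.mk f g d ∈ distTriang C) (x : T ⟶ Z) (hx : x ≫ d = 0) :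
    ∃ y : T ⟶ Y, x = y ≫ g :=
  Triangle.coyoneda_exact₃ _ h x hx

theorem exists_eq_comp_mor₃ (h : Triangle.mk f g d ∈ distTriang C) (x : T ⟶ X⟦(1 : ℤ)⟧)
    (hx : x ≫ f⟦(1 : ℤ)⟧' = 0) : ∃ y : T ⟶ Z, x = y ≫ d :=
  Triangle.coyoneda_exact₁ _ h x hx

theorem mor₁_comp_mor₂ (h : Triangle.mk f g d ∈ distTriang C) : f ≫ g = 0 :=
  comp_distTriang_mor_zero₁₂ _ h

theorem mor₂_comp_mor₃ (h : Triangle.mk f g d ∈ distTriang C) : g ≫ d = 0 :=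
  comp_distTriang_mor_zero₂₃ _ h

theorem mor₃_comp_shift_mor₁ (h : Triangle.mk f g d ∈ distTriang C) : d ≫ f⟦(1 : ℤ)⟧' = 0 :=
  comp_distTriang_mor_zero₃₁ _ h

end


/-- A morphism out of `X` factors through `X ⟶ M'` if it vanishes on the cone `Y⟦-1⟧ ⟶ X`. -/
theorem exists_comp_eq_of_geq {X M' Y T : C} {f : X ⟶ M'} {g : M' ⟶ Y} {d : Y ⟶ X⟦(1 : ℤ)⟧}
    (h : Triangle.mk f g d ∈ distTriang C) (hY : Geq Y T) (a : X ⟶ T) :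
    ∃ c : M' ⟶ T, a = f ≫ c := by
  obtain ⟨c, hc⟩ := exists_eq_shift_mor₁_comp h (a⟦(1 : ℤ)⟧') (hY 1 one_pos _)
  obtain ⟨c, rfl⟩ := (shiftFunctor C (1 : ℤ)).map_surjective c
  refine ⟨-c, (shiftFunctor C (1 : ℤ)).map_injective ?_⟩
  rw [hc, Functor.map_comp, Functor.map_neg, Preadditive.comp_neg]

/-- Apply `Hom(-, T)` to the triangle: a map `Y ⟶ T[i]` comes from `X[1] ⟶ T[i]`. For `i > 1` this
vanishes by `X ≥ T`. For `i = 1` it is the shift of a map `X ⟶ T`, which extends over `f` by the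
approximation property and so dies on `Y`. -/
theorem geq_cone {X M' Y M T : C} {f : X ⟶ M'} {g : M' ⟶ Y} {d : Y ⟶ X⟦(1 : ℤ)⟧}
    (h : Triangle.mk f g d ∈ distTriang C) (hX : Geq X T) (hM : Geq M' T)
    (hM' : ∀ a : X ⟶ M, ∃ c, a = f ≫ c)
    (hT : ∀ a : X ⟶ T, a ∈ through M X T) : Geq Y T := by
  have h0 : ∀ a : X ⟶ T, ∃ c : M' ⟶ T, a = f ≫ c := by
    intro a
    have := hT a
    induction this using AddSubgroup.closure_induction with
    | mem a ha =>
      obtain ⟨a, b, rfl⟩ := ha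
      obtain ⟨c, rfl⟩ := hM' a
      exact ⟨c ≫ b, Category.assoc _ _ _⟩
    | zero => exact ⟨0, comp_zero.symm⟩
    | add x y _ _ hx hy =>
      obtain ⟨c, rfl⟩ := hx
      obtain ⟨c', rfl⟩ := hy
      exact ⟨c + c', (Preadditive.comp_add ..).symm⟩
    | neg x _ hx =>
      obtain ⟨c, rfl⟩ := hx
      exact ⟨-c, (Preadditive.comp_neg ..).symm⟩
  intro i hi y
  obtain ⟨b, rfl⟩ := exists_eq_mor₃_comp h y (hM i hi _)
  rcases eq_or_ne i 1 with rfl | hi'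
  · obtain ⟨b, rfl⟩ := (shiftFunctor C (1 : ℤ)).map_surjective b
    obtain ⟨c, rfl⟩ := h0 b
    rw [Functor.map_comp, ← Category.assoc, mor₃_comp_shift_mor₁ h, zero_comp]
  · rw [(forall_hom_shift_eq_zero_iff X T 1 i (i - 1) (by lia)).2 (hX _ (by lia)) b, comp_zero]

/-- The dual argument with `Hom(T, -)`: only `i = 1` needs the approximation property, while higher
degrees use `T ≥ X`. -/
theorem geq_cocone {X M' Y M T : C} {f : M' ⟶ X} {g : Y ⟶ M'} {d : X ⟶ Y⟦(1 : ℤ)⟧}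
    (h : Triangle.mk g f d ∈ distTriang C) (hX : Geq T X) (hM : Geq T M')
    (hM' : ∀ a : M ⟶ X, ∃ c, a = c ≫ f)
    (hT : ∀ a : T ⟶ X, a ∈ through M T X) : Geq T Y := by
  have h0 : ∀ a : T ⟶ X, ∃ c : T ⟶ M', a = c ≫ f := by
    intro a
    have := hT a
    induction this using AddSubgroup.closure_induction with
    | mem a ha =>
      obtain ⟨b, a, rfl⟩ := ha
      obtain ⟨c, rfl⟩ := hM' a
      exact ⟨b ≫ c, (Category.assoc _ _ _).symm⟩
    | zero => exact ⟨0, zero_comp.symm⟩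
    | add x y _ _ hx hy =>
      obtain ⟨c, rfl⟩ := hx
      obtain ⟨c', rfl⟩ := hy
      exact ⟨c + c', (Preadditive.add_comp ..).symm⟩
    | neg x _ hx =>
      obtain ⟨c, rfl⟩ := hx
      exact ⟨-c, (Preadditive.neg_comp ..).symm⟩
  intro i hi
  rcases eq_or_ne i 1 with rfl | hi'
  · intro y
    obtain ⟨b, rfl⟩ := exists_eq_comp_mor₃ h y (hM 1 one_pos _)
    obtain ⟨c, rfl⟩ := h0 b
    rw [Category.assoc, mor₂_comp_mor₃ h, comp_zero]
  -- The triangle reaches `Y` only as `Y[1]`, so the excess shift is moved onto the source.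
  · rw [← forall_hom_shift_eq_zero_iff T Y (1 - i) 1 i (by lia)]
    intro y
    obtain ⟨b, rfl⟩ := exists_eq_comp_mor₃ h y
      ((forall_hom_shift_eq_zero_iff T M' (1 - i) 1 i (by lia)).2 (hM i hi) _)
    have h1 : ∀ f : T⟦1 - i⟧ ⟶ X⟦(0 : ℤ)⟧, f = 0 :=
      (forall_hom_shift_eq_zero_iff T X (1 - i) 0 (i - 1) (by lia)).2 (hX _ (by lia))
    have h2 : b = 0 := by
      let e := (shiftFunctorZero C ℤ).app X
      rw [← cancel_mono e.inv, h1 (b ≫ e.inv), zero_comp]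
    rw [h2, zero_comp]

end Triangulated

/-! ### Exactly one of the two factorization conditions holds -/

section Dichotomy

variable {A : Type u} [Ring A]

theorem stalk_hom_shift_eq_zero (X Y : FGProj A) (n : ℤ) (hn : n ≠ 0)
    (f : (stalkFunctor A).obj X ⟶ ((stalkFunctor A).obj Y)⟦n⟧) : f = 0 := by
  have h := (forall_single_to_shift_eq_zero_iff X
    ((CochainComplex.singleFunctor (FGProj A) 0).obj Y) n (n - 1) (n + 1) (by lia) rfl).2
    fun z _ => ⟨0, (HomologicalComplex.isZero_single_obj_X _ _ _ _ hn).eq_of_tgt _ _⟩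
  have h1 := h (f.hom ≫ (((isBounded A).ι.commShiftIso n).hom.app ((stalkFunctor A).obj Y)))
  apply ObjectProperty.hom_ext
  rw [← cancel_mono (((isBounded A).ι.commShiftIso n).hom.app ((stalkFunctor A).obj Y))]
  exact h1.trans zero_comp.symm

theorem stalk_hom_shift_one_eq_zero (X Y : FGProj A) (f : (stalkFunctor A).obj X ⟶ ((stalkFunctor A).obj Y)⟦(1 : ℤ)⟧) : f = 0 :=
  stalk_hom_shift_eq_zero X Y 1 one_ne_zero f

section

variable {C D : Type*} [Category* C] [Category* D] {F G : C ⥤ D} (e : F ≅ G)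

include e in
theorem epi_map_of_natIso {X Y : C} (f : X ⟶ Y) [Epi (F.map f)] : Epi (G.map f) := by
  have : G.map f = e.inv.app X ≫ F.map f ≫ e.hom.app Y := by simp
  rw [this]
  infer_instance

include e in
theorem mono_map_of_natIso {X Y : C} (f : X ⟶ Y) [Mono (F.map f)] : Mono (G.map f) := by
  have : G.map f = e.inv.app X ≫ F.map f ≫ e.hom.app Y := by simp
  rw [this]
  infer_instance

include e in
theorem map_eq_zero_iff_of_natIso [HasZeroMorphisms D] {X Y : C} (f : X ⟶ Y) :
    F.map f = 0 ↔ G.map f = 0 := by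
  rw [← cancel_mono (e.hom.app Y), zero_comp, e.hom.naturality, ← cancel_epi (e.hom.app X),
    comp_zero]

end

variable {R : Type u} [Ring R]

/-- An injection between simple modules is bijective, so nothing is left for the complement. -/
theorem isZero_of_iso_biprod {X Y Z : ModuleCat.{v} R} (e : X ≅ Y ⊞ Z) (hX : IsSimpleModule R X)
    (hY : IsSimpleModule R Y) : IsZero Z := by
  have : Mono (biprod.inl ≫ e.inv : Y ⟶ X) := inferInstance
  have h1 := (ModuleCat.mono_iff_injective _).1 this
  have h2 : Function.Bijective (biprod.inl ≫ e.inv : Y ⟶ X).hom := by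
    refine LinearMap.bijective_of_ne_zero fun h => ?_
    have := IsSimpleModule.nontrivial R Y
    obtain ⟨y, hy⟩ := exists_ne (0 : Y)
    refine hy (h1 ?_)
    rw [map_zero]
    exact congr($h y)
  have : Epi (biprod.inl ≫ e.inv : Y ⟶ X) := (ModuleCat.epi_iff_surjective _).2 h2.2
  have h3 : (biprod.snd : Y ⊞ Z ⟶ Z) = 0 := by
    rw [← cancel_epi ((biprod.inl ≫ e.inv : Y ⟶ X) ≫ e.hom)]
    simp
  rw [IsZero.iff_id_eq_zero, ← biprod.inr_snd (X := Y), h3, comp_zero]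

variable {F : FGProj A ⥤ ModuleCat.{u} R} [F.Additive]

/-- `Hom(P, T)` consists of morphisms that factor through `add M`. -/
def FactorsLeft (P M : FGProj A) (T : Kb A) : Prop :=
  ∀ a : (stalkFunctor A).obj P ⟶ T, a ∈ through ((stalkFunctor A).obj M) ((stalkFunctor A).obj P) T

/-- `Hom(T, P[1])` consists of morphisms that factor through `add M[1]`. -/
def FactorsRight (P M : FGProj A) (T : Kb A) : Prop :=
  ∀ a : T ⟶ ((stalkFunctor A).obj P)⟦(1 : ℤ)⟧, a ∈ through (((stalkFunctor A).obj M)⟦(1 : ℤ)⟧) T (((stalkFunctor A).obj P)⟦(1 : ℤ)⟧)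

variable (F) in
/-- `H⁻¹` of a shifted stalk complex. -/
noncomputable def stalkShiftHomology :
    stalkFunctor A ⋙ shiftFunctor (Kb A) (1 : ℤ) ⋙ homologyOf F (-1) ≅ F :=
  Functor.isoWhiskerLeft (stalkFunctor A) (homologyOfShift F 1 (-1) 0 (by lia)) ≪≫
    stalkHomologyZero F

theorem isZero_homologyOf_shift (a n m : ℤ) (h : a + n = m) (X : Kb A)
    (hX : IsZero ((homologyOf F m).obj X)) : IsZero ((homologyOf F n).obj (X⟦a⟧)) :=
  hX.of_iso ((homologyOfShift F a n m h).app X)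

theorem isZero_homologyOf_stalkShift (n : ℤ) (hn : n ≠ -1) (X : FGProj A) :
    IsZero ((homologyOf F n).obj (((stalkFunctor A).obj X)⟦(1 : ℤ)⟧)) :=
  isZero_homologyOf_shift 1 n (1 + n) rfl _ (isZero_homologyOf_stalk F _ (by lia) X)

theorem homologyOf_exact_mk {X Y Z : Kb A} {f : X ⟶ Y} {g : Y ⟶ Z} {d : Z ⟶ X⟦(1 : ℤ)⟧}
    (h : Triangle.mk f g d ∈ distTriang (Kb A)) (n : ℤ) :
    Function.Exact ((homologyOf F n).map f) ((homologyOf F n).map g) :=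
  homologyOf_exact F n _ h

theorem homologyOf_exact_mk' {X Y Z : Kb A} {f : X ⟶ Y} {g : Y ⟶ Z} {d : Z ⟶ X⟦(1 : ℤ)⟧}
    (h : Triangle.mk f g d ∈ distTriang (Kb A)) (n : ℤ) :
    Function.Exact ((homologyOf F n).map g) ((homologyOf F n).map d) :=
  homologyOf_exact F n _ (rot_of_distTriang _ h)

theorem isZero_of_exact {X Y Z : ModuleCat.{u} R} {f : X ⟶ Y} {g : Y ⟶ Z}
    (h : Function.Exact f g) (hX : IsZero X) (hZ : IsZero Z) : IsZero Y := by
  have : Subsingleton Y := ⟨fun y y' => by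
    have h1 : ∀ y : Y, y = 0 := fun y => by
      obtain ⟨x, rfl⟩ := (h y).1 (by rw [hZ.eq_of_tgt g 0]; rfl)
      rw [hX.eq_of_src f 0]
      rfl
    rw [h1 y, h1 y']⟩
  exact ModuleCat.isZero_of_subsingleton _

theorem epi_of_exact {X Y Z : ModuleCat.{u} R} {f : X ⟶ Y} {g : Y ⟶ Z}
    (h : Function.Exact f g) (hZ : IsZero Z) : Epi f :=
  (ModuleCat.epi_iff_surjective _).2 fun y => (h y).1 (by rw [hZ.eq_of_tgt g 0]; rfl)

theorem mono_of_exact {X Y Z : ModuleCat.{u} R} {f : X ⟶ Y} {g : Y ⟶ Z}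
    (h : Function.Exact f g) (hX : IsZero X) : Mono g := by
  rw [ModuleCat.mono_iff_injective]
  refine (injective_iff_map_eq_zero g.hom).2 fun y hy => ?_
  obtain ⟨x, rfl⟩ := (h y).1 hy
  rw [hX.eq_of_src f 0]
  rfl

variable {P M : FGProj A}

/-- Vanishing of `H⁰` makes `F d` surjective. A map `P ⟶ T` lifts to `X₀`, because `Hom(P, X₁[1]) =
0`; by Nakayama the lift agrees with a map through `d` up to maps through `M`, and `d` composes to
zero with `X₀ ⟶ T`. -/
theorem IsTwoTerm.factorsLeft (hF : IsLocalTop F P M) {T : Kb A} (hT : IsTwoTerm T)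
    (h : IsZero ((homologyOf F 0).obj T)) : FactorsLeft P M T := by
  obtain ⟨X₁, X₀, d, g, w, hT⟩ := hT
  have : Epi ((stalkFunctor A ⋙ homologyOf F 0).map d) := epi_of_exact (homologyOf_exact_mk hT 0) h
  have h1 := epi_map_of_natIso (stalkHomologyZero F) d
  rw [ModuleCat.epi_iff_surjective] at h1
  intro a
  obtain ⟨a, rfl⟩ := exists_eq_comp_mor₂ hT a (stalk_hom_shift_one_eq_zero _ _ _)
  obtain ⟨a, rfl⟩ := (stalkFunctor A).map_surjective a
  obtain ⟨y, hy⟩ := hF.exists_sub_mem_through_of_epi d h1 a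
  have h2 := postcomp_mem_through (map_mem_through (stalkFunctor A) hy) g
  rw [Functor.map_sub, Functor.map_comp, Preadditive.sub_comp, Category.assoc, mor₁_comp_mor₂ hT,
    comp_zero, sub_zero] at h2
  exact h2

/-- Vanishing of `H⁻¹` makes `F d` injective, and a map `T ⟶ P[1]` comes from a map `X₁ ⟶ P` to
which the dual form of Nakayama applies. -/
theorem IsTwoTerm.factorsRight (hF : IsLocalTop F P M) {T : Kb A} (hT : IsTwoTerm T)
    (h : IsZero ((homologyOf F (-1)).obj T)) : FactorsRight P M T := by
  obtain ⟨X₁, X₀, d, g, w, hT⟩ := hT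
  have : Mono ((stalkFunctor A ⋙ shiftFunctor (Kb A) (1 : ℤ) ⋙ homologyOf F (-1)).map d) := by
    have h1 := mono_of_exact (homologyOf_exact_mk' (F := F) (rot_of_distTriang _ hT) (-1)) h
    have h2 : (stalkFunctor A ⋙ shiftFunctor (Kb A) (1 : ℤ) ⋙ homologyOf F (-1)).map d =
      - (homologyOf F (-1)).map (-((stalkFunctor A).map d)⟦(1 : ℤ)⟧') := by
      rw [Functor.map_neg, neg_neg]
      rfl
    rw [h2]
    have : Mono ((homologyOf F (-1)).map (-((stalkFunctor A).map d)⟦(1 : ℤ)⟧')) := h1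
    infer_instance
  have h1 := mono_map_of_natIso (stalkShiftHomology F) d
  rw [ModuleCat.mono_iff_injective] at h1
  intro a
  obtain ⟨a, rfl⟩ := exists_eq_mor₃_comp hT a (stalk_hom_shift_one_eq_zero _ _ _)
  obtain ⟨a, rfl⟩ := (shiftFunctor (Kb A) (1 : ℤ)).map_surjective a
  obtain ⟨a, rfl⟩ := (stalkFunctor A).map_surjective a
  obtain ⟨y, hy⟩ := hF.exists_sub_mem_through_of_mono d h1 a
  have h2 := precomp_mem_through w
    (map_mem_through (shiftFunctor (Kb A) (1 : ℤ)) (map_mem_through (stalkFunctor A) hy))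
  rw [Functor.map_sub, Functor.map_comp, Functor.map_sub, Functor.map_comp, Preadditive.comp_sub,
    ← Category.assoc w, mor₃_comp_shift_mor₁ hT, zero_comp, sub_zero] at h2
  exact h2

/-- `H⁰` of `F T` is a quotient of `F X₀`, whose identity is a sum of maps through `F P`; hence it
is the sum of the images of the maps induced by `P ⟶ T`. -/
theorem IsTwoTerm.isZero_homologyOf_zero (hF : IsLocalTop F P M) {T : Kb A} (hT : IsTwoTerm T)
    (h : ∀ a : (stalkFunctor A).obj P ⟶ T, (homologyOf F 0).map a = 0) : IsZero ((homologyOf F 0).obj T) := by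
  obtain ⟨X₁, X₀, d, g, w, hT⟩ := hT
  have h1 : Epi ((homologyOf F 0).map g) :=
    epi_of_exact (homologyOf_exact_mk' hT 0) (isZero_homologyOf_stalkShift 0 (by lia) _)
  obtain ⟨n, a, b, hab, -⟩ := hF.sum_map_comp_map X₀
  have h2 : (homologyOf F 0).map g = 0 := by
    have h3 : (stalkFunctor A ⋙ homologyOf F 0).map (∑ j, a j ≫ b j) = 𝟙 _ := by
      rw [← cancel_epi ((stalkHomologyZero F).inv.app X₀), ← (stalkHomologyZero F).inv.naturality,
        F.map_sum]
      simp only [F.map_comp]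
      rw [hab, Category.id_comp, Category.comp_id]
    have h4 : (homologyOf F 0).map g = (stalkFunctor A ⋙ homologyOf F 0).map (∑ j, a j ≫ b j) ≫
        (homologyOf F 0).map g := by
      rw [h3]
      exact (Category.id_comp _).symm
    rw [h4, Functor.map_sum, Preadditive.sum_comp]
    refine Finset.sum_eq_zero fun j _ => ?_
    change (homologyOf F 0).map ((stalkFunctor A).map (a j ≫ b j)) ≫ (homologyOf F 0).map g = 0
    rw [Functor.map_comp, Functor.map_comp, Category.assoc, ← Functor.map_comp, h, comp_zero]
  rw [h2] at h1
  exact (IsZero.iff_id_eq_zero _).2 (by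
    rw [← cancel_epi (0 : (homologyOf F 0).obj ((stalkFunctor A).obj X₀) ⟶ _), zero_comp, zero_comp])

/-- Dually, `H⁻¹` embeds in `F X₁`, so it is detected by the maps `T ⟶ P[1]`. -/
theorem IsTwoTerm.isZero_homologyOf_neg_one (hF : IsLocalTop F P M) {T : Kb A} (hT : IsTwoTerm T)
    (h : ∀ a : T ⟶ ((stalkFunctor A).obj P)⟦(1 : ℤ)⟧, (homologyOf F (-1)).map a = 0) :
    IsZero ((homologyOf F (-1)).obj T) := by
  obtain ⟨X₁, X₀, d, g, w, hT⟩ := hT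
  have h1 : Mono ((homologyOf F (-1)).map w) :=
    mono_of_exact (homologyOf_exact_mk' hT (-1)) (isZero_homologyOf_stalk F (-1) (by lia) _)
  obtain ⟨n, a, b, hab, -⟩ := hF.sum_map_comp_map X₁
  have h2 : (homologyOf F (-1)).map w = 0 := by
    have h3 : (stalkFunctor A ⋙ shiftFunctor (Kb A) (1 : ℤ) ⋙ homologyOf F (-1)).map
        (∑ j, a j ≫ b j) = 𝟙 _ := by
      rw [← cancel_epi ((stalkShiftHomology F).inv.app X₁), ← (stalkShiftHomology F).inv.naturality,
        F.map_sum]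
      simp only [F.map_comp]
      rw [hab, Category.id_comp, Category.comp_id]
    have h4 : (homologyOf F (-1)).map w = (homologyOf F (-1)).map w ≫
        (stalkFunctor A ⋙ shiftFunctor (Kb A) (1 : ℤ) ⋙ homologyOf F (-1)).map
          (∑ j, a j ≫ b j) := by
      rw [h3]
      exact (Category.comp_id _).symm
    rw [h4, Functor.map_sum, Preadditive.comp_sum]
    refine Finset.sum_eq_zero fun j _ => ?_
    change (homologyOf F (-1)).map w ≫ (homologyOf F (-1)).map
      ((shiftFunctor (Kb A) (1 : ℤ)).map ((stalkFunctor A).map (a j ≫ b j))) = 0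
    rw [Functor.map_comp, Functor.map_comp, Functor.map_comp, ← Category.assoc, ← Functor.map_comp, h, zero_comp]
  rw [h2] at h1
  exact (IsZero.iff_id_eq_zero _).2 (by
    rw [← cancel_mono (0 : _ ⟶ (homologyOf F (-1)).obj (((stalkFunctor A).obj X₁)⟦(1 : ℤ)⟧)),
      comp_zero, comp_zero])

theorem FactorsLeft.isZero_homologyOf (hF : IsLocalTop F P M) {T : Kb A} (hT : IsTwoTerm T)
    (h : FactorsLeft P M T) : IsZero ((homologyOf F 0).obj T) :=
  hT.isZero_homologyOf_zero hF fun a => map_eq_zero_of_mem_through (homologyOf F 0)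
    (hF.isZero.of_iso ((stalkHomologyZero F).app M)) (h a)

theorem FactorsRight.isZero_homologyOf (hF : IsLocalTop F P M) {T : Kb A} (hT : IsTwoTerm T)
    (h : FactorsRight P M T) : IsZero ((homologyOf F (-1)).obj T) :=
  hT.isZero_homologyOf_neg_one hF fun a => map_eq_zero_of_mem_through (homologyOf F (-1))
    (hF.isZero.of_iso ((stalkShiftHomology F).app M)) (h a)

/-- If both homologies are nonzero, choose `f : P ⟶ T` and `g : T ⟶ P[1]` visible on them. The
composite `g ≫ f[1]` is zero by `T ≥ T`, yet `f[1]` is injective on `H⁻¹` because its source there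
is simple. -/
theorem factorsLeft_or_factorsRight (hF : IsLocalTop F P M) {T : Kb A} (hT : IsTwoTerm T)
    (h : Geq T T) : FactorsLeft P M T ∨ FactorsRight P M T := by
  by_cases h0 : IsZero ((homologyOf F 0).obj T)
  · exact Or.inl (hT.factorsLeft hF h0)
  by_cases h1 : IsZero ((homologyOf F (-1)).obj T)
  · exact Or.inr (hT.factorsRight hF h1)
  exfalso
  obtain ⟨f, hf⟩ : ∃ f : (stalkFunctor A).obj P ⟶ T, (homologyOf F 0).map f ≠ 0 := by
    by_contra! H
    exact h0 (hT.isZero_homologyOf_zero hF H)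
  obtain ⟨g, hg⟩ : ∃ g : T ⟶ ((stalkFunctor A).obj P)⟦(1 : ℤ)⟧, (homologyOf F (-1)).map g ≠ 0 := by
    by_contra! H
    exact h1 (hT.isZero_homologyOf_neg_one hF H)
  have hP : IsSimpleModule R ((homologyOf F (-1)).obj (((stalkFunctor A).obj P)⟦(1 : ℤ)⟧)) := by
    have := hF.simple
    exact IsSimpleModule.congr ((stalkShiftHomology F).app P).toLinearEquiv
  have h2 : (homologyOf F (-1)).map (f⟦(1 : ℤ)⟧') ≠ 0 := fun h =>
    hf ((map_eq_zero_iff_of_natIso (homologyOfShift F 1 (-1) 0 (by lia)) f).1 h)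
  have h3 : Mono ((homologyOf F (-1)).map (f⟦(1 : ℤ)⟧')) := by
    rw [ModuleCat.mono_iff_injective]
    refine LinearMap.injective_of_ne_zero fun h => h2 ?_
    ext1
    exact h
  refine hg ?_
  rw [← cancel_mono ((homologyOf F (-1)).map (f⟦(1 : ℤ)⟧')), ← Functor.map_comp,
    h 1 one_pos (g ≫ f⟦(1 : ℤ)⟧'), Functor.map_zero, zero_comp]

/-- Closure under summands is what lets the kernel of a homological functor absorb a whole thick
closure. -/
instance {C : Type*} [Category* C] [HasShift C ℤ] {D : Type*} [Category* D] [HasZeroMorphisms D] (G : C ⥤ D)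
    [Preadditive C] : G.homologicalKernel.IsStableUnderRetracts where
  of_retract r h n := by
    have r' := (r.map (shiftFunctor _ n)).map G
    exact (h n).of_mono r'.i

/-- If both conditions hold, `F T` has no homology at all. The thick closure of `T` then lies in the
homological kernel, but that closure is everything, including `P`, whose top is nonzero. -/
theorem not_factorsLeft_and_factorsRight (hF : IsLocalTop F P M) {T : Kb A} (hT : IsTwoTerm T)
    (h : IsSilting T) : ¬ (FactorsLeft P M T ∧ FactorsRight P M T) := by
  rintro ⟨h0, h1⟩
  have h0 := h0.isZero_homologyOf hF hT
  have h1 := h1.isZero_homologyOf hF hT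
  have h2 : ∀ n, IsZero ((homologyOf F n).obj T) := by
    intro n
    rcases eq_or_ne n 0 with rfl | hn
    · exact h0
    rcases eq_or_ne n (-1) with rfl | hn'
    · exact h1
    obtain ⟨X₁, X₀, d, g, w, hT⟩ := hT
    exact isZero_of_exact (homologyOf_exact_mk' hT n) (isZero_homologyOf_stalk F n hn _)
      (isZero_homologyOf_stalkShift n hn' _)
  have h3 : ObjectProperty.singleton T ≤ (homologyOf F 0).homologicalKernel := by
    rintro _ ⟨⟩
    exact fun n => isZero_homologyOf_shift n 0 n (by lia) _ (h2 n)
  rw [← ObjectProperty.triangEnvelope_le_iff, h.thick_eq_top] at h3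
  have h4 := h3 ((stalkFunctor A).obj P) trivial 0
  have h5 := (h4.of_iso ((homologyOfShift F 0 0 0 (by lia)).symm.app ((stalkFunctor A).obj P))).of_iso
    ((stalkHomologyZero F).symm.app P)
  have := hF.simple
  have := IsSimpleModule.nontrivial R (F.obj P)
  exact not_subsingleton _ (ModuleCat.subsingleton_of_isZero h5)

end Dichotomy

/-! ### Existence of minimal approximations -/

section Approximation

variable {A : Type u} [Ring A]

theorem lin_pow {X : FGProj A} (h : End X) (n : ℕ) : lin (h ^ n : End X) = (lin h) ^ n := by
  induction n with
  | zero => rfl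
  | succ n ih =>
    ext x
    rw [pow_succ h, pow_succ (lin h), ← ih]
    rfl

section

variable {C : Type*} [Category* C]

theorem comp_end_pow {X Y : C} {f : X ⟶ Y} {h : End Y} (hf : f ≫ h = f) (n : ℕ) :
    f ≫ (h ^ n : End Y) = f := by
  induction n with
  | zero => exact Category.comp_id f
  | succ n ih =>
    rw [pow_succ, End.mul_def, ← Category.assoc, hf, ih]

theorem end_pow_comp {X Y : C} {f : Y ⟶ X} {h : End Y} (hf : h ≫ f = f) (n : ℕ) :
    (h ^ n : End Y) ≫ f = f := by
  induction n with
  | zero => exact Category.id_comp f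
  | succ n ih =>
    rw [pow_succ, End.mul_def, Category.assoc, ih, hf]

end

section

variable [IsArtinianRing Aᵐᵒᵖ]

/-- A form of Fitting's lemma: high powers of an endomorphism factor through a direct summand
which is proper unless the endomorphism is invertible. -/
theorem exists_fitting (X : FGProj A) (h : X ⟶ X) :
    ∃ (k : X ⟶ X) (Y : FGProj A) (i : Y ⟶ X) (p : X ⟶ Y), i ≫ p = 𝟙 Y ∧ k ≫ p ≫ i = k ∧
      (∀ (Z : FGProj A) (f : Z ⟶ X), f ≫ h = f → f ≫ k = f) ∧
      (∀ (Z : FGProj A) (f : X ⟶ Z), h ≫ f = f → k ≫ f = f) ∧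
      (Module.length Aᵐᵒᵖ Y.obj < Module.length Aᵐᵒᵖ X.obj ∨ IsIso h) := by
  let h' : End X := h
  have : Module.Finite Aᵐᵒᵖ X.obj := X.property.1
  have : IsArtinian Aᵐᵒᵖ X.obj := inferInstance
  have : IsNoetherian Aᵐᵒᵖ X.obj := inferInstance
  obtain ⟨n, hn⟩ := Filter.eventually_atTop.1 
    (LinearMap.eventually_isCompl_ker_pow_range_pow (lin h))
  -- The exponent is taken positive so that surjectivity of the power passes to `h` itself.
  have hc := (hn (n + 1) (by lia)).symm
  rw [show lin h = lin h' from rfl, ← lin_pow] at hc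
  set k : X ⟶ X := (h' ^ (n + 1) : End X) with hk
  -- The projection onto the image of `k` along its kernel; the summand `Y` is the image of `k`.
  let e : X ⟶ X := ofLin ((LinearMap.range (lin k)).projection _ hc)
  have hke : k ≫ e = k := lin_injective fun x =>
    Submodule.projection_apply_left hc ⟨lin k x, x, rfl⟩
  have hee : e ≫ e = e := lin_injective fun x =>
    Submodule.projection_apply_left hc ((LinearMap.range (lin k)).projectionOnto _ hc x)
  obtain ⟨Y, i, p, hip, hpi⟩ := IsIdempotentComplete.idempotents_split X e hee
  refine ⟨k, Y, i, p, hip, by rw [hpi]; exact hke, fun Z f hf => comp_end_pow (h := h') hf _,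
    fun Z f hf => end_pow_comp (h := h') hf _, ?_⟩
  have hi : Function.Injective (lin i) := Function.LeftInverse.injective
    (g := lin p) fun y => congr(lin $hip y)
  by_cases hr : LinearMap.range (lin i) = ⊤
  · right
    have h1 : LinearMap.range (lin k) = ⊤ := by
      rw [eq_top_iff]
      rintro x -
      obtain ⟨y, rfl⟩ := LinearMap.range_eq_top.1 hr x
      have h2 : i ≫ e = i := by rw [← hpi, ← Category.assoc, hip, Category.id_comp]
      have h3 : lin e (lin i y) = lin i y := congr(lin $h2 y)
      rw [← h3]
      exact ((LinearMap.range (lin k)).projectionOnto _ hc (lin i y)).2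
    have h2 : Function.Surjective (lin h) := by
      intro x
      obtain ⟨y, hy⟩ := LinearMap.range_eq_top.1 h1 x
      rw [hk, lin_pow, pow_succ'] at hy
      exact ⟨_, hy⟩
    have h3 := IsNoetherian.bijective_of_surjective_endomorphism (lin h) h2
    let E := LinearEquiv.ofBijective (lin h) h3
    exact ⟨ofLin E.symm.toLinearMap, lin_injective fun x => E.symm_apply_apply x,
      lin_injective fun x => E.apply_symm_apply x⟩
  · left
    rw [(LinearEquiv.ofInjective (lin i) hi).length_eq]
    exact Submodule.length_lt hr

end

section

variable {C : Type*} [Category* C] [Preadditive C] [HasFiniteBiproducts C]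

/-- `f : X ⟶ M'` is a left `add M`-approximation of `X`. -/
structure IsLeftApprox (M : C) {X M' : C} (f : X ⟶ M') : Prop where
  mem : ∃ n : ℕ, Nonempty (Retract M' (⨁ fun _ : Fin n => M))
  factors : ∀ g : X ⟶ M, ∃ h : M' ⟶ M, f ≫ h = g

/-- `f : M' ⟶ X` is a right `add M`-approximation of `X`. -/
structure IsRightApprox (M : C) {X M' : C} (f : M' ⟶ X) : Prop where
  mem : ∃ n : ℕ, Nonempty (Retract M' (⨁ fun _ : Fin n => M))
  factors : ∀ g : M ⟶ X, ∃ h : M ⟶ M', h ≫ f = g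

theorem IsLeftApprox.comp {M X M' M'' : C} {f : X ⟶ M'} (hf : IsLeftApprox M f) (i : M'' ⟶ M')
    (p : M' ⟶ M'') (hip : i ≫ p = 𝟙 _) (h : f ≫ p ≫ i = f) : IsLeftApprox M (f ≫ p) where
  mem := by
    obtain ⟨n, ⟨r⟩⟩ := hf.mem
    exact ⟨n, ⟨(Retract.mk i p hip).trans r⟩⟩
  factors g := by
    obtain ⟨c, rfl⟩ := hf.factors g
    exact ⟨i ≫ c, by rw [← Category.assoc, Category.assoc f, h]⟩

end

/-- Induction on length. A non-invertible `h` fixing `f` yields by Fitting a map `k` that also fixes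
`f` and has image in a proper summand; projecting `f` onto this summand keeps it an approximation.
-/
theorem IsLeftApprox.exists_minimal [IsArtinianRing Aᵐᵒᵖ] {M X M' : FGProj A} {f : X ⟶ M'}
    (hf : IsLeftApprox M f) : ∃ (N : FGProj A) (g : X ⟶ N), IsLeftApprox M g ∧
      ∀ h : N ⟶ N, g ≫ h = g → IsIso h := by
  induction hl : Module.length Aᵐᵒᵖ M'.obj using WellFoundedLT.induction generalizing M' with
  | ind l ih =>
  by_cases H : ∀ h : M' ⟶ M', f ≫ h = f → IsIso h
  · exact ⟨M', f, hf, H⟩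
  push Not at H
  obtain ⟨h, hfh, hh⟩ := H
  obtain ⟨k, Y, i, p, hip, hpi, hk, -, hlt⟩ := exists_fitting M' h
  have h1 : f ≫ p ≫ i = f := by
    rw [← hk _ f hfh, Category.assoc, hpi]
  exact ih _ (hl ▸ hlt.resolve_right hh) (hf.comp i p hip h1) rfl

theorem IsRightApprox.exists_minimal [IsArtinianRing Aᵐᵒᵖ] {M X M' : FGProj A} {f : M' ⟶ X}
    (hf : IsRightApprox M f) : ∃ (N : FGProj A) (g : N ⟶ X), IsRightApprox M g ∧
      ∀ h : N ⟶ N, h ≫ g = g → IsIso h := by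
  induction hl : Module.length Aᵐᵒᵖ M'.obj using WellFoundedLT.induction generalizing M' with
  | ind l ih =>
  by_cases H : ∀ h : M' ⟶ M', h ≫ f = f → IsIso h
  · exact ⟨M', f, hf, H⟩
  push Not at H
  obtain ⟨h, hfh, hh⟩ := H
  obtain ⟨k, Y, i, p, hip, hpi, -, hk, hlt⟩ := exists_fitting M' h
  have h1 : k ≫ p ≫ i ≫ f = f := by
    have h2 : k ≫ p ≫ i ≫ f = (k ≫ p ≫ i) ≫ f := by simp
    rw [h2, hpi, hk _ f hfh]
  refine ih _ (hl ▸ hlt.resolve_right hh) (M' := Y) (f := i ≫ f) ⟨?_, fun g => ?_⟩ rfl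
  · obtain ⟨n, ⟨r⟩⟩ := hf.mem
    exact ⟨n, ⟨(Retract.mk i p hip).trans r⟩⟩
  · obtain ⟨c, rfl⟩ := hf.factors g
    exact ⟨c ≫ k ≫ p, by rw [Category.assoc, Category.assoc, h1]⟩

section Generators

variable {K : Type w} [Field K] [Algebra K A]

/-- Multiplication by a scalar, as an endomorphism of a module. -/
def scalarEnd (c : K) (X : FGProj A) : X ⟶ X :=
  ofLin
    { toFun := fun x => MulOpposite.op (algebraMap K A c) • x
      map_add' := smul_add _
      map_smul' := fun r x => by
        rw [RingHom.id_apply, smul_smul, smul_smul]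
        congr 1
        exact congrArg MulOpposite.op (Algebra.commutes c r.unop).symm }

theorem scalarEnd_comp (c : K) {X Y : FGProj A} (f : X ⟶ Y) :
    scalarEnd c X ≫ f = f ≫ scalarEnd c Y :=
  lin_injective fun x => map_smul (lin f) (MulOpposite.op (algebraMap K A c)) x

theorem linearMap_pi_mul {n : ℕ} (φ : (Fin n → K) →ₗ[K] A) (c : Fin n → K) (x : A) :
    φ c * x = ∑ k, φ (Pi.single k 1) * (x * algebraMap K A (c k)) := by
  have h : c = ∑ k, c k • Pi.single k (1 : K) := by
    ext l
    simp [Pi.single_apply]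
  conv_lhs => rw [h]
  rw [map_sum, Finset.sum_mul]
  refine Finset.sum_congr rfl fun k _ => ?_
  rw [map_smul, smul_mul_assoc, ← Algebra.commutes, ← mul_assoc, ← Algebra.commutes, mul_assoc,
    Algebra.smul_def]

variable (K) in
-- `Hom(X, Y)` is a summand of `End A`, which is `A`, so a finite spanning set of `A` over `K`
-- restricts to generators. Scalars enter through `scalarEnd`.
theorem exists_hom_generators [Module.Finite K A] {X Y : FGProj A} (i : X ⟶ regular A)
    (p : regular A ⟶ X) (hip : i ≫ p = 𝟙 X) (j : Y ⟶ regular A) (q : regular A ⟶ Y)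
    (hjq : j ≫ q = 𝟙 Y) : ∃ (n : ℕ) (s : Fin n → (X ⟶ Y)), ∀ g : X ⟶ Y, ∃ c : Fin n → K,
      g = ∑ k, s k ≫ scalarEnd (c k) Y := by
  obtain ⟨n, φ, hφ⟩ := Module.Finite.exists_fin' K A
  refine ⟨n, fun k => i ≫ ofElement (X := regular A) (φ (Pi.single k 1)) ≫ q, fun g => ?_⟩
  obtain ⟨c, hc⟩ := hφ (lin (p ≫ g ≫ j) (1 : A))
  refine ⟨c, ?_⟩
  have h1 : p ≫ g ≫ j = ∑ k, scalarEnd (c k) (regular A) ≫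
      ofElement (X := regular A) (φ (Pi.single k 1)) := by
    refine lin_injective fun (x : A) => ?_
    have h2 : lin (p ≫ g ≫ j) x = φ c * x := by
      rw [hc]
      refine Eq.trans ?_ (map_smul (lin (p ≫ g ≫ j)) (MulOpposite.op x) (1 : A))
      exact congrArg (lin (p ≫ g ≫ j)) (one_mul x).symm
    refine h2.trans (Eq.trans ?_ (lin_sum_apply _ _ _).symm)
    exact linearMap_pi_mul φ c x
  calc g = i ≫ (p ≫ g ≫ j) ≫ q := by
        simp only [Category.assoc, hjq, Category.comp_id]
        rw [← Category.assoc, hip, Category.id_comp]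
    _ = _ := by
      rw [h1, Preadditive.sum_comp, Preadditive.comp_sum]
      refine Finset.sum_congr rfl fun k _ => ?_
      simp only [Category.assoc, scalarEnd_comp]

variable (K) [Module.Finite K A] {X Y : FGProj A} (i : X ⟶ regular A)
    (p : regular A ⟶ X) (hip : i ≫ p = 𝟙 X) (j : Y ⟶ regular A) (q : regular A ⟶ Y)
    (hjq : j ≫ q = 𝟙 Y)

include K hip hjq

/-- Finitely many generators of `Hom(X, Y)` assemble into a map from `X` to a power of `Y`, which is
an approximation and can be made minimal. -/
theorem exists_isLeftApprox : ∃ (N : FGProj A) (f : X ⟶ N), IsLeftApprox Y f ∧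
    ∀ h : N ⟶ N, f ≫ h = f → IsIso h := by
  have : IsArtinianRing Aᵐᵒᵖ := IsArtinianRing.of_finite K Aᵐᵒᵖ
  obtain ⟨n, s, hs⟩ := exists_hom_generators K i p hip j q hjq
  have : IsLeftApprox Y (biproduct.lift s) := by
    refine ⟨⟨n, ⟨Retract.refl _⟩⟩, fun g => ?_⟩
    obtain ⟨c, rfl⟩ := hs g
    exact ⟨biproduct.desc fun k => scalarEnd (c k) Y, biproduct.lift_desc⟩
  exact this.exists_minimal

theorem exists_isRightApprox : ∃ (N : FGProj A) (f : N ⟶ Y), IsRightApprox X f ∧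
    ∀ h : N ⟶ N, h ≫ f = f → IsIso h := by
  have : IsArtinianRing Aᵐᵒᵖ := IsArtinianRing.of_finite K Aᵐᵒᵖ
  obtain ⟨n, s, hs⟩ := exists_hom_generators K i p hip j q hjq
  have : IsRightApprox X (biproduct.desc s) := by
    refine ⟨⟨n, ⟨Retract.refl _⟩⟩, fun g => ?_⟩
    obtain ⟨c, rfl⟩ := hs g
    refine ⟨biproduct.lift fun k => scalarEnd (c k) X, biproduct.lift_desc.trans ?_⟩
    simp only [scalarEnd_comp]
  exact this.exists_minimal

end Generators

end Approximation

/-! ### Mutations and the description of `𝒯⁻` and `𝒯⁺` -/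

section Mutation

theorem map_comp_eq_zero_of_isZero {C D : Type*} [Category* C] [Category* D] [HasZeroMorphisms D]
    (H : C ⥤ D) {X Y Z : C} (h : IsZero (H.obj Y)) (f : X ⟶ Y) (g : Y ⟶ Z) : H.map (f ≫ g) = 0 := by
  rw [H.map_comp, h.eq_of_src (H.map g) 0, comp_zero]

/-- Additive functors commute with binary biproducts. -/
noncomputable def additiveMapBiprod {C D : Type*} [Category* C] [Category* D] [Preadditive C]
    [Preadditive D] [HasBinaryBiproducts C] [HasBinaryBiproducts D] (F : C ⥤ D) [F.Additive]
    (X Y : C) : F.obj (X ⊞ Y) ≅ F.obj X ⊞ F.obj Y where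
  hom := biprod.lift (F.map biprod.fst) (F.map biprod.snd)
  inv := biprod.desc (F.map biprod.inl) (F.map biprod.inr)
  hom_inv_id := by
    rw [biprod.lift_desc, ← F.map_comp, ← F.map_comp, ← F.map_add, biprod.total,
      CategoryTheory.Functor.map_id]
  inv_hom_id := by ext <;> simp [← F.map_comp]

section

variable {C : Type*} [Category* C] [Preadditive C] [HasFiniteBiproducts C]
  {D : Type*} [Category* D] [Preadditive D] [HasZeroObject D] [HasShift D ℤ]
  [∀ n : ℤ, (shiftFunctor D n).Additive] [Pretriangulated D] (G : C ⥤ D) [G.Additive] {M : C}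

include G in
theorem add_map {N : C} (h : ∃ n : ℕ, Nonempty (Retract N (⨁ fun _ : Fin n => M))) :
    Add (G.obj M) (G.obj N) := by
  obtain ⟨n, ⟨r⟩⟩ := h
  exact ⟨n, ⟨(r.map G).trans (Retract.ofIso (G.mapBiproduct fun _ : Fin n => M))⟩⟩

variable [G.Full] [G.Faithful]

/-- Factorizations into an object of `add` are built coordinate by coordinate, and fullness brings
each coordinate back to `C`. -/
theorem IsLeftApprox.isMinLeftApprox_map {X M' : C} {f : X ⟶ M'} (hf : IsLeftApprox M f)
    (hmin : ∀ h : M' ⟶ M', f ≫ h = f → IsIso h) : IsMinLeftApprox (G.obj M) (G.map f) where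
  mem := add_map G hf.mem
  factors N hN g := by
    obtain ⟨n, ⟨r⟩⟩ := hN
    have h1 : ∀ j, ∃ h : G.obj M' ⟶ G.obj M,
        G.map f ≫ h = g ≫ r.i ≫ biproduct.π (fun _ : Fin n => G.obj M) j := by
      intro j
      obtain ⟨a, ha⟩ := G.map_surjective (g ≫ r.i ≫ biproduct.π (fun _ : Fin n => G.obj M) j)
      obtain ⟨b, rfl⟩ := hf.factors a
      exact ⟨G.map b, by rw [← ha, G.map_comp]⟩
    choose h hh using h1
    refine ⟨biproduct.lift h ≫ r.r, ?_⟩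
    have h2 : G.map f ≫ biproduct.lift h = g ≫ r.i := by
      ext j
      rw [Category.assoc, biproduct.lift_π, hh, Category.assoc]
    rw [← Category.assoc, h2, Category.assoc, r.retract, Category.comp_id]
  minimal h hh := by
    obtain ⟨h, rfl⟩ := G.map_surjective h
    have := hmin h (G.map_injective (by rw [G.map_comp, hh]))
    infer_instance

theorem IsRightApprox.isMinRightApprox_map {X M' : C} {f : M' ⟶ X} (hf : IsRightApprox M f)
    (hmin : ∀ h : M' ⟶ M', h ≫ f = f → IsIso h) : IsMinRightApprox (G.obj M) (G.map f) where
  mem := add_map G hf.mem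
  factors N hN g := by
    obtain ⟨n, ⟨r⟩⟩ := hN
    have h1 : ∀ j, ∃ h : G.obj M ⟶ G.obj M',
        h ≫ G.map f = biproduct.ι (fun _ : Fin n => G.obj M) j ≫ r.r ≫ g := by
      intro j
      obtain ⟨a, ha⟩ := G.map_surjective (biproduct.ι (fun _ : Fin n => G.obj M) j ≫ r.r ≫ g)
      obtain ⟨b, rfl⟩ := hf.factors a
      exact ⟨G.map b, by rw [← ha, G.map_comp]⟩
    choose h hh using h1
    refine ⟨r.i ≫ biproduct.desc h, ?_⟩
    have h2 : biproduct.desc h ≫ G.map f = r.r ≫ g := by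
      ext j
      rw [← Category.assoc, biproduct.ι_desc, hh]
    rw [Category.assoc, h2, ← Category.assoc, r.retract, Category.id_comp]
  minimal h hh := by
    obtain ⟨h, rfl⟩ := G.map_surjective h
    have := hmin h (G.map_injective (by rw [G.map_comp, hh]))
    infer_instance

end

variable {A : Type u} [Ring A]

/-- Basic silting objects `T` with `A ≥ T ≥ A[1]`. -/
structure IsTwoSilting (T : Kb A) : Prop where
  isSilting : IsSilting T
  isBasic : IsBasic T
  geq : Geq (stalk (regular A)) T
  geq' : Geq T ((stalk (regular A))⟦(1 : ℤ)⟧)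

theorem mem_twoSilt_iff (x : IsoClass (Kb A)) :
    x ∈ twoSilt A ↔ ∃ T : Kb A, isoClass T = x ∧ IsTwoSilting T :=
  ⟨fun ⟨T, h, h1, h2, h3, h4⟩ => ⟨T, h, h1, h2, h3, h4⟩,
    fun ⟨T, h, h1, h2, h3, h4⟩ => ⟨T, h, h1, h2, h3, h4⟩⟩

theorem IsTwoSilting.isTwoTerm {T : Kb A} (h : IsTwoSilting T) : IsTwoTerm T :=
  isTwoTerm_of_geq T h.geq h.geq'

theorem FactorsRight.of_iso {P M : FGProj A} {T T' : Kb A} (e : T ≅ T') (h : FactorsRight P M T) :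
    FactorsRight P M T' := fun a => by
  have h1 := precomp_mem_through e.inv (h (e.hom ≫ a))
  rwa [← Category.assoc, e.inv_hom_id, Category.id_comp] at h1

variable {R : Type u} [Ring R] {F : FGProj A ⥤ ModuleCat.{u} R} [F.Additive] {P M : FGProj A}

/-- The definition of mutation allows any complement of `P`, even one in the homotopy category.
Since `F A ≅ F P` is simple, each such complement is invisible to `F`, and that is all that is used
about it; no uniqueness of complements is needed. -/
theorem IsLocalTop.isZero_of_iso_biprod (hF : IsLocalTop F P M) (eA : regular A ≅ P ⊞ M)
    {C : Type*} [Category* C] [Preadditive C] [HasBinaryBiproducts C] (G : FGProj A ⥤ C)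
    [G.Additive] (H : C ⥤ ModuleCat.{u} R) [H.Additive] (i : G ⋙ H ≅ F) (N : C)
    (e : G.obj (regular A) ≅ G.obj P ⊞ N) : IsZero (H.obj N) := by
  have := hF.simple
  have h1 : IsSimpleModule R (H.obj (G.obj P)) := IsSimpleModule.congr (i.app P).toLinearEquiv
  have e1 : F.obj (regular A) ≅ F.obj P :=
    F.mapIso eA ≪≫ additiveMapBiprod F P M ≪≫ (isoBiprodZero hF.isZero).symm
  have h2 : IsSimpleModule R (H.obj (G.obj (regular A))) :=
    IsSimpleModule.congr (i.app (regular A) ≪≫ e1).toLinearEquiv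
  exact Silting.isZero_of_iso_biprod (H.mapIso e ≪≫ additiveMapBiprod H _ _) h2 h1

/-- If the mutation is `≥ T`, then so is the cone `Y`, hence every map `P ⟶ T` factors through `M'`,
on which `H⁰` vanishes; so `H⁰` of `F T` is zero and Nakayama applies. Conversely, the factorization
condition is what `geq_cone` needs for the cone of a minimal approximation. -/
theorem TMinus_eq (hF : IsLocalTop F P M) (eA : regular A ≅ P ⊞ M)
    (hP : ∃ (N : FGProj A) (f : P ⟶ N), IsLeftApprox M f ∧ ∀ h : N ⟶ N, f ≫ h = f → IsIso h) :
    TMinus P = {x | ∃ T : Kb A, isoClass T = x ∧ IsTwoSilting T ∧ FactorsLeft P M T} := by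
  ext x
  constructor
  · rintro ⟨hx, U, ⟨M₁, M', Y, f, g, d, ⟨e⟩, hf, hT, ⟨e'⟩⟩, hU, -⟩
    obtain ⟨T, rfl, h⟩ := (mem_twoSilt_iff x).1 hx
    refine ⟨T, rfl, h, h.isTwoTerm.factorsLeft hF (h.isTwoTerm.isZero_homologyOf_zero hF ?_)⟩
    intro a
    have hY : Geq Y T := Geq.of_retract ⟨biprod.inl ≫ e'.inv, e'.hom ≫ biprod.fst, by simp⟩ hU
    obtain ⟨c, rfl⟩ := exists_comp_eq_of_geq hT hY a
    have h1 : IsZero ((homologyOf F 0).obj M') := isZero_of_add _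
      (hF.isZero_of_iso_biprod eA (stalkFunctor A) (homologyOf F 0) (stalkHomologyZero F) M₁ e)
      hf.mem
    exact map_comp_eq_zero_of_isZero (homologyOf F 0) h1 f c
  · rintro ⟨T, rfl, h, hT⟩
    refine ⟨(mem_twoSilt_iff _).2 ⟨T, rfl, h⟩, ?_⟩
    obtain ⟨N, f, hf, hmin⟩ := hP
    have hf' := hf.isMinLeftApprox_map (stalkFunctor A) hmin
    obtain ⟨Y, g, d, hY⟩ := distinguished_cocone_triangle ((stalkFunctor A).map f)
    let e : stalk (regular A) ≅ (stalkFunctor A).obj P ⊞ (stalkFunctor A).obj M :=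
      (stalkFunctor A).mapIso eA ≪≫ additiveMapBiprod (stalkFunctor A) P M
    have h1 : Geq ((stalkFunctor A).obj P) T :=
      h.geq.of_retract ⟨biprod.inl ≫ e.inv, e.hom ≫ biprod.fst, by simp⟩
    have h2 : Geq ((stalkFunctor A).obj M) T :=
      h.geq.of_retract ⟨biprod.inr ≫ e.inv, e.hom ≫ biprod.snd, by simp⟩
    refine ⟨Y ⊞ (stalkFunctor A).obj M, ⟨_, _, Y, _, g, d, ⟨e⟩, hf', hY, ⟨Iso.refl _⟩⟩, ?_, h.geq'⟩
    refine Geq.biprod_left (geq_cone hY h1 (h2.add_left hf'.mem) (fun a => ?_) hT) h2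
    obtain ⟨c, hc⟩ := hf'.factors _ ⟨1, ⟨Retract.ofIso (biproductUniqueIso
      (fun _ : Fin 1 => (stalkFunctor A).obj M)).symm⟩⟩ a
    exact ⟨c, hc.symm⟩

/-- The dual of `TMinus_eq`, with `P[1]`, the homology in degree `-1` and `geq_cocone`. -/
theorem TPlus_eq (hF : IsLocalTop F P M) (eA : regular A ≅ P ⊞ M)
    (hP : ∃ (N : FGProj A) (f : N ⟶ P), IsRightApprox M f ∧ ∀ h : N ⟶ N, h ≫ f = f → IsIso h) :
    TPlus P = {x | ∃ T : Kb A, isoClass T = x ∧ IsTwoSilting T ∧ FactorsRight P M T} := by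
  ext x
  constructor
  · rintro ⟨hx, U, ⟨M₁, M', Y, f, g, d, ⟨e⟩, hf, hT, ⟨e'⟩⟩, -, hU⟩
    obtain ⟨T, rfl, h⟩ := (mem_twoSilt_iff x).1 hx
    refine ⟨T, rfl, h, h.isTwoTerm.factorsRight hF (h.isTwoTerm.isZero_homologyOf_neg_one hF ?_)⟩
    intro a
    have hY : Geq T Y :=
      Geq.of_retract_right ⟨biprod.inl ≫ e'.inv, e'.hom ≫ biprod.fst, by simp⟩ hU
    obtain ⟨c, rfl⟩ := exists_eq_comp_mor₂ hT a (hY 1 one_pos _)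
    have h1 : IsZero ((homologyOf F (-1)).obj M') := isZero_of_add _
      (hF.isZero_of_iso_biprod eA (stalkFunctor A ⋙ shiftFunctor (Kb A) (1 : ℤ))
        (homologyOf F (-1)) (stalkShiftHomology F) M₁ e) hf.mem
    exact map_comp_eq_zero_of_isZero (homologyOf F (-1)) h1 c f
  · rintro ⟨T, rfl, h, hT⟩
    refine ⟨(mem_twoSilt_iff _).2 ⟨T, rfl, h⟩, ?_⟩
    obtain ⟨N, f, hf, hmin⟩ := hP
    let G := stalkFunctor A ⋙ shiftFunctor (Kb A) (1 : ℤ)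
    have hf' := hf.isMinRightApprox_map G hmin
    obtain ⟨Y, g, d, hY⟩ := distinguished_cocone_triangle₁ (G.map f)
    let e : (stalk (regular A))⟦(1 : ℤ)⟧ ≅ G.obj P ⊞ G.obj M := G.mapIso eA ≪≫ additiveMapBiprod G P M
    have h1 : Geq T (G.obj P) :=
      h.geq'.of_retract_right ⟨biprod.inl ≫ e.inv, e.hom ≫ biprod.fst, by simp⟩
    have h2 : Geq T (G.obj M) :=
      h.geq'.of_retract_right ⟨biprod.inr ≫ e.inv, e.hom ≫ biprod.snd, by simp⟩
    refine ⟨Y ⊞ G.obj M, ⟨_, _, Y, _, g, d, ⟨e⟩, hf', hY, ⟨Iso.refl _⟩⟩, h.geq, ?_⟩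
    refine Geq.biprod_right (geq_cocone hY h1 (h2.add_right hf'.mem) (fun a => ?_) hT) h2
    obtain ⟨c, hc⟩ := hf'.factors _ ⟨1, ⟨Retract.ofIso (biproductUniqueIso
      (fun _ : Fin 1 => G.obj M)).symm⟩⟩ a
    exact ⟨c, hc.symm⟩

/-- Each element of `2silt A` lies in exactly one of `𝒯⁻` and `𝒯⁺`. -/
theorem isCompl_factors (hF : IsLocalTop F P M) :
    {x | ∃ T : Kb A, isoClass T = x ∧ IsTwoSilting T ∧ FactorsLeft P M T} ∪
      {x | ∃ T : Kb A, isoClass T = x ∧ IsTwoSilting T ∧ FactorsRight P M T} = twoSilt A ∧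
    Disjoint {x | ∃ T : Kb A, isoClass T = x ∧ IsTwoSilting T ∧ FactorsLeft P M T}
      {x | ∃ T : Kb A, isoClass T = x ∧ IsTwoSilting T ∧ FactorsRight P M T} := by
  constructor
  · ext x
    rw [mem_twoSilt_iff]
    constructor
    · rintro (⟨T, hx, hT, -⟩ | ⟨T, hx, hT, -⟩) <;> exact ⟨T, hx, hT⟩
    · rintro ⟨T, hx, hT⟩
      exact (factorsLeft_or_factorsRight hF hT.isTwoTerm hT.isSilting.geq_self).imp
        (fun h => ⟨T, hx, hT, h⟩) (fun h => ⟨T, hx, hT, h⟩)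
  · rw [Set.disjoint_left]
    rintro _ ⟨T, rfl, hT, h⟩ ⟨T', hx, hT', h'⟩
    obtain ⟨e⟩ : Nonempty (T' ≅ T) := Quotient.exact hx
    exact not_factorsLeft_and_factorsRight hF hT.isTwoTerm hT.isSilting ⟨h, h'.of_iso e⟩

end Mutation

/-! ### Dualities can be checked on a generator -/

section ContravariantGenerator

open Opposite

variable {C : Type*} [Category* C] [Preadditive C] [HasFiniteBiproducts C] (G : Cᵒᵖ ⥤ C)
  [G.Additive] {Q : C}

/-- Two splittings of the same idempotent are isomorphic. -/
def isoOfSplittings {X Y Z W : C} (i : X ⟶ Z) (p : Z ⟶ X) (hip : i ≫ p = 𝟙 X) (j : Y ⟶ W)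
    (q : W ⟶ Y) (hjq : j ≫ q = 𝟙 Y) (θ : Z ≅ W) (h : (p ≫ i) ≫ θ.hom = θ.hom ≫ q ≫ j) : X ≅ Y where
  hom := i ≫ θ.hom ≫ q
  inv := j ≫ θ.inv ≫ p
  hom_inv_id := by
    have h' : θ.hom ≫ q ≫ j ≫ θ.inv = p ≫ i := by
      have := congr($h ≫ θ.inv)
      simpa using this.symm
    calc _ = i ≫ (θ.hom ≫ q ≫ j ≫ θ.inv) ≫ p := by simp
      _ = (i ≫ p) ≫ (i ≫ p) := by rw [h']; simp
      _ = 𝟙 X := by rw [hip, Category.comp_id]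
  inv_hom_id := by
    have h' : θ.inv ≫ p ≫ i ≫ θ.hom = q ≫ j := by
      have := congr(θ.inv ≫ $h)
      simpa using this
    calc _ = j ≫ (θ.inv ≫ p ≫ i ≫ θ.hom) ≫ q := by simp
      _ = (j ≫ q) ≫ (j ≫ q) := by rw [h']; simp
      _ = 𝟙 Y := by rw [hjq, Category.comp_id]

variable (hQ : ∀ X : C, ∃ (n : ℕ) (f : Fin n → (X ⟶ Q)) (g : Fin n → (Q ⟶ X)),
  ∑ j, f j ≫ g j = 𝟙 X)

include hQ

/-- A morphism is recovered from its matrix of components through `Q`; the same principle gives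
fullness below. -/
theorem faithful_of_generator (h : ∀ f : Q ⟶ Q, G.map f.op = 0 → f = 0) : G.Faithful where
  map_injective {X Y a b} hab := by
    obtain ⟨n, f, g, hfg⟩ := hQ X.unop
    obtain ⟨n', f', g', hfg'⟩ := hQ Y.unop
    rw [← sub_eq_zero]
    apply Quiver.Hom.unop_inj
    have h1 : ∀ k j, g' k ≫ (a - b).unop ≫ f j = 0 := by
      intro k j
      apply h
      rw [op_comp, op_comp, G.map_comp, G.map_comp, Quiver.Hom.op_unop, G.map_sub, hab, sub_self,
        comp_zero, zero_comp]
    calc (a - b).unop = (∑ k, f' k ≫ g' k) ≫ (a - b).unop ≫ (∑ j, f j ≫ g j) := by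
          rw [hfg, hfg', Category.comp_id, Category.id_comp]
      _ = 0 := by
          rw [Preadditive.sum_comp]
          refine Finset.sum_eq_zero fun k _ => ?_
          rw [Preadditive.comp_sum, Preadditive.comp_sum]
          refine Finset.sum_eq_zero fun j _ => ?_
          have := congr(f' k ≫ $(h1 k j) ≫ g j)
          simpa using this

theorem full_of_generator
    (h : ∀ f : G.obj (op Q) ⟶ G.obj (op Q), ∃ g : Q ⟶ Q, G.map g.op = f) : G.Full where
  map_surjective {X Y} a := by
    obtain ⟨n, f, g, hfg⟩ := hQ X.unop
    obtain ⟨n', f', g', hfg'⟩ := hQ Y.unop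
    have hX : 𝟙 (G.obj X) = ∑ k, G.map (g k).op ≫ G.map (f k).op := by
      simp only [← G.map_comp, ← op_comp]
      rw [← G.map_sum, ← op_sum, hfg, op_id]
      exact (G.map_id X).symm
    have hY : 𝟙 (G.obj Y) = ∑ k, G.map (g' k).op ≫ G.map (f' k).op := by
      simp only [← G.map_comp, ← op_comp]
      rw [← G.map_sum, ← op_sum, hfg', op_id]
      exact (G.map_id Y).symm
    choose m hm using fun k j => h (G.map (f k).op ≫ a ≫ G.map (g' j).op)
    refine ⟨∑ k, ∑ j, (f' j ≫ m k j ≫ g k).op, ?_⟩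
    rw [G.map_sum]
    simp only [G.map_sum, op_comp, G.map_comp, hm]
    calc _ = (∑ k, G.map (g k).op ≫ G.map (f k).op) ≫ a ≫
          (∑ k, G.map (g' k).op ≫ G.map (f' k).op) := by
          simp only [Preadditive.sum_comp, Preadditive.comp_sum, Category.assoc]
          exact Finset.sum_comm
      _ = a := by rw [← hX, ← hY, Category.comp_id, Category.id_comp]

/-- An object `Y` is the image of an idempotent on a power of `Q`. That power is isomorphic to its
own dual, so the idempotent is the dual of one on the source side, whose splitting maps to `Y`. -/
theorem essSurj_of_generator [IsIdempotentComplete C] [G.Full] [G.Faithful]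
    (e : G.obj (op Q) ≅ Q) : G.EssSurj where
  mem_essImage Y := by
    obtain ⟨n, f, g, hfg⟩ := hQ Y
    let Z : C := ⨁ fun _ : Fin n => Q
    let j : Y ⟶ Z := biproduct.lift f
    let q : Z ⟶ Y := biproduct.desc g
    have hjq : j ≫ q = 𝟙 Y := biproduct.lift_desc.trans hfg
    let θ : G.obj (op Z) ≅ Z :=
      { hom := biproduct.lift fun k => G.map (biproduct.ι (fun _ : Fin n => Q) k).op ≫ e.hom
        inv := biproduct.desc fun k => e.inv ≫ G.map (biproduct.π (fun _ : Fin n => Q) k).op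
        hom_inv_id := by
          rw [biproduct.lift_desc]
          simp only [Category.assoc, e.hom_inv_id_assoc]
          simp only [← G.map_comp, ← op_comp]
          rw [← G.map_sum, ← op_sum, biproduct.total, op_id]
          exact G.map_id _
        inv_hom_id := by
          ext k l
          simp only [biproduct.ι_desc_assoc, Category.assoc, biproduct.lift_π]
          rw [← G.map_comp_assoc, ← op_comp]
          change _ = biproduct.ι (fun _ : Fin n => Q) l ≫ 𝟙 _ ≫ biproduct.π (fun _ : Fin n => Q) k
          rw [Category.id_comp]
          by_cases hkl : k = l
          · subst hkl
            simp
          · rw [biproduct.ι_π_ne _ (Ne.symm hkl), biproduct.ι_π_ne _ hkl, op_zero, G.map_zero,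
              zero_comp, comp_zero] }
    obtain ⟨a, ha⟩ := G.map_surjective (θ.hom ≫ (q ≫ j) ≫ θ.inv)
    have haa : a.unop ≫ a.unop = a.unop := by
      rw [← unop_comp]
      congr 1
      apply G.map_injective
      rw [G.map_comp, ha]
      have : θ.hom ≫ q ≫ (j ≫ q) ≫ j ≫ θ.inv = θ.hom ≫ q ≫ j ≫ θ.inv := by
        rw [hjq, Category.id_comp]
      simpa using this
    obtain ⟨X, i, p, hip, hpi⟩ := IsIdempotentComplete.idempotents_split Z a.unop haa
    refine ⟨op X, ⟨isoOfSplittings (G.map p.op) (G.map i.op) ?_ j q hjq θ ?_⟩⟩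
    · rw [← G.map_comp, ← op_comp, hip]
      exact G.map_id _
    · rw [← G.map_comp, ← op_comp, hpi, Quiver.Hom.op_unop, ha]
      simp

end ContravariantGenerator

/-! ### The duality `Hom(-, A)` twisted by an anti-automorphism -/

section DualFunctor

open Opposite

variable {A : Type u} [Ring A] (τ : Aᵐᵒᵖ ≃+* A)

theorem isFGProj_of_sum (X : ModuleCat.{u} Aᵐᵒᵖ) {n : ℕ} (f : Fin n → (X →ₗ[Aᵐᵒᵖ] A))
    (g : Fin n → (A →ₗ[Aᵐᵒᵖ] X)) (h : ∀ x, ∑ j, g j (f j x) = x) : isFGProj A X := by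
  have h1 := (regular A).property.1
  have h2 := (regular A).property.2
  have : Module.Finite Aᵐᵒᵖ A := h1
  have : Module.Projective Aᵐᵒᵖ A := h2
  let i : X →ₗ[Aᵐᵒᵖ] (Fin n → A) := LinearMap.pi f
  let p : (Fin n → A) →ₗ[Aᵐᵒᵖ] X := ∑ j, g j ∘ₗ LinearMap.proj j
  have : Module.Projective Aᵐᵒᵖ (Fin n → A) :=
    Module.Projective.of_equiv (DFinsupp.linearEquivFunOnFintype (R := Aᵐᵒᵖ) (M := fun _ : Fin n => A))
  have hpi : p ∘ₗ i = LinearMap.id := by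
    ext x
    simpa [i, p] using h x
  exact ⟨Module.Finite.of_surjective p fun x => ⟨i x, congr($hpi x)⟩,
    Module.Projective.of_split i p hpi⟩

/-- The module `Hom(X, A)`, made into a right module by means of `τ`. -/
noncomputable def dualModule (X : FGProj A) : ModuleCat.{u} Aᵐᵒᵖ :=
  (ModuleCat.restrictScalars τ.toRingHom).obj (ModuleCat.of A (X.obj →ₗ[Aᵐᵒᵖ] A))

/-- The map `Hom(Y, A) → Hom(X, A)` induced by `X ⟶ Y`. -/
noncomputable def dualMap {X Y : FGProj A} (f : X ⟶ Y) : dualModule τ Y ⟶ dualModule τ X :=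
  (ModuleCat.restrictScalars τ.toRingHom).map
    (ModuleCat.ofHom
      { toFun := fun φ : Y.obj →ₗ[Aᵐᵒᵖ] A => φ ∘ₗ lin f
        map_add' := fun _ _ => rfl
        map_smul' := fun _ _ => rfl })

/-- The underlying linear map of an element of the dual. -/
noncomputable def dualVal {X : FGProj A} (φ : dualModule τ X) : X.obj →ₗ[Aᵐᵒᵖ] A := φ

theorem dualVal_injective {X : FGProj A} {φ ψ : dualModule τ X}
    (h : ∀ x, dualVal τ φ x = dualVal τ ψ x) : φ = ψ :=
  LinearMap.ext (f := dualVal τ φ) (g := dualVal τ ψ) h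

theorem dualVal_smul {X : FGProj A} (r : Aᵐᵒᵖ) (φ : dualModule τ X) (x : X.obj) :
    dualVal τ (r • φ) x = τ r * dualVal τ φ x := rfl

/-- The value at `1` of an element of the dual of the regular module. -/
noncomputable def dualEval (φ : dualModule τ (regular A)) : A := dualVal τ φ (1 : A)

theorem dualVal_eq (φ : dualModule τ (regular A)) (x : A) : dualVal τ φ x = dualEval τ φ * x :=
  (congrArg (dualVal τ φ) (one_mul x).symm).trans
    (map_smul (dualVal τ φ) (MulOpposite.op x) (1 : A))

theorem dualEval_smul (r : Aᵐᵒᵖ) (φ : dualModule τ (regular A)) :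
    dualEval τ (r • φ) = τ r * dualEval τ φ := rfl

/-- The element of the dual of the regular module with a given value at `1`. -/
noncomputable def dualOfEval (a : A) : dualModule τ (regular A) :=
  ({ toFun := fun x : A => a * x
     map_add' := mul_add a
     map_smul' := fun r x => (mul_assoc a x r.unop).symm } : A →ₗ[Aᵐᵒᵖ] A)

/-- The dual of the regular module is the regular module. -/
noncomputable def dualRegular : dualModule τ (regular A) ≃ₗ[Aᵐᵒᵖ] A where
  toFun φ := (τ.symm (dualEval τ φ)).unop
  map_add' φ ψ := by
    rw [← MulOpposite.unop_add, ← map_add]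
    rfl
  map_smul' r φ := by
    rw [dualEval_smul, map_mul, τ.symm_apply_apply]
    rfl
  invFun a := dualOfEval τ (τ (MulOpposite.op a))
  left_inv φ := dualVal_injective τ fun (x : A) => by
    refine Eq.trans ?_ (dualVal_eq τ φ x).symm
    exact congrArg (· * x) (τ.apply_symm_apply (dualEval τ φ))
  right_inv a := by
    change (τ.symm (τ (MulOpposite.op a) * 1)).unop = a
    rw [mul_one, τ.symm_apply_apply]
    rfl

/-- Dualizing a decomposition of the identity of `X` through `A` gives one through the dual of `A`,
which is again `A`. -/
theorem isFGProj_dualModule (X : FGProj A) : isFGProj A (dualModule τ X) := by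
  obtain ⟨n, f, g, h⟩ := exists_sum_comp_regular X
  refine isFGProj_of_sum _
    (fun j => (dualRegular τ).toLinearMap ∘ₗ (dualMap τ (g j)).hom)
    (fun j => (dualMap τ (f j)).hom ∘ₗ (dualRegular τ).symm.toLinearMap) fun φ => ?_
  have h1 : ∀ j, (dualMap τ (f j)).hom ((dualRegular τ).symm
      ((dualRegular τ) ((dualMap τ (g j)).hom φ))) = dualMap τ (f j ≫ g j) φ := by
    intro j
    rw [LinearEquiv.symm_apply_apply]
    rfl
  simp only [LinearMap.comp_apply, LinearEquiv.coe_coe, h1]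
  refine dualVal_injective τ fun x => ?_
  have h2 : ∀ s : Finset (Fin n), dualVal τ (∑ j ∈ s, dualMap τ (f j ≫ g j) φ) x =
      dualVal τ φ (lin (∑ j ∈ s, f j ≫ g j) x) := by
    intro s
    induction s using Finset.induction_on with
    | empty => exact (map_zero (dualVal τ φ)).symm
    | insert a s ha ih =>
      rw [Finset.sum_insert ha, Finset.sum_insert ha, lin_add_apply, map_add, ← ih]
      rfl
  rw [h2, h]
  rfl

/-- The duality `Hom(-, A)` on finitely generated projective modules. -/
noncomputable def dualFunctor : (FGProj A)ᵒᵖ ⥤ FGProj A where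
  obj X := ⟨dualModule τ X.unop, isFGProj_dualModule τ X.unop⟩
  map f := ⟨dualMap τ f.unop⟩
  map_id _ := rfl
  map_comp _ _ := rfl

instance : (dualFunctor τ).Additive where
  map_add {_ _ f g} := lin_injective fun φ => dualVal_injective τ fun x =>
    map_add (dualVal τ φ) (lin f.unop x) (lin g.unop x)

/-- The dual of `A` is generated by the identity map, so a morphism out of it is determined by one
value; fullness rests on this. -/
theorem dualModule_regular_eq_smul (φ : dualModule τ (regular A)) :
    φ = τ.symm (dualEval τ φ) • dualOfEval τ 1 := by
  refine dualVal_injective τ fun (x : A) => (dualVal_eq τ φ x).trans ?_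
  refine Eq.trans ?_ (dualVal_smul τ (τ.symm (dualEval τ φ)) (dualOfEval τ 1) x).symm
  rw [τ.apply_symm_apply]
  exact congrArg (dualEval τ φ * ·) (one_mul x).symm

instance : (dualFunctor τ).Faithful :=
  faithful_of_generator (Q := regular A) _ exists_sum_comp_regular fun f hf => by
    refine lin_injective fun x => ?_
    have h1 : dualVal τ (dualOfEval τ 1) (lin f x) = 0 :=
      congr(dualVal τ (lin $hf (dualOfEval τ 1)) x)
    exact (one_mul (M := A) (lin f x)).symm.trans h1

instance : (dualFunctor τ).Full :=
  full_of_generator (Q := regular A) _ exists_sum_comp_regular fun f => by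
    let g : regular A ⟶ regular A := ofLin (dualVal τ (lin f (dualOfEval τ 1)))
    refine ⟨g, lin_injective fun φ => ?_⟩
    have h : lin ((dualFunctor τ).map g.op) (dualOfEval τ 1) = lin f (dualOfEval τ 1) :=
      dualVal_injective τ fun x => one_mul (M := A) (dualVal τ (lin f (dualOfEval τ 1)) x)
    have h1 : ∀ r : Aᵐᵒᵖ, lin ((dualFunctor τ).map g.op) (r • dualOfEval τ 1) =
        lin f (r • dualOfEval τ 1) := by
      intro r
      exact (map_smul (lin ((dualFunctor τ).map g.op)) r (dualOfEval τ 1)).trans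
        ((congrArg (r • ·) h).trans (map_smul (lin f) r (dualOfEval τ 1)).symm)
    have h2 := h1 (τ.symm (dualEval τ φ))
    rwa [← dualModule_regular_eq_smul τ φ] at h2

/-- The dual of the regular module is the regular module. -/
noncomputable def dualRegularIso : (dualFunctor τ).obj (op (regular A)) ≅ regular A where
  hom := ofLin (dualRegular τ).toLinearMap
  inv := ofLin (Y := (dualFunctor τ).obj (op (regular A))) (dualRegular τ).symm.toLinearMap
  hom_inv_id := lin_injective fun x => (dualRegular τ).symm_apply_apply x
  inv_hom_id := lin_injective fun x => (dualRegular τ).apply_symm_apply x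

instance : (dualFunctor τ).EssSurj :=
  essSurj_of_generator _ exists_sum_comp_regular (dualRegularIso τ)

/-- The dual of `eA` is `eA` if `e` is fixed by the anti-automorphism. -/
noncomputable def dualIdemModuleIso (e : A) (he : IsIdempotentElem e)
    (h : τ (MulOpposite.op e) = e) :
    (dualFunctor τ).obj (op (idemModule e he)) ≅ idemModule e he :=
  isoOfSplittings ((dualFunctor τ).map (idemProj e he).op) ((dualFunctor τ).map (idemIncl e he).op)
    (by
      rw [← Functor.map_comp, ← op_comp, idemIncl_idemProj]
      exact (dualFunctor τ).map_id _)
    (idemIncl e he) (idemProj e he) (idemIncl_idemProj e he) (dualRegularIso τ) (by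
      rw [← Functor.map_comp, ← op_comp]
      refine lin_injective fun φ => ?_
      -- Precomposing with left multiplication by `e` multiplies the value at `1` by `e` on the
      -- right; the inverse of `τ` turns this into left multiplication by `e`, because `τ` fixes
      -- `e`.
      change (τ.symm (dualVal τ φ (e * 1 : A))).unop = e * (τ.symm (dualEval τ φ)).unop
      have h1 : τ.symm e = MulOpposite.op e := by rw [← h, τ.symm_apply_apply, h]
      have h2 : dualVal τ φ (e * 1 : A) = dualEval τ φ * e :=
        (dualVal_eq τ φ _).trans (congrArg (dualEval τ φ * ·) (mul_one e))
      rw [h2, map_mul, h1]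
      rfl)

end DualFunctor

/-! ### Passing the duality to complexes up to homotopy -/

section DualHomotopyCategory

open Opposite

variable {C : Type*} [Category* C] [Preadditive C]

variable (C) in
/-- The contravariant functor to the homotopy category of the opposite category. -/
noncomputable def homotopyCategoryOp :
    (HomotopyCategory C (ComplexShape.up ℤ))ᵒᵖ ⥤ HomotopyCategory Cᵒᵖ (ComplexShape.up ℤ) :=
  (CategoryTheory.Quotient.lift _ ((CochainComplex.opEquivalence C).functor ⋙
    HomotopyCategory.quotient Cᵒᵖ (ComplexShape.up ℤ)).rightOp (by
      rintro K L f g ⟨h⟩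
      exact Quiver.Hom.unop_inj
        (HomotopyCategory.eq_of_homotopy _ _ (CochainComplex.homotopyOp h)))).leftOp

instance : (homotopyCategoryOp C).Additive where
  map_add {X Y f g} := by
    obtain ⟨f, rfl⟩ : ∃ f' : Y.unop ⟶ X.unop, f = f'.op := ⟨f.unop, rfl⟩
    obtain ⟨g, rfl⟩ : ∃ g' : Y.unop ⟶ X.unop, g = g'.op := ⟨g.unop, rfl⟩
    obtain ⟨f, rfl⟩ := (HomotopyCategory.quotient C (ComplexShape.up ℤ)).map_surjective f
    obtain ⟨g, rfl⟩ := (HomotopyCategory.quotient C (ComplexShape.up ℤ)).map_surjective g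
    rfl

instance : (homotopyCategoryOp C).Full where
  map_surjective {X Y} f := by
    obtain ⟨f, rfl⟩ := (HomotopyCategory.quotient Cᵒᵖ (ComplexShape.up ℤ)).map_surjective f
    obtain ⟨f, rfl⟩ := (CochainComplex.opEquivalence C).functor.map_surjective (X := op X.unop.as)
      (Y := op Y.unop.as) f
    exact ⟨((HomotopyCategory.quotient C (ComplexShape.up ℤ)).map f.unop).op, rfl⟩

instance : (homotopyCategoryOp C).Faithful where
  map_injective {X Y f g} h := by
    obtain ⟨f, rfl⟩ : ∃ f' : Y.unop ⟶ X.unop, f = f'.op := ⟨f.unop, rfl⟩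
    obtain ⟨g, rfl⟩ : ∃ g' : Y.unop ⟶ X.unop, g = g'.op := ⟨g.unop, rfl⟩
    obtain ⟨f, rfl⟩ := (HomotopyCategory.quotient C (ComplexShape.up ℤ)).map_surjective f
    obtain ⟨g, rfl⟩ := (HomotopyCategory.quotient C (ComplexShape.up ℤ)).map_surjective g
    exact congrArg Quiver.Hom.op (HomotopyCategory.eq_of_homotopy _ _
      (CochainComplex.homotopyUnop (HomotopyCategory.homotopyOfEq _ _ h)))

variable (G : Cᵒᵖ ⥤ C) [G.Additive]

/-- The contravariant functor on cochain complexes induced by a contravariant functor. -/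
noncomputable def dualComplex : (CochainComplex C ℤ)ᵒᵖ ⥤ CochainComplex C ℤ :=
  (CochainComplex.opEquivalence C).functor ⋙ G.mapHomologicalComplex (ComplexShape.up ℤ)

/-- The contravariant functor on the homotopy category induced by a contravariant functor. -/
noncomputable def dualHomotopyCategory : (HomotopyCategory C (ComplexShape.up ℤ))ᵒᵖ ⥤
    HomotopyCategory C (ComplexShape.up ℤ) :=
  homotopyCategoryOp C ⋙ G.mapHomotopyCategory (ComplexShape.up ℤ)

instance : (dualHomotopyCategory G).Additive := by unfold dualHomotopyCategory; infer_instance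

instance [G.Full] [G.Faithful] : (dualHomotopyCategory G).Full := by
  unfold dualHomotopyCategory; infer_instance

instance [G.Full] [G.Faithful] : (dualHomotopyCategory G).Faithful := by
  unfold dualHomotopyCategory; infer_instance

theorem dualComplex_obj_d (K : CochainComplex C ℤ) (m n : ℤ) :
    ((dualComplex G).obj (op K)).d m n = G.map (K.d (-n) (-m)).op := rfl

theorem map_op_units_smul {X Y Z W : C} (s : ℤˣ) {α : op X ⟶ op Y} {d : Z ⟶ Y} {d' : W ⟶ X}
    {β : op W ⟶ op Z} (h : α ≫ d.op = d'.op ≫ β) :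
    G.map α ≫ (s • G.map d.op) = G.map (s • d').op ≫ G.map β := by
  rcases Int.units_eq_one_or s with rfl | rfl
  · rw [one_smul, one_smul, ← G.map_comp, h, G.map_comp]
  · rw [Units.neg_smul, Units.neg_smul, one_smul, one_smul, op_neg, G.map_neg,
      Preadditive.comp_neg, Preadditive.neg_comp, ← G.map_comp, h, G.map_comp]

/-- The duality exchanges the shift functors. -/
noncomputable def dualComplexShiftIso (K : CochainComplex C ℤ) (a b : ℤ) (h : a + b = 0) :
    (dualComplex G).obj (op (K⟦a⟧)) ≅ ((dualComplex G).obj (op K))⟦b⟧ :=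
  HomologicalComplex.Hom.isoOfComponents
    (fun n => G.mapIso ((K.XIsoOfEq (show -(n + b) = -n + a by lia)).op)) (by
      intro i j _
      rw [CochainComplex.shiftFunctor_obj_d', dualComplex_obj_d, dualComplex_obj_d,
        CochainComplex.shiftFunctor_obj_d']
      obtain rfl : b = -a := by lia
      have key : (K.XIsoOfEq (show -(i + -a) = -i + a by lia)).op.hom ≫
          (K.d (-(j + -a)) (-(i + -a))).op = (K.d (-j + a) (-i + a)).op ≫
          (K.XIsoOfEq (show -(j + -a) = -j + a by lia)).op.hom := by
        simp [← op_comp]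
      -- The shifts by `a` and by `-a` put the same sign on differentials, so the degreewise
      -- identification needs no sign of its own.
      rw [Int.negOnePow_neg]
      exact map_op_units_smul G a.negOnePow key)

theorem isZero_of_isZero_map [G.Faithful] [HasZeroObject C] {X : C} (h : IsZero (G.obj (op X))) : IsZero X := by
  rw [IsZero.iff_id_eq_zero]
  exact Quiver.Hom.op_inj (G.map_injective (h.eq_of_src _ _))

variable [HasZeroObject C] 

/-- A complex concentrated in degree zero. -/
noncomputable def isoSingleOfIsZero (K : CochainComplex C ℤ) (h : ∀ n, n ≠ 0 → IsZero (K.X n)) :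
    K ≅ (CochainComplex.singleFunctor C 0).obj (K.X 0) :=
  HomologicalComplex.Hom.isoOfComponents
    (fun n => if hn : n = 0 then K.XIsoOfEq hn ≪≫
        (HomologicalComplex.singleObjXIsoOfEq (ComplexShape.up ℤ) 0 (K.X 0) n hn).symm
      else (h n hn).iso (HomologicalComplex.isZero_single_obj_X _ _ _ _ hn)) (by
    intro i j hij
    have hij : i + 1 = j := hij
    by_cases hi : i = 0
    · exact (HomologicalComplex.isZero_single_obj_X _ _ _ _ (by lia)).eq_of_tgt _ _
    · exact (h i hi).eq_of_src _ _)

end DualHomotopyCategory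

section

variable {C : Type*} [Category* C] [Preadditive C] [HasZeroObject C] [HasShift C ℤ]
  [∀ n : ℤ, (shiftFunctor C n).Additive] [Pretriangulated C]

theorem exists_distinguished_of_iso {T : Triangle C} (hT : T ∈ distTriang C) {X Y Z : C}
    {f : X ⟶ Y} {g : Y ⟶ Z} (e₁ : T.obj₁ ≅ X) (e₂ : T.obj₂ ≅ Y) (e₃ : T.obj₃ ≅ Z)
    (h₁ : T.mor₁ ≫ e₂.hom = e₁.hom ≫ f) (h₂ : T.mor₂ ≫ e₃.hom = e₂.hom ≫ g) :
    ∃ q, Triangle.mk f g q ∈ distTriang C :=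
  ⟨e₃.inv ≫ T.mor₃ ≫ e₁.hom⟦1⟧', isomorphic_distinguished _ hT _
    (Triangle.isoMk _ _ e₁ e₂ e₃ h₁ h₂ (by
      change T.mor₃ ≫ e₁.hom⟦1⟧' = e₃.hom ≫ e₃.inv ≫ T.mor₃ ≫ e₁.hom⟦1⟧'
      rw [e₃.hom_inv_id_assoc])).symm⟩

end

/-! ### Duals of distinguished triangles -/

section DualTriangle

open Opposite

variable {C : Type*} [Category* C] [Preadditive C] [HasZeroObject C] [HasBinaryBiproducts C]
  (G : Cᵒᵖ ⥤ C) [G.Additive]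

/-- The dual of a short complex of cochain complexes. -/
noncomputable def dualShortComplex (S : ShortComplex (CochainComplex C ℤ)) :
    ShortComplex (CochainComplex C ℤ) :=
  ShortComplex.mk ((dualComplex G).map S.g.op) ((dualComplex G).map S.f.op) (by
    rw [← Functor.map_comp, ← op_comp, S.zero]
    ext n
    exact G.map_zero _ _)

/-- Duality preserves degreewise splittings. -/
noncomputable def dualSplitting (S : ShortComplex (CochainComplex C ℤ))
    (σ : ∀ n, (S.map (HomologicalComplex.eval C _ n)).Splitting) (n : ℤ) :
    ((dualShortComplex G S).map (HomologicalComplex.eval C _ n)).Splitting :=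
  (σ (-n)).op.map G

/-- Distinguished triangles come from degreewise split short exact sequences, and dualizing such a
sequence gives another with its ends exchanged. The connecting map is left unidentified, since only
its existence is used. -/
theorem exists_dual_distinguished (T : Triangle (HomotopyCategory C (ComplexShape.up ℤ)))
    (hT : T ∈ distTriang _) :
    ∃ q, Triangle.mk ((dualHomotopyCategory G).map T.mor₂.op)
      ((dualHomotopyCategory G).map T.mor₁.op) q ∈
        distTriang (HomotopyCategory C (ComplexShape.up ℤ)) := by
  obtain ⟨S, σ, ⟨e⟩⟩ :=
    (HomotopyCategory.distinguished_iff_iso_trianglehOfDegreewiseSplit T).1 hT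
  have h := (HomotopyCategory.distinguished_iff_iso_trianglehOfDegreewiseSplit _).2
    ⟨_, dualSplitting G S σ, ⟨Iso.refl _⟩⟩
  let e₁ := (dualHomotopyCategory G).mapIso (Triangle.π₁.mapIso e).op
  let e₂ := (dualHomotopyCategory G).mapIso (Triangle.π₂.mapIso e).op
  let e₃ := (dualHomotopyCategory G).mapIso (Triangle.π₃.mapIso e).op
  exact exists_distinguished_of_iso h e₃ e₂ e₁
    ((((dualHomotopyCategory G).map_comp
      (CochainComplex.trianglehOfDegreewiseSplit S σ).mor₂.op e.hom.hom₂.op).symm.trans (congrArg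
      (fun f => (dualHomotopyCategory G).map (Quiver.Hom.op f)) e.hom.comm₂.symm)).trans
      ((dualHomotopyCategory G).map_comp e.hom.hom₃.op T.mor₂.op))
    ((((dualHomotopyCategory G).map_comp
      (CochainComplex.trianglehOfDegreewiseSplit S σ).mor₁.op e.hom.hom₁.op).symm.trans (congrArg
      (fun f => (dualHomotopyCategory G).map (Quiver.Hom.op f)) e.hom.comm₁.symm)).trans
      ((dualHomotopyCategory G).map_comp e.hom.hom₂.op T.mor₁.op))

end DualTriangle

/-! ### The duality on `Kᵇ(proj A)` -/

section DualKb

open Opposite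

instance {C : Type*} [Category* C] [Preadditive C] (G : Cᵒᵖ ⥤ C) [G.Additive] [G.Full] [G.Faithful]
    [G.EssSurj] : (dualComplex G).EssSurj := by
  have : G.IsEquivalence := {}
  have : G.asEquivalence.functor.Additive := inferInstanceAs G.Additive
  have : (G.mapHomologicalComplex (ComplexShape.up ℤ)).EssSurj :=
    inferInstanceAs (G.asEquivalence.mapHomologicalComplex (ComplexShape.up ℤ)).functor.EssSurj
  unfold dualComplex
  infer_instance

variable {A : Type u} [Ring A] (G : (FGProj A)ᵒᵖ ⥤ FGProj A) [G.Additive]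

theorem isBounded_dualComplex (K : CochainComplex (FGProj A) ℤ)
    (h : isBounded A ((HomotopyCategory.quotient _ _).obj K)) :
    isBounded A ((HomotopyCategory.quotient _ _).obj ((dualComplex G).obj (op K))) := by
  rw [isBounded_quotient_iff] at h ⊢
  obtain ⟨a, b, ha, hb⟩ := h
  refine ⟨-b, -a, ?_, ?_⟩
  · rw [CochainComplex.isStrictlyGE_iff]
    intro i hi
    exact G.map_isZero (K.isZero_of_isStrictlyLE b (-i) (by lia)).op
  · rw [CochainComplex.isStrictlyLE_iff]
    intro i hi
    exact G.map_isZero (K.isZero_of_isStrictlyGE a (-i) (by lia)).op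

theorem isBounded_of_dualComplex [G.Faithful] (K : CochainComplex (FGProj A) ℤ)
    (h : isBounded A ((HomotopyCategory.quotient _ _).obj ((dualComplex G).obj (op K)))) :
    isBounded A ((HomotopyCategory.quotient _ _).obj K) := by
  rw [isBounded_quotient_iff] at h ⊢
  obtain ⟨a, b, ha, hb⟩ := h
  have hz (i : ℤ) (h : IsZero (((dualComplex G).obj (op K)).X (-i))) : IsZero (K.X i) := by
    have h' : IsZero (K.X (- -i)) := isZero_of_isZero_map G h
    rwa [neg_neg] at h'
  refine ⟨-b, -a, ?_, ?_⟩
  · rw [CochainComplex.isStrictlyGE_iff]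
    intro i hi
    exact hz i (CochainComplex.isZero_of_isStrictlyLE _ b (-i) (by lia))
  · rw [CochainComplex.isStrictlyLE_iff]
    intro i hi
    exact hz i (CochainComplex.isZero_of_isStrictlyGE _ a (-i) (by lia))

/-- The duality of `Kᵇ(proj A)` induced by a duality of `proj A`. -/
noncomputable def dualKb : (Kb A)ᵒᵖ ⥤ Kb A :=
  (isBounded A).lift ((isBounded A).ι.op ⋙ dualHomotopyCategory G) fun X =>
    isBounded_dualComplex G X.unop.obj.as X.unop.property

instance : (dualKb G).Additive where
  map_add {X Y f g} := by
    apply ObjectProperty.hom_ext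
    exact ((isBounded A).ι.op ⋙ dualHomotopyCategory G).map_add

instance [G.Full] [G.Faithful] : (dualKb G).Full where
  map_surjective f := by
    obtain ⟨g, hg⟩ := ((isBounded A).ι.op ⋙ dualHomotopyCategory G).map_surjective f.hom
    exact ⟨g, ObjectProperty.hom_ext _ hg⟩

instance [G.Full] [G.Faithful] : (dualKb G).Faithful where
  map_injective h :=
    ((isBounded A).ι.op ⋙ dualHomotopyCategory G).map_injective congr(($h).hom)

instance [G.Full] [G.Faithful] [G.EssSurj] : (dualKb G).EssSurj where
  mem_essImage Y := by
    let e := (dualComplex G).objObjPreimageIso Y.obj.as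
    have h : isBounded A ((HomotopyCategory.quotient _ _).obj
        ((dualComplex G).obj ((dualComplex G).objPreimage Y.obj.as))) := by
      obtain ⟨a, b, _, _⟩ := Y.property
      exact ⟨a, b, CochainComplex.isStrictlyGE_of_iso e.symm a,
        CochainComplex.isStrictlyLE_of_iso e.symm b⟩
    exact ⟨op ⟨(HomotopyCategory.quotient _ _).obj ((dualComplex G).objPreimage Y.obj.as).unop,
      isBounded_of_dualComplex G _ h⟩, 
        ⟨(isBounded A).isoMk ((HomotopyCategory.quotient _ _).mapIso e)⟩⟩

/-- The duality exchanges the shift functors. -/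
noncomputable def dualKbShiftIso (X : Kb A) (a b : ℤ) (h : a + b = 0) :
    (dualKb G).obj (op (X⟦a⟧)) ≅ ((dualKb G).obj (op X))⟦b⟧ :=
  (isBounded A).isoMk
    ((dualHomotopyCategory G).mapIso
        (((HomotopyCategory.quotient _ _).commShiftIso a).app X.obj.as ≪≫
          ((isBounded A).ι.commShiftIso a).symm.app X).op ≪≫
      (HomotopyCategory.quotient _ _).mapIso (dualComplexShiftIso G X.obj.as a b h) ≪≫
      ((HomotopyCategory.quotient _ _).commShiftIso b).app _ ≪≫
      ((isBounded A).ι.commShiftIso b).symm.app ((dualKb G).obj (op X)))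

/-- The duality on complexes concentrated in degree zero. -/
noncomputable def dualKbStalkIso (X : FGProj A) :
    (dualKb G).obj (op (stalk X)) ≅ stalk (G.obj (op X)) :=
  (isBounded A).isoMk ((HomotopyCategory.quotient _ _).mapIso
    (isoSingleOfIsZero ((dualComplex G).obj (op ((CochainComplex.singleFunctor _ 0).obj X)))
      (fun n hn => G.map_isZero
        (HomologicalComplex.isZero_single_obj_X _ _ _ _ (show -n ≠ 0 by lia)).op) ≪≫
    (CochainComplex.singleFunctor _ 0).mapIso (G.mapIso
      (HomologicalComplex.singleObjXSelf (ComplexShape.up ℤ) 0 X).symm.op)))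

theorem exists_dualKb_distinguished [G.Full] [G.Faithful] {X Y Z : Kb A} {f : X ⟶ Y} {g : Y ⟶ Z}
    {w : Z ⟶ X⟦(1 : ℤ)⟧} (h : Triangle.mk f g w ∈ distTriang (Kb A)) :
    ∃ p q, Triangle.mk (Y := (dualKb G).obj (op Y)) (Z := (dualKb G).obj (op X))
      ((dualKb G).map g.op) p q ∈ distTriang (Kb A) := by
  obtain ⟨q, hq⟩ := exists_dual_distinguished G _ ((isBounded A).ι.map_distinguished _ h)
  obtain ⟨W, p', q', hW⟩ := distinguished_cocone_triangle ((dualKb G).map g.op)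
  have hW' := (isBounded A).ι.map_distinguished _ hW
  let e : W.obj ≅ ((dualKb G).obj (op X)).obj :=
    Triangle.π₃.mapIso (isoTriangleOfIso₁₂ _ _ hW' hq (Iso.refl _) (Iso.refl _)
      ((Category.comp_id _).trans (Category.id_comp _).symm))
  exact ⟨_, _, mk_distinguished_of_iso₃ hW ((isBounded A).isoMk e)⟩

end DualKb

/-! ### Additive properties under a contravariant equivalence -/

section Duality

open Opposite

variable {C : Type u} [Category.{v} C] [Preadditive C]

theorem forall_hom_eq_zero_of_iso {X X' Y Y' : C} (e : X ≅ X') (e' : Y ≅ Y')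
    (h : ∀ f : X ⟶ Y, f = 0) (f : X' ⟶ Y') : f = 0 := by
  have h1 := h (e.hom ≫ f ≫ e'.inv)
  rwa [Preadditive.IsIso.comp_left_eq_zero, Preadditive.IsIso.comp_right_eq_zero] at h1

theorem forall_mem_through_of_iso {X X' Y Y' M M' : C} (e : X ≅ X') (e' : Y ≅ Y') (e'' : M ≅ M')
    (h : ∀ f : X ⟶ Y, f ∈ through M X Y) (f : X' ⟶ Y') : f ∈ through M' X' Y' := by
  have h1 := precomp_mem_through e.inv (postcomp_mem_through (h (e.hom ≫ f ≫ e'.inv)) e'.hom)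
  have h2 : e.inv ≫ (e.hom ≫ f ≫ e'.inv) ≫ e'.hom = f := by simp
  rw [h2] at h1
  exact mem_through_of_iso e'' h1

section Contravariant

variable (F : Cᵒᵖ ⥤ C) [F.Additive]

theorem map_op_mem_through {M X Y : C} {f : X ⟶ Y} (hf : f ∈ through M X Y) :
    F.map f.op ∈ through (F.obj (op M)) (F.obj (op Y)) (F.obj (op X)) := by
  induction hf using AddSubgroup.closure_induction with
  | mem f hf =>
    obtain ⟨a, b, rfl⟩ := hf
    rw [op_comp, F.map_comp]
    exact comp_mem_through _ _
  | zero => rw [op_zero, F.map_zero]; exact zero_mem _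
  | add f f' _ _ h h' => rw [op_add, F.map_add]; exact add_mem h h'
  | neg f _ h => rw [op_neg, F.map_neg]; exact neg_mem h

variable [F.Full] [F.Faithful]

theorem forall_map_op_eq_zero_iff (X Y : C) :
    (∀ f : X ⟶ Y, f = 0) ↔ ∀ g : F.obj (op Y) ⟶ F.obj (op X), g = 0 := by
  constructor
  · intro h g
    obtain ⟨f, rfl⟩ := F.map_surjective g
    rw [← f.op_unop, h f.unop, op_zero, F.map_zero]
  · intro h f
    exact Quiver.Hom.op_inj (F.map_injective ((h _).trans (h _).symm))

theorem exists_mem_through_of_map_op {M X Y : C} {g : F.obj (op Y) ⟶ F.obj (op X)}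
    (hg : g ∈ through (F.obj (op M)) (F.obj (op Y)) (F.obj (op X))) :
    ∃ f : X ⟶ Y, f ∈ through M X Y ∧ F.map f.op = g := by
  induction hg using AddSubgroup.closure_induction with
  | mem g hg =>
    obtain ⟨a, b, rfl⟩ := hg
    obtain ⟨a, rfl⟩ := F.map_surjective a
    obtain ⟨b, rfl⟩ := F.map_surjective b
    exact ⟨b.unop ≫ a.unop, comp_mem_through _ _, by rw [op_comp, F.map_comp]; rfl⟩
  | zero => exact ⟨0, zero_mem _, by rw [op_zero, F.map_zero]⟩
  | add g g' _ _ h h' =>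
    obtain ⟨f, hf, rfl⟩ := h
    obtain ⟨f', hf', rfl⟩ := h'
    exact ⟨f + f', add_mem hf hf', by rw [op_add, F.map_add]⟩
  | neg g _ h =>
    obtain ⟨f, hf, rfl⟩ := h
    exact ⟨-f, neg_mem hf, by rw [op_neg, F.map_neg]⟩

theorem forall_map_op_mem_through_iff (M X Y : C) :
    (∀ f : X ⟶ Y, f ∈ through M X Y) ↔ ∀ g : F.obj (op Y) ⟶ F.obj (op X),
      g ∈ through (F.obj (op M)) (F.obj (op Y)) (F.obj (op X)) := by
  constructor
  · intro h g
    obtain ⟨f, rfl⟩ := F.map_surjective g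
    exact map_op_mem_through F (h f.unop)
  · intro h f
    obtain ⟨f', hf', h'⟩ := exists_mem_through_of_map_op F (h (F.map f.op))
    rwa [← Quiver.Hom.op_inj (F.map_injective h')]

theorem isZero_map_op_iff (X : C) : IsZero (F.obj (op X)) ↔ IsZero X := by
  constructor
  · intro h
    rw [IsZero.iff_id_eq_zero]
    exact Quiver.Hom.op_inj (F.map_injective (h.eq_of_src _ _))
  · intro h
    rw [IsZero.iff_id_eq_zero]
    rw [← F.map_id, ← op_id, h.eq_of_src (𝟙 X) 0, op_zero, F.map_zero]

variable [HasBinaryBiproducts C]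

/-- Contravariant additive functors commute with binary biproducts. -/
noncomputable def mapOpBiprod (X Y : C) :
    F.obj (op (X ⊞ Y)) ≅ F.obj (op X) ⊞ F.obj (op Y) where
  hom := biprod.lift (F.map biprod.inl.op) (F.map biprod.inr.op)
  inv := biprod.desc (F.map biprod.fst.op) (F.map biprod.snd.op)
  hom_inv_id := by
    rw [biprod.lift_desc, ← F.map_comp, ← F.map_comp, ← F.map_add, ← op_comp, ← op_comp, ← op_add,
      biprod.total, op_id, F.map_id]
  inv_hom_id := by ext <;> simp [← F.map_comp, ← op_comp]

theorem nonempty_iso_map_op_iff (X Y : C) :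
    Nonempty (F.obj (op X) ≅ F.obj (op Y)) ↔ Nonempty (X ≅ Y) :=
  ⟨fun ⟨e⟩ => ⟨(F.preimageIso e).unop.symm⟩, fun ⟨e⟩ => ⟨F.mapIso e.symm.op⟩⟩

theorem nonempty_retract_map_op_iff (X Y : C) :
    Nonempty (Retract (F.obj (op X)) (F.obj (op Y))) ↔ Nonempty (Retract X Y) := by
  constructor
  · rintro ⟨⟨i, r, h⟩⟩
    obtain ⟨i, rfl⟩ := F.map_surjective i
    obtain ⟨r, rfl⟩ := F.map_surjective r
    refine ⟨⟨r.unop, i.unop, Quiver.Hom.op_inj (F.map_injective ?_)⟩⟩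
    rw [op_comp, F.map_comp, op_id, F.map_id]
    exact h
  · rintro ⟨⟨i, r, h⟩⟩
    refine ⟨⟨F.map r.op, F.map i.op, ?_⟩⟩
    rw [← F.map_comp, ← op_comp, h, op_id, F.map_id]

variable [F.EssSurj]

theorem exists_iso_map_op (Y : C) : ∃ X : C, Nonempty (F.obj (op X) ≅ Y) :=
  ⟨(F.objPreimage Y).unop, ⟨F.objObjPreimageIso Y⟩⟩

theorem _root_.CategoryTheory.Indecomposable.of_iso {X Y : C} (e : X ≅ Y)
    (h : Indecomposable X) : Indecomposable Y :=
  ⟨fun hY => h.1 (hY.of_iso e), fun _ _ e' => h.2 _ _ (e ≪≫ e')⟩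

theorem indecomposable_map_op_iff (X : C) :
    Indecomposable (F.obj (op X)) ↔ Indecomposable X := by
  constructor
  · rintro ⟨h, h'⟩
    refine ⟨fun hX => h ((isZero_map_op_iff F X).2 hX), fun Y Z e => ?_⟩
    exact (h' _ _ (F.mapIso e.symm.op ≪≫ mapOpBiprod F Y Z)).imp
      (isZero_map_op_iff F Y).1 (isZero_map_op_iff F Z).1
  · rintro ⟨h, h'⟩
    refine ⟨fun hX => h ((isZero_map_op_iff F X).1 hX), fun Y Z e => ?_⟩
    obtain ⟨Y', ⟨eY⟩⟩ := exists_iso_map_op F Y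
    obtain ⟨Z', ⟨eZ⟩⟩ := exists_iso_map_op F Z
    obtain ⟨e'⟩ := (nonempty_iso_map_op_iff F X (Y' ⊞ Z')).1
      ⟨e ≪≫ (biprod.mapIso eY eZ).symm ≪≫ (mapOpBiprod F Y' Z').symm⟩
    exact (h' _ _ e').imp (fun h => ((isZero_map_op_iff F Y').2 h).of_iso eY.symm)
      (fun h => ((isZero_map_op_iff F Z').2 h).of_iso eZ.symm)

end Contravariant

end Duality

/-! ### Silting objects under a triangulated duality -/

section TriangulatedDuality

open Opposite

variable {C : Type u} [Category.{v} C] [Preadditive C] [HasZeroObject C] [HasShift C ℤ]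
  [∀ n : ℤ, (shiftFunctor C n).Additive] [Pretriangulated C]

/-- A contravariant functor is compatible with shifts and distinguished triangles. -/
structure IsTriangulatedDuality (D : Cᵒᵖ ⥤ C) : Prop where
  shift (X : C) (a b : ℤ) (h : a + b = 0) :
    Nonempty (D.obj (op (X⟦a⟧)) ≅ (D.obj (op X))⟦b⟧)
  triangle {X Y Z : C} {f : X ⟶ Y} {g : Y ⟶ Z} {w : Z ⟶ X⟦(1 : ℤ)⟧}
    (h : Triangle.mk f g w ∈ distTriang C) :
    ∃ p q, Triangle.mk (Y := D.obj (op Y)) (Z := D.obj (op X)) (D.map g.op) p q ∈ distTriang C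

/-- A duality followed by the shift. -/
abbrev shiftedDual (D : Cᵒᵖ ⥤ C) : Cᵒᵖ ⥤ C := D ⋙ shiftFunctor C (1 : ℤ)

theorem Geq.shift_iff {T U : C} (a : ℤ) : Geq (T⟦a⟧) (U⟦a⟧) ↔ Geq T U := by
  refine forall_congr' fun i => forall_congr' fun _ => ?_
  rw [← forall_hom_shift_eq_zero_iff T U a (a + i) i (by lia)]
  exact ⟨forall_hom_eq_zero_of_iso (Iso.refl _) ((shiftFunctorAdd' C a i _ rfl).symm.app U),
    forall_hom_eq_zero_of_iso (Iso.refl _) ((shiftFunctorAdd' C a i _ rfl).app U)⟩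

variable {D : Cᵒᵖ ⥤ C} [D.Additive] [D.Full] [D.Faithful] (hD : IsTriangulatedDuality D)

include hD

/-- Maps `T ⟶ U[i]` correspond to maps `D(U[i]) ⟶ D T`, that is, `(D U)[-i] ⟶ D T`, and shifting by
`i` gives `D U ⟶ (D T)[i]`. -/
theorem IsTriangulatedDuality.geq_iff {T U : C} :
    Geq (D.obj (op U)) (D.obj (op T)) ↔ Geq T U := by
  refine forall_congr' fun i => forall_congr' fun _ => ?_
  rw [forall_map_op_eq_zero_iff D T, ← forall_hom_shift_eq_zero_iff _ _ (-i) 0 i (by lia)]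
  obtain ⟨e⟩ := hD.shift U i (-i) (by lia)
  exact ⟨forall_hom_eq_zero_of_iso e.symm ((shiftFunctorZero C ℤ).app _),
    forall_hom_eq_zero_of_iso e ((shiftFunctorZero C ℤ).symm.app _)⟩

theorem IsTriangulatedDuality.shiftedDual_geq_iff {T U : C} :
    Geq ((shiftedDual D).obj (op U)) ((shiftedDual D).obj (op T)) ↔ Geq T U :=
  (Geq.shift_iff 1).trans hD.geq_iff

theorem IsTriangulatedDuality.shiftedDual_shift (X : C) :
    Nonempty ((shiftedDual D).obj (op (X⟦(1 : ℤ)⟧)) ≅ D.obj (op X)) := by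
  obtain ⟨e⟩ := hD.shift X 1 (-1) (by lia)
  exact ⟨(shiftFunctor C (1 : ℤ)).mapIso e ≪≫ (shiftFunctorCompIsoId C (-1 : ℤ) 1 (by lia)).app _⟩

variable [D.EssSurj]

theorem IsTriangulatedDuality.isBasic_iff [HasBinaryBiproducts C] (T : C) :
    IsBasic ((shiftedDual D).obj (op T)) ↔ IsBasic T := by
  constructor
  · intro h X hX
    rw [← not_nonempty_iff, ← nonempty_retract_map_op_iff (shiftedDual D)]
    rintro ⟨r⟩
    exact (h _ ((indecomposable_map_op_iff (shiftedDual D) X).2 hX)).false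
      ((Retract.ofIso (mapOpBiprod (shiftedDual D) X X).symm).trans r)
  · intro h X hX
    obtain ⟨X', ⟨e⟩⟩ := exists_iso_map_op (shiftedDual D) X
    refine ⟨fun r => ?_⟩
    refine (not_nonempty_iff.2 (h X' ((indecomposable_map_op_iff (shiftedDual D) X').1
      (hX.of_iso e.symm)))) ?_
    rw [← nonempty_retract_map_op_iff (shiftedDual D)]
    exact ⟨(Retract.ofIso (mapOpBiprod (shiftedDual D) X' X' ≪≫ biprod.mapIso e e)).trans r⟩

variable [IsTriangulated C]

/-- The objects whose dual lies in the thick closure of the shifted dual of `T` form a thick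
subcategory containing `T`, hence all objects; essential surjectivity then reaches every object. -/
theorem IsTriangulatedDuality.thick_eq_top {T : C}
    (h : (ObjectProperty.singleton T).triangEnvelope = ⊤) :
    (ObjectProperty.singleton ((shiftedDual D).obj (op T))).triangEnvelope = ⊤ := by
  set Q := (ObjectProperty.singleton ((shiftedDual D).obj (op T))).triangEnvelope
  let Q' : ObjectProperty C := fun X => Q (D.obj (op X))
  have : Q'.IsStableUnderRetracts := ⟨fun {X Y} r hY => by
    obtain ⟨r'⟩ := (nonempty_retract_map_op_iff D X Y).2 ⟨r⟩
    exact Q.prop_of_retract r' hY⟩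
  have : Q'.IsStableUnderShift ℤ := ⟨fun a => ⟨fun X hX => by
    obtain ⟨e⟩ := hD.shift X a (-a) (by lia)
    exact Q.prop_of_iso e.symm (Q.le_shift (-a) _ hX)⟩⟩
  have : Q'.IsTriangulatedClosed₃ := ⟨fun S hS h₁ h₂ => by
    obtain ⟨p, q, hpq⟩ := hD.triangle hS
    -- The dual of the third vertex is the first vertex of the dual triangle, so closure in the
    -- first position is used.
    exact ObjectProperty.le_isoClosure _ _ (Q.ext_of_isTriangulatedClosed₁ _ hpq h₂ h₁)⟩
  have : Q'.ContainsZero := ⟨0, isZero_zero C, by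
    obtain ⟨Z, hZ, hQ⟩ := ObjectProperty.ContainsZero.exists_zero (P := Q)
    exact Q.prop_of_iso (hZ.iso ((isZero_map_op_iff D 0).2 (isZero_zero C))) hQ⟩
  have : Q'.IsTriangulated := { toIsTriangulatedClosed₂ := .of_isTriangulatedClosed₃ }
  have h1 : ObjectProperty.singleton T ≤ Q' := by
    rintro _ ⟨⟩
    exact Q.prop_of_iso ((shiftFunctorCompIsoId C (1 : ℤ) (-1) (by lia)).app (D.obj (op T)))
      (Q.le_shift (-1) _ (ObjectProperty.le_triangEnvelope _ _ ⟨PUnit.unit⟩))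
  rw [← ObjectProperty.triangEnvelope_le_iff, h] at h1
  rw [eq_top_iff]
  intro Y _
  obtain ⟨X, ⟨e⟩⟩ := exists_iso_map_op D Y
  exact Q.prop_of_iso e (h1 X trivial)

theorem IsTriangulatedDuality.thick_eq_top_of_dual {T : C}
    (h : (ObjectProperty.singleton ((shiftedDual D).obj (op T))).triangEnvelope = ⊤) :
    (ObjectProperty.singleton T).triangEnvelope = ⊤ := by
  set Q := (ObjectProperty.singleton T).triangEnvelope
  -- Quantifying over all preimages of `Y` makes the property invariant under isomorphism; one
  -- preimage suffices to verify it, as preimages are unique up to isomorphism.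
  let Q' : ObjectProperty C := fun Y => ∀ X, Nonempty (D.obj (op X) ≅ Y) → Q X
  have hQ' {X Y : C} (e : D.obj (op X) ≅ Y) (hX : Q X) : Q' Y := fun X' ⟨e'⟩ => by
    obtain ⟨i⟩ := (nonempty_iso_map_op_iff D X X').1 ⟨e ≪≫ e'.symm⟩
    exact Q.prop_of_iso i hX
  have : Q'.IsStableUnderRetracts := ⟨fun {X Y} r hY => by
    obtain ⟨X', ⟨e⟩⟩ := exists_iso_map_op D X
    obtain ⟨Y', ⟨e'⟩⟩ := exists_iso_map_op D Y
    obtain ⟨r'⟩ := (nonempty_retract_map_op_iff D X' Y').1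
      ⟨((Retract.ofIso e).trans r).trans (Retract.ofIso e'.symm)⟩
    exact hQ' e (Q.prop_of_retract r' (hY Y' ⟨e'⟩))⟩
  have : Q'.IsStableUnderShift ℤ := ⟨fun a => ⟨fun X hX => by
    obtain ⟨X', ⟨e⟩⟩ := exists_iso_map_op D X
    obtain ⟨e'⟩ := hD.shift X' (-a) a (by lia)
    exact hQ' (e' ≪≫ (shiftFunctor C a).mapIso e) (Q.le_shift (-a) _ (hX X' ⟨e⟩))⟩⟩
  have : Q'.IsTriangulatedClosed₃ := ⟨fun S hS h₁ h₂ => by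
    obtain ⟨X, ⟨e⟩⟩ := exists_iso_map_op D S.obj₁
    obtain ⟨Y, ⟨e'⟩⟩ := exists_iso_map_op D S.obj₂
    -- The first map of `S` is the dual of a map `Y ⟶ X`. Completing the latter to a triangle
    -- starting at some `Z` makes the dual of `Z` isomorphic to the third vertex of `S`.
    obtain ⟨g, hg⟩ := D.map_surjective (e.hom ≫ S.mor₁ ≫ e'.inv)
    obtain ⟨Z, f, w, hT⟩ := distinguished_cocone_triangle₁ g.unop
    obtain ⟨p, q, hpq⟩ := hD.triangle hT
    have i := Triangle.π₃.mapIso (isoTriangleOfIso₁₂ _ _ hpq hS e e' (by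
      change D.map g ≫ e'.hom = e.hom ≫ S.mor₁
      rw [hg]
      simp))
    exact ObjectProperty.le_isoClosure _ _
      (hQ' i (Q.ext_of_isTriangulatedClosed₁ _ hT (h₂ Y ⟨e'⟩) (h₁ X ⟨e⟩)))⟩
  have : Q'.ContainsZero := ⟨0, isZero_zero C, by
    obtain ⟨Z, hZ, hQ⟩ := ObjectProperty.ContainsZero.exists_zero (P := Q)
    exact hQ' (((isZero_map_op_iff D Z).2 hZ).iso (isZero_zero C)) hQ⟩
  have : Q'.IsTriangulated := { toIsTriangulatedClosed₂ := .of_isTriangulatedClosed₃ }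
  have h1 : ObjectProperty.singleton ((shiftedDual D).obj (op T)) ≤ Q' := by
    rintro _ ⟨⟩
    obtain ⟨e⟩ := hD.shift T (-1) 1 (by lia)
    exact hQ' e (Q.le_shift (-1) _ (ObjectProperty.le_triangEnvelope _ _ ⟨PUnit.unit⟩))
  rw [← ObjectProperty.triangEnvelope_le_iff, h] at h1
  rw [eq_top_iff]
  intro X _
  exact h1 (D.obj (op X)) trivial X ⟨Iso.refl _⟩

theorem IsTriangulatedDuality.isSilting_iff (T : C) :
    IsSilting ((shiftedDual D).obj (op T)) ↔ IsSilting T :=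
  ⟨fun h => ⟨hD.shiftedDual_geq_iff.1 h.1, hD.thick_eq_top_of_dual h.2⟩,
    fun h => ⟨hD.shiftedDual_geq_iff.2 h.1, hD.thick_eq_top h.2⟩⟩

end TriangulatedDuality

/-! ### Bijections on isomorphism classes -/

section Classes

open Opposite

variable {C : Type u} [Category.{v} C] [Preadditive C] [HasShift C ℤ]

/-- A contravariant equivalence which reverses `≥` induces order-reversing bijections between sets
of isomorphism classes. -/
theorem exists_equiv_isoClass (E : Cᵒᵖ ⥤ C) [E.Full] [E.Faithful] [E.EssSurj]
    (hE : ∀ T U : C, Geq (E.obj (op U)) (E.obj (op T)) ↔ Geq T U) (p q : C → Prop)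
    (hq : ∀ T U : C, (T ≅ U) → q T → q U) (hpq : ∀ T, q (E.obj (op T)) ↔ p T) :
    ∃ φ : {x : IsoClass C | ∃ T, isoClass T = x ∧ p T} ≃
        {x : IsoClass C | ∃ T, isoClass T = x ∧ q T},
      ∀ S T : {x : IsoClass C | ∃ T, isoClass T = x ∧ p T},
        GeqClass (S : IsoClass C) T ↔ GeqClass (φ T : IsoClass C) (φ S) := by
  let ψ : IsoClass C → IsoClass C := Quotient.map (fun T => E.obj (op T))
    fun _ _ ⟨e⟩ => ⟨E.mapIso e.symm.op⟩
  have hψ : ∀ x ∈ {x : IsoClass C | ∃ T, isoClass T = x ∧ p T},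
      ψ x ∈ {x : IsoClass C | ∃ T, isoClass T = x ∧ q T} := by
    rintro _ ⟨T, rfl, hT⟩
    exact ⟨_, rfl, (hpq T).2 hT⟩
  refine ⟨Equiv.ofBijective (fun x => ⟨ψ x, hψ x x.2⟩) ⟨?_, ?_⟩, ?_⟩
  · rintro ⟨_, S, rfl, hS⟩ ⟨_, T, rfl, hT⟩ h
    obtain ⟨e⟩ : Nonempty (E.obj (op S) ≅ E.obj (op T)) := Quotient.exact (Subtype.ext_iff.1 h)
    exact Subtype.ext (Quotient.sound ⟨(E.preimageIso e).unop.symm⟩)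
  · rintro ⟨_, T, rfl, hT⟩
    let e := E.objObjPreimageIso T
    exact ⟨⟨isoClass (E.objPreimage T).unop, _, rfl, (hpq _).1 (hq _ _ e.symm hT)⟩,
      Subtype.ext (Quotient.sound ⟨e⟩)⟩
  · rintro ⟨_, S, rfl, hS⟩ ⟨_, T, rfl, hT⟩
    exact (hE S T).symm

end Classes

/-! ### The duality exchanges `𝒯⁻` and `𝒯⁺` -/

section TwoSilting

open Opposite

variable {A : Type u} [Ring A]

theorem IsSilting.of_iso {T U : Kb A} (e : T ≅ U) (h : IsSilting T) : IsSilting U := by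
  refine ⟨h.geq_self.of_iso e e, ?_⟩
  have h1 : ObjectProperty.singleton T ≤ (ObjectProperty.singleton U).triangEnvelope := by
    rintro _ ⟨⟩
    exact ObjectProperty.prop_of_iso _ e.symm (ObjectProperty.le_triangEnvelope _ _ ⟨PUnit.unit⟩)
  rw [← ObjectProperty.triangEnvelope_le_iff, h.thick_eq_top] at h1
  exact eq_top_iff.2 h1

theorem IsTwoSilting.of_iso {T U : Kb A} (e : T ≅ U) (h : IsTwoSilting T) : IsTwoSilting U where
  isSilting := h.isSilting.of_iso e
  isBasic X hX := ⟨fun r => (h.isBasic X hX).false (r.trans (Retract.ofIso e.symm))⟩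
  geq := h.geq.of_iso (Iso.refl _) e
  geq' := h.geq'.of_iso e (Iso.refl _)

variable (τ : Aᵐᵒᵖ ≃+* A)

/-- The duality of `Kᵇ(proj A)` induced by an anti-automorphism of `A`. -/
noncomputable abbrev ringDual : (Kb A)ᵒᵖ ⥤ Kb A := dualKb (dualFunctor τ)

theorem isTriangulatedDuality_ringDual : IsTriangulatedDuality (ringDual τ) where
  shift X a b h := ⟨dualKbShiftIso _ X a b h⟩
  triangle h := exists_dualKb_distinguished _ h

/-- A module isomorphic to its dual is swapped with its shift: one shift is added by construction,
and the duality inverts a shift already present. -/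
theorem nonempty_shiftedDual_stalk {P : FGProj A} (e : (dualFunctor τ).obj (op P) ≅ P) :
    Nonempty ((shiftedDual (ringDual τ)).obj (op (stalk P)) ≅ (stalk P)⟦(1 : ℤ)⟧) ∧
      Nonempty ((shiftedDual (ringDual τ)).obj (op ((stalk P)⟦(1 : ℤ)⟧)) ≅ stalk P) := by
  have i : (ringDual τ).obj (op (stalk P)) ≅ stalk P :=
    dualKbStalkIso _ P ≪≫ (stalkFunctor A).mapIso e
  obtain ⟨j⟩ := (isTriangulatedDuality_ringDual τ).shiftedDual_shift (stalk P)
  exact ⟨⟨(shiftFunctor (Kb A) (1 : ℤ)).mapIso i⟩, ⟨j ≪≫ i⟩⟩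

/-- The shifted duality swaps `A` with `A[1]` and reverses `≥`, so it interchanges the two bounds on
`T`. -/
theorem isTwoSilting_shiftedDual_iff (T : Kb A) :
    IsTwoSilting ((shiftedDual (ringDual τ)).obj (op T)) ↔ IsTwoSilting T := by
  have hD := isTriangulatedDuality_ringDual τ
  obtain ⟨⟨i⟩, ⟨j⟩⟩ := nonempty_shiftedDual_stalk τ (dualRegularIso τ)
  have h1 : Geq (stalk (regular A)) ((shiftedDual (ringDual τ)).obj (op T)) ↔
      Geq T ((stalk (regular A))⟦(1 : ℤ)⟧) := by
    rw [← hD.shiftedDual_geq_iff (T := T)]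
    exact ⟨fun h => h.of_iso j.symm (Iso.refl _), fun h => h.of_iso j (Iso.refl _)⟩
  have h2 : Geq ((shiftedDual (ringDual τ)).obj (op T)) ((stalk (regular A))⟦(1 : ℤ)⟧) ↔
      Geq (stalk (regular A)) T := by
    rw [← hD.shiftedDual_geq_iff (T := stalk (regular A))]
    exact ⟨fun h => h.of_iso (Iso.refl _) i.symm, fun h => h.of_iso (Iso.refl _) i⟩
  exact ⟨fun ⟨a, b, c, d⟩ => ⟨(hD.isSilting_iff T).1 a, (hD.isBasic_iff T).1 b, h2.1 d, h1.1 c⟩,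
    fun ⟨a, b, c, d⟩ => ⟨(hD.isSilting_iff T).2 a, (hD.isBasic_iff T).2 b, h1.2 d, h2.2 c⟩⟩

theorem factorsRight_shiftedDual_iff {P M : FGProj A} (eP : (dualFunctor τ).obj (op P) ≅ P)
    (eM : (dualFunctor τ).obj (op M) ≅ M) (T : Kb A) :
    FactorsRight P M ((shiftedDual (ringDual τ)).obj (op T)) ↔ FactorsLeft P M T := by
  obtain ⟨⟨i⟩, -⟩ := nonempty_shiftedDual_stalk τ eP
  obtain ⟨⟨j⟩, -⟩ := nonempty_shiftedDual_stalk τ eM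
  exact Iff.trans ⟨forall_mem_through_of_iso (Iso.refl _) i.symm j.symm,
    forall_mem_through_of_iso (Iso.refl _) i j⟩
    (forall_map_op_mem_through_iff (shiftedDual (ringDual τ)) (stalk M) (stalk P) T).symm

/-- The regular module is the sum of the modules given by complementary idempotents. -/
noncomputable def regularIso (e : A) (he : IsIdempotentElem e) :
    regular A ≅ idemModule e he ⊞ idemModule (1 - e) he.one_sub where
  hom := biprod.lift (idemProj e he) (idemProj (1 - e) he.one_sub)
  inv := biprod.desc (idemIncl e he) (idemIncl (1 - e) he.one_sub)
  hom_inv_id := by rw [biprod.lift_desc, idemProj_idemIncl_add]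
  inv_hom_id := by
    apply biprod.hom_ext' <;> apply biprod.hom_ext
    · simp [idemIncl_idemProj]
    · simp [idemIncl_idemProj_one_sub]
    · simp [idemIncl_one_sub_idemProj]
    · simp [idemIncl_idemProj]

theorem exists_equiv_TMinus_TPlus {K : Type*} [Field K] [Algebra K A] [Module.Finite K A]
    (e : A) (he : IsIdempotentElem e) (hτ : τ (MulOpposite.op e) = e) (ε : A →+* K)
    (hε : ε e = 1) (hsurj : Function.Surjective ε) (m : ℕ)
    (hnil : ∀ l : List A, l.length = m → (∀ a ∈ l, e * a * e = a ∧ ε a = 0) → l.prod = 0) :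
    (∃ φ : TMinus (idemModule e he) ≃ TPlus (idemModule e he),
      ∀ S T : TMinus (idemModule e he),
        GeqClass (S : IsoClass (Kb A)) T ↔ GeqClass (φ T : IsoClass (Kb A)) (φ S)) ∧
    Cardinal.mk (twoSilt A) = 2 * Cardinal.mk (TMinus (idemModule e he)) := by
  have hF := isLocalTop_topFunctor ε he hε hsurj m hnil
  have eA := regularIso e he
  have hL := TMinus_eq hF eA (exists_isLeftApprox K (idemIncl e he) (idemProj e he)
    (idemIncl_idemProj e he) (idemIncl _ he.one_sub) (idemProj _ he.one_sub)
    (idemIncl_idemProj _ he.one_sub))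
  have hR := TPlus_eq hF eA (exists_isRightApprox K (idemIncl _ he.one_sub)
    (idemProj _ he.one_sub) (idemIncl_idemProj _ he.one_sub) (idemIncl e he) (idemProj e he)
    (idemIncl_idemProj e he))
  have eP := dualIdemModuleIso τ e he hτ
  have eM := dualIdemModuleIso τ (1 - e) he.one_sub (by
    rw [MulOpposite.op_sub, map_sub, MulOpposite.op_one, map_one, hτ])
  have key := exists_equiv_isoClass (shiftedDual (ringDual τ))
    (fun T U => (isTriangulatedDuality_ringDual τ).shiftedDual_geq_iff)
    (fun T => IsTwoSilting T ∧ FactorsLeft (idemModule e he) (idemModule (1 - e) he.one_sub) T)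
    (fun T => IsTwoSilting T ∧ FactorsRight (idemModule e he) (idemModule (1 - e) he.one_sub) T)
    (fun T U i h => ⟨h.1.of_iso i, h.2.of_iso i⟩)
    (fun T => and_congr (isTwoSilting_shiftedDual_iff τ T) (factorsRight_shiftedDual_iff τ eP eM T))
  -- By the two descriptions, the complementary sets of factorization conditions become `𝒯⁻` and
  -- `𝒯⁺`, as do the ends of the bijection.
  have hc := isCompl_factors hF
  rw [← hL, ← hR] at hc key
  obtain ⟨φ, hφ⟩ := key
  refine ⟨⟨φ, hφ⟩, ?_⟩
  rw [← hc.1, Cardinal.mk_union_of_disjoint hc.2, ← Cardinal.mk_congr φ, two_mul]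

end TwoSilting

/-! ### The anti-automorphism given by path reversal -/

section PathReversal

variable (K : Type w) [Field K] {V : Type u} [Quiver.{v} V]

/-- The path in a quiver whose reversal is a given path in the opposite quiver. -/
def unopPath {a : Vᵒᵖ} : ∀ {b : Vᵒᵖ}, Quiver.Path a b → Quiver.Path b.unop a.unop
  | _, .nil => .nil
  | _, .cons p e => (Quiver.Hom.toPath e.unop).comp (unopPath p)

theorem opPath_comp {a b c : V} (p : Quiver.Path a b) (q : Quiver.Path b c) :
    opPath (p.comp q) = (opPath q).comp (opPath p) := by
  induction q with
  | nil => exact (Quiver.Path.nil_comp _).symm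
  | cons q e ih =>
    rw [Quiver.Path.comp_cons, opPath, ih, opPath, Quiver.Path.comp_assoc]

theorem unopPath_comp {a b c : Vᵒᵖ} (p : Quiver.Path a b) (q : Quiver.Path b c) :
    unopPath (p.comp q) = (unopPath q).comp (unopPath p) := by
  induction q with
  | nil => exact (Quiver.Path.nil_comp _).symm
  | cons q e ih =>
    rw [Quiver.Path.comp_cons, unopPath, ih, unopPath, Quiver.Path.comp_assoc]

theorem unopPath_opPath {a b : V} (p : Quiver.Path a b) : unopPath (opPath p) = p := by
  induction p with
  | nil => rfl
  | cons p e ih =>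
    rw [opPath, unopPath_comp, ih]
    rfl

theorem opPath_unopPath {a b : Vᵒᵖ} (p : Quiver.Path a b) : opPath (unopPath p) = p := by
  induction p with
  | nil => rfl
  | cons p e ih =>
    rw [unopPath, opPath_comp, ih]
    rfl

theorem reversePaths_ofPath {a b : V} (p : Quiver.Path a b) :
    reversePaths (ofPath K p) = ofPath K (opPath p) :=
  Finsupp.mapDomain_single

theorem mapPathAlgebra_ofPath {W : Type u} [Quiver.{v} W] (F : V ⥤q W) {a b : V}
    (p : Quiver.Path a b) : mapPathAlgebra F (ofPath K p) = ofPath K (F.mapPath p) :=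
  Finsupp.mapDomain_single

theorem reversePaths_injective : Function.Injective (reversePaths (K := K) (V := V)) := by
  refine Finsupp.mapDomain_injective (Function.LeftInverse.injective
    (g := fun p : QPath Vᵒᵖ => (⟨p.2.1.unop, p.1.unop, unopPath p.2.2⟩ : QPath V)) ?_)
  rintro ⟨a, b, p⟩
  dsimp only
  rw [unopPath_opPath]

/-- The image of a path under a morphism of quivers. -/
def mapQPath {W : Type u} [Quiver.{v} W] (F : V ⥤q W) (p : QPath V) : QPath W :=
  ⟨F.obj p.1, F.obj p.2.1, F.mapPath p.2.2⟩

theorem mapQPath_mapQPath {W : Type u} [Quiver.{v} W] {F : V ⥤q W} {G : W ⥤q V}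
    (h : F ⋙q G = 𝟭q V) (p : QPath V) : mapQPath G (mapQPath F p) = p := by
  have h1 : mapQPath G (mapQPath F p) = mapQPath (F ⋙q G) p := by
    obtain ⟨a, b, p⟩ := p
    simp only [mapQPath, Prefunctor.mapPath_comp_apply]
    rfl
  rw [h1, h]
  obtain ⟨a, b, p⟩ := p
  simp only [mapQPath, Prefunctor.mapPath_id]
  rfl

variable {K}

/-- The linear endomorphism of the path algebra given by path reversal and an isomorphism from the
opposite quiver. -/
noncomputable def antiMap (ι : Vᵒᵖ ⥤q V) : PathAlgebra K V →ₗ[K] PathAlgebra K V :=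
  mapPathAlgebra ι ∘ₗ reversePaths

theorem antiMap_ofPath (ι : Vᵒᵖ ⥤q V) {a b : V} (p : Quiver.Path a b) :
    antiMap ι (ofPath K p) = ofPath K (ι.mapPath (opPath p)) := by
  rw [antiMap, LinearMap.comp_apply, reversePaths_ofPath, mapPathAlgebra_ofPath]

theorem antiMap_mul {ι : Vᵒᵖ ⥤q V} (hι : IsQuiverIso ι) (x y : PathAlgebra K V) :
    antiMap ι (x * y) = antiMap ι y * antiMap ι x := by
  induction x using pathAlgebra_induction with
  | h0 => rw [pa_zero_mul, map_zero, pa_mul_zero]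
  | hadd x x' hx hx' => rw [pa_add_mul, map_add, map_add, pa_mul_add, hx, hx']
  | hpath r p =>
  induction y using pathAlgebra_induction with
  | h0 => rw [pa_mul_zero, map_zero, pa_zero_mul]
  | hadd y y' hy hy' => rw [pa_mul_add, map_add, map_add, pa_add_mul, hy, hy']
  | hpath s q =>
  rename_i a b c d
  rw [pa_smul_mul, pa_mul_smul, map_smul, map_smul, map_smul, map_smul, pa_mul_smul, pa_smul_mul,
    antiMap_ofPath, antiMap_ofPath]
  congr 2
  by_cases h : c = b
  · subst h
    rw [ofPath_mul_ofPath, ofPath_mul_ofPath, antiMap_ofPath, opPath_comp, Prefunctor.mapPath_comp]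
  · rw [ofPath_mul_ofPath_of_ne _ _ h, ofPath_mul_ofPath_of_ne, map_zero]
    intro h'
    -- Injectivity of `ι` on vertices keeps non-composable paths non-composable.
    obtain ⟨G, hG, -⟩ := hι
    have hobj (z : Vᵒᵖ) : G.obj (ι.obj z) = z := congr(($hG).obj z)
    have h1 := congrArg G.obj h'
    rw [hobj, hobj] at h1
    exact h (Opposite.op_injective h1).symm

theorem antiMap_surjective {ι : Vᵒᵖ ⥤q V} (hι : IsQuiverIso ι) :
    Function.Surjective (antiMap (K := K) ι) := by
  obtain ⟨G, -, hG⟩ := hι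
  intro y
  induction y using pathAlgebra_induction with
  | h0 => exact ⟨0, map_zero _⟩
  | hadd x y hx hy =>
    obtain ⟨x, rfl⟩ := hx
    obtain ⟨y, rfl⟩ := hy
    exact ⟨x + y, map_add _ _ _⟩
  | hpath c p =>
    rename_i a b
    refine ⟨c • ofPath K (unopPath (G.mapPath p)), ?_⟩
    rw [map_smul, antiMap_ofPath, opPath_unopPath]
    congr 1
    exact congrArg (fun q : QPath V => (Finsupp.single q 1 : QPath V →₀ K))
      (mapQPath_mapQPath hG ⟨a, b, p⟩)

variable [Fintype V]

/-- A surjective anti-multiplicative map preserves the unit: multiply its value at `1` by the image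
of a preimage of `1`. -/
theorem antiMap_one {ι : Vᵒᵖ ⥤q V} (hι : IsQuiverIso ι) :
    antiMap ι (1 : PathAlgebra K V) = 1 := by
  obtain ⟨y, hy⟩ := antiMap_surjective (K := K) hι 1
  calc antiMap ι (1 : PathAlgebra K V) = antiMap ι 1 * antiMap ι y := by rw [hy, mul_one]
    _ = 1 := by rw [← antiMap_mul hι, mul_one, hy]

/-- The compatibility of `ι` with the ideal turns the claim into one about reversal alone, where
injectivity suffices. -/
theorem antiMap_mem_iff {ι : Vᵒᵖ ⥤q V} (I : Ideal (PathAlgebra K V))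
    (hI : opIdeal I = (I.restrictScalars K).comap (mapPathAlgebra ι)) (y : PathAlgebra K V) :
    antiMap ι y ∈ I ↔ y ∈ I := by
  have h : antiMap ι y ∈ I ↔ reversePaths y ∈ opIdeal I := by
    rw [hI]
    rfl
  rw [h, opIdeal, Submodule.mem_map]
  constructor
  · rintro ⟨z, hz, hzy⟩
    exact reversePaths_injective K hzy ▸ hz
  · intro hy
    exact ⟨y, hy, rfl⟩

/-- An isomorphism of a bound quiver with its opposite induces an anti-automorphism of its
algebra. -/
theorem exists_antiAutomorphism (I : Ideal (PathAlgebra K V)) [I.IsTwoSided] {ι : Vᵒᵖ ⥤q V}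
    (hι : IsQuiverIso ι) (hI : opIdeal I = (I.restrictScalars K).comap (mapPathAlgebra ι)) :
    ∃ τ : (PathAlgebra K V ⧸ I)ᵐᵒᵖ ≃+* PathAlgebra K V ⧸ I, ∀ y,
      τ (MulOpposite.op (Ideal.Quotient.mk I (antiMap ι y))) = Ideal.Quotient.mk I y := by
  let f : PathAlgebra K V →+* (PathAlgebra K V ⧸ I)ᵐᵒᵖ :=
    { toFun := fun y => MulOpposite.op (Ideal.Quotient.mk I (antiMap ι y))
      map_zero' := by rw [map_zero, map_zero, MulOpposite.op_zero]
      map_one' := by rw [antiMap_one hι, map_one, MulOpposite.op_one]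
      map_add' := fun x y => by rw [map_add, map_add, MulOpposite.op_add]
      map_mul' := fun x y => by rw [antiMap_mul hι, map_mul, MulOpposite.op_mul] }
  have hf (y : PathAlgebra K V) : f y = 0 ↔ y ∈ I := by
    rw [← antiMap_mem_iff I hI y, ← Ideal.Quotient.eq_zero_iff_mem]
    exact MulOpposite.op_eq_zero_iff _
  let g := Ideal.Quotient.lift I f fun y hy => (hf y).2 hy
  have hg : Function.Bijective g := by
    constructor
    · rw [injective_iff_map_eq_zero]
      intro y hy
      obtain ⟨y, rfl⟩ := Ideal.Quotient.mk_surjective y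
      exact Ideal.Quotient.eq_zero_iff_mem.2 ((hf y).1 hy)
    · intro z
      obtain ⟨z, rfl⟩ := MulOpposite.op_surjective z
      obtain ⟨z, rfl⟩ := Ideal.Quotient.mk_surjective z
      obtain ⟨y, rfl⟩ := antiMap_surjective hι z
      exact ⟨Ideal.Quotient.mk I y, rfl⟩
  -- The map built above runs from the algebra to its opposite, so `τ` is its inverse.
  exact ⟨(RingEquiv.ofBijective g hg).symm, fun y =>
    (RingEquiv.ofBijective g hg).symm_apply_apply (Ideal.Quotient.mk I y)⟩

end PathReversal

/-! ### Finiteness, augmentation and nilpotency for bound quiver algebras -/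

section BoundQuiver

variable (K : Type w) [Field K] {V : Type u} [Quiver.{v} V]

/-- The coefficient of an element of the path algebra at the trivial path at `x`. -/
noncomputable def trivialCoeff (x : V) : PathAlgebra K V →ₗ[K] K :=
  Finsupp.lapply (⟨x, x, Quiver.Path.nil⟩ : QPath V)

theorem trivialCoeff_ofPath_of_ne {a b : V} (p : Quiver.Path a b) (x : V) (h : p.length ≠ 0) :
    trivialCoeff K x (ofPath K p) = 0 := by
  refine Finsupp.single_eq_of_ne fun h' => h ?_
  exact (congrArg (fun q : QPath V => q.2.2.length) h').symm

theorem trivialCoeff_vertexIdem_self (x : V) : trivialCoeff K x (vertexIdem K x) = 1 :=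
  Finsupp.single_eq_same

theorem trivialCoeff_vertexIdem_of_ne {a x : V} (h : a ≠ x) :
    trivialCoeff K x (vertexIdem K a) = 0 :=
  Finsupp.single_eq_of_ne fun h' => h (congrArg (fun q : QPath V => q.1) h').symm

/-- A concatenation of paths is trivial only if both factors are trivial at the same vertex. -/
theorem trivialCoeff_mul (x : V) (y z : PathAlgebra K V) :
    trivialCoeff K x (y * z) = trivialCoeff K x y * trivialCoeff K x z := by
  induction y using pathAlgebra_induction with
  | h0 => rw [pa_zero_mul, map_zero, zero_mul]
  | hadd y y' hy hy' => rw [pa_add_mul, map_add, map_add, add_mul, hy, hy']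
  | hpath r p =>
  induction z using pathAlgebra_induction with
  | h0 => rw [pa_mul_zero, map_zero, mul_zero]
  | hadd y y' hy hy' => rw [pa_mul_add, map_add, map_add, mul_add, hy, hy']
  | hpath s q =>
  rename_i a b c d
  have h : trivialCoeff K x (ofPath K p * ofPath K q) =
      trivialCoeff K x (ofPath K p) * trivialCoeff K x (ofPath K q) := by
    by_cases hcb : c = b
    · subst hcb
      rw [ofPath_mul_ofPath]
      by_cases hp : p.length = 0
      · obtain rfl := Quiver.Path.eq_of_length_zero p hp
        obtain rfl := Quiver.Path.eq_nil_of_length_zero p hp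
        rw [Quiver.Path.nil_comp]
        by_cases hq : q.length = 0
        · obtain rfl := Quiver.Path.eq_of_length_zero q hq
          obtain rfl := Quiver.Path.eq_nil_of_length_zero q hq
          by_cases hax : a = x
          · subst hax
            exact (trivialCoeff_vertexIdem_self K a).trans (((congrArg₂ (· * ·)
              (trivialCoeff_vertexIdem_self K a) (trivialCoeff_vertexIdem_self K a)).trans
              (one_mul 1)).symm)
          · have h0 := trivialCoeff_vertexIdem_of_ne K hax
            exact h0.trans (((congrArg₂ (· * ·) h0 h0).trans (zero_mul 0)).symm)
        · rw [trivialCoeff_ofPath_of_ne K q x hq, mul_zero]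
      · rw [trivialCoeff_ofPath_of_ne K p x hp, zero_mul,
          trivialCoeff_ofPath_of_ne K _ x (by rw [Quiver.Path.length_comp]; lia)]
    · rw [ofPath_mul_ofPath_of_ne _ _ hcb, map_zero]
      by_cases hp : p.length = 0
      · by_cases hq : q.length = 0
        · obtain rfl := Quiver.Path.eq_of_length_zero q hq
          obtain rfl := Quiver.Path.eq_nil_of_length_zero q hq
          obtain rfl := Quiver.Path.eq_of_length_zero p hp
          obtain rfl := Quiver.Path.eq_nil_of_length_zero p hp
          by_cases hax : a = x
          · have h0 := trivialCoeff_vertexIdem_of_ne K (fun h => hcb (h.trans hax.symm) : c ≠ x)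
            exact ((congrArg (_ * ·) h0).trans (mul_zero _)).symm
          · have h0 := trivialCoeff_vertexIdem_of_ne K hax
            exact ((congrArg (· * _) h0).trans (zero_mul _)).symm
        · rw [trivialCoeff_ofPath_of_ne K q x hq, mul_zero]
      · rw [trivialCoeff_ofPath_of_ne K p x hp, zero_mul]
  rw [pa_smul_mul, pa_mul_smul, map_smul, map_smul, map_smul, map_smul, h, smul_mul_smul_comm,
    smul_smul]

theorem trivialCoeff_eq_zero (x : V) {y : PathAlgebra K V} (hy : y ∈ arrowIdeal K V) :
    trivialCoeff K x y = 0 := by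
  induction hy using Submodule.span_induction with
  | mem y hy =>
    obtain ⟨a, b, p, hp, rfl⟩ := hy
    exact trivialCoeff_ofPath_of_ne K p x hp.ne'
  | zero => exact map_zero _
  | add y z _ _ hy hz => rw [map_add, hy, hz, add_zero]
  | smul c y _ hy => rw [map_smul, hy, smul_zero]

theorem ofPath_mem_arrowIdeal {a b : V} (p : Quiver.Path a b) (h : 0 < p.length) :
    ofPath K p ∈ arrowIdeal K V :=
  Submodule.subset_span ⟨a, b, p, h, rfl⟩

/-- Multiplying by the idempotent on both sides keeps only paths from `x` to `x`; apart from the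
trivial one these have positive length. -/
theorem vertexIdem_mul_mul_sub_mem (x : V) (y : PathAlgebra K V) :
    vertexIdem K x * y * vertexIdem K x - trivialCoeff K x y • vertexIdem K x ∈
      arrowIdeal K V := by
  induction y using pathAlgebra_induction with
  | h0 => rw [pa_mul_zero, pa_zero_mul, map_zero, zero_smul, sub_zero]; exact zero_mem _
  | hadd y y' hy hy' =>
    rw [pa_mul_add, pa_add_mul, map_add, add_smul, add_sub_add_comm]
    exact add_mem hy hy'
  | hpath r p =>
  rename_i a b
  rw [pa_mul_smul, pa_smul_mul, map_smul, smul_assoc, ← smul_sub]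
  refine Submodule.smul_mem _ _ ?_
  by_cases hp : p.length = 0
  · obtain rfl := Quiver.Path.eq_of_length_zero p hp
    obtain rfl := Quiver.Path.eq_nil_of_length_zero p hp
    have h1 : ofPath K (Quiver.Path.nil : Quiver.Path a a) = vertexIdem K a := rfl
    rw [h1]
    by_cases hax : a = x
    · subst hax
      rw [trivialCoeff_vertexIdem_self, one_smul]
      have h2 : vertexIdem K a * vertexIdem K a = vertexIdem K a := ofPath_mul_ofPath _ _
      rw [h2, h2, sub_self]
      exact zero_mem _
    · rw [trivialCoeff_vertexIdem_of_ne K hax, zero_smul, sub_zero]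
      have h2 : vertexIdem K x * vertexIdem K a = 0 := ofPath_mul_ofPath_of_ne _ _ hax
      rw [h2, pa_zero_mul]
      exact zero_mem _
  · rw [trivialCoeff_ofPath_of_ne K p x hp, zero_smul, sub_zero]
    by_cases hax : a = x
    · subst hax
      have h2 : vertexIdem K a * ofPath K p = ofPath K p :=
        (ofPath_mul_ofPath _ _).trans (congrArg _ (Quiver.Path.nil_comp p))
      rw [h2]
      by_cases hab : a = b
      · subst hab
        have h3 : ofPath K p * vertexIdem K a = ofPath K p := ofPath_mul_ofPath _ _
        rw [h3]
        exact ofPath_mem_arrowIdeal K p (by lia)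
      · have h3 : ofPath K p * vertexIdem K a = 0 := ofPath_mul_ofPath_of_ne _ _ hab
        rw [h3]
        exact zero_mem _
    · have h2 : vertexIdem K x * ofPath K p = 0 := ofPath_mul_ofPath_of_ne _ _ hax
      rw [h2, pa_zero_mul]
      exact zero_mem _

variable [Fintype V]

theorem ofPath_mem_arrowIdeal_pow (n : ℕ) {a b : V} (p : Quiver.Path a b)
    (h : n + 1 ≤ p.length) : ofPath K p ∈ arrowIdeal K V ^ (n + 1) := by
  induction n generalizing b with
  | zero =>
    rw [zero_add, pow_one]
    exact ofPath_mem_arrowIdeal K p h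
  | succ n ih =>
    cases p with
    | nil => exact absurd h (by rw [Quiver.Path.length_nil]; lia)
    | cons p e =>
      rw [Quiver.Path.length_cons] at h
      have h1 : ofPath K (p.cons e) = ofPath K p * ofPath K e.toPath :=
        (ofPath_mul_ofPath p e.toPath).symm
      rw [pow_succ, h1]
      exact Submodule.mul_mem_mul (ih p (by lia)) (ofPath_mem_arrowIdeal K _ one_pos)

/-- There are finitely many paths of bounded length in a finite quiver. -/
theorem finite_setOf_length_le [∀ a b : V, Finite (a ⟶ b)] (n : ℕ) :
    {p : QPath V | p.2.2.length ≤ n}.Finite := by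
  classical
  induction n with
  | zero =>
    refine (Set.finite_range fun a : V => (⟨a, a, Quiver.Path.nil⟩ : QPath V)).subset ?_
    rintro ⟨a, b, p⟩ hp
    have hp : p.length = 0 := Nat.le_zero.1 hp
    obtain rfl := Quiver.Path.eq_of_length_zero p hp
    obtain rfl := Quiver.Path.eq_nil_of_length_zero p hp
    exact ⟨a, rfl⟩
  | succ n ih =>
    -- Appends an arrow to a path; the default value for non-composable pairs plays no role.
    let f : QPath V × (Σ a : V, Σ b : V, (a ⟶ b)) → QPath V := fun q =>
      if h : q.1.2.1 = q.2.1 then ⟨q.1.1, q.2.2.1, (q.1.2.2.cast rfl h).cons q.2.2.2⟩ else q.1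
    refine (ih.union ((ih.prod Set.finite_univ).image f)).subset ?_
    rintro ⟨a, b, p⟩ hp
    cases p with
    | nil => exact Or.inl (Nat.zero_le _)
    | @cons c _ p e =>
      refine Or.inr ⟨(⟨a, c, p⟩, ⟨c, b, e⟩), ⟨?_, trivial⟩, ?_⟩
      · exact Nat.le_of_succ_le_succ hp
      · simp [f]

variable (I : Ideal (PathAlgebra K V)) [I.IsTwoSided]

variable {K I} in
-- Paths of length at least `m` vanish in the quotient, so the finitely many shorter ones span it.
theorem finite_quotient_of_isAdmissible [∀ a b : V, Finite (a ⟶ b)] (hI : IsAdmissible I) :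
    Module.Finite K (PathAlgebra K V ⧸ I) := by
  obtain ⟨m, hm, hmI, -⟩ := hI
  obtain ⟨n, rfl⟩ : ∃ n, m = n + 1 := ⟨m - 1, by lia⟩
  refine Module.finite_def.2 (Submodule.fg_def.2
    ⟨_, (finite_setOf_length_le n).image fun p : QPath V =>
      Ideal.Quotient.mk I (ofPath K p.2.2), eq_top_iff.2 ?_⟩)
  rintro y -
  obtain ⟨y, rfl⟩ := Ideal.Quotient.mk_surjective y
  induction y using pathAlgebra_induction with
  | h0 => rw [map_zero]; exact zero_mem _
  | hadd x y hx hy => rw [map_add]; exact add_mem hx hy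
  | hpath c p =>
  rename_i a b
  have hc : Ideal.Quotient.mk I (c • ofPath K p) = c • Ideal.Quotient.mk I (ofPath K p) := rfl
  rw [hc]
  refine Submodule.smul_mem _ c ?_
  by_cases hp : p.length ≤ n
  · exact Submodule.subset_span ⟨⟨a, b, p⟩, hp, rfl⟩
  · have h0 : Ideal.Quotient.mk I (ofPath K p) = 0 :=
      Ideal.Quotient.eq_zero_iff_mem.2 (hmI (ofPath_mem_arrowIdeal_pow K n p (by lia)))
    exact h0 ▸ zero_mem _

theorem trivialCoeff_one (x : V) : trivialCoeff K x (1 : PathAlgebra K V) = 1 := by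
  change trivialCoeff K x (∑ a : V, vertexIdem K a) = 1
  rw [map_sum, Finset.sum_eq_single x, trivialCoeff_vertexIdem_self]
  · intro a _ h
    exact trivialCoeff_vertexIdem_of_ne K h
  · intro h
    exact absurd (Finset.mem_univ x) h

variable {K I} in
/-- The augmentation of the algebra of a bound quiver at a vertex. -/
theorem exists_augmentation (hI : IsAdmissible I) (x : V) :
    ∃ ε : PathAlgebra K V ⧸ I →+* K, ∀ y, ε (Ideal.Quotient.mk I y) = trivialCoeff K x y := by
  obtain ⟨m, hm, -, hI2⟩ := hI
  let f : PathAlgebra K V →+* K :=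
    { toFun := trivialCoeff K x
      map_zero' := map_zero _
      map_one' := trivialCoeff_one K x
      map_add' := map_add _
      map_mul' := trivialCoeff_mul K x }
  refine ⟨Ideal.Quotient.lift I f fun y hy => ?_, fun y => rfl⟩
  have h1 : y ∈ arrowIdeal K V * arrowIdeal K V := by
    rw [← pow_two]
    exact hI2 hy
  change trivialCoeff K x y = 0
  refine Submodule.mul_induction_on h1 (fun a ha b _ => ?_) fun a b ha hb => ?_
  · rw [trivialCoeff_mul, trivialCoeff_eq_zero K x ha, zero_mul]
  · rw [map_add, ha, hb, add_zero]

variable {K} in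
theorem exists_prod_eq_mk (l : List (PathAlgebra K V ⧸ I))
    (hl : ∀ a ∈ l, ∃ y ∈ arrowIdeal K V, Ideal.Quotient.mk I y = a) :
    ∃ z ∈ arrowIdeal K V ^ l.length, Ideal.Quotient.mk I z = l.prod := by
  induction l with
  | nil => exact ⟨1, by rw [List.length_nil, pow_zero]; exact Submodule.one_le.1 le_rfl, map_one _⟩
  | cons a l ih =>
    obtain ⟨z, hz, hz'⟩ := ih fun b hb => hl b (List.mem_cons_of_mem _ hb)
    obtain ⟨y, hy, hy'⟩ := hl a List.mem_cons_self
    refine ⟨y * z, ?_, by rw [map_mul, hy', hz', List.prod_cons]⟩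
    rw [List.length_cons, pow_succ']
    exact Submodule.mul_mem_mul hy hz

variable {K I} in
-- Each factor is sandwiched by the idempotent and has zero augmentation, so it lifts to the arrow
-- ideal; a product of `m` such lifts lies in `R ^ m`, hence in `I`.
theorem prod_eq_zero_of_isAdmissible (x : V) (ε : PathAlgebra K V ⧸ I →+* K)
    (hε : ∀ y, ε (Ideal.Quotient.mk I y) = trivialCoeff K x y) {m : ℕ}
    (hm : arrowIdeal K V ^ m ≤ I.restrictScalars K) (l : List (PathAlgebra K V ⧸ I))
    (hlm : l.length = m) (hl : ∀ a ∈ l, Ideal.Quotient.mk I (vertexIdem K x) * a *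
      Ideal.Quotient.mk I (vertexIdem K x) = a ∧ ε a = 0) : l.prod = 0 := by
  obtain ⟨z, hz, hz'⟩ := exists_prod_eq_mk I l fun a ha => by
    obtain ⟨h1, h2⟩ := hl a ha
    obtain ⟨y, rfl⟩ := Ideal.Quotient.mk_surjective a
    rw [hε] at h2
    have h3 := vertexIdem_mul_mul_sub_mem K x y
    rw [h2, zero_smul, sub_zero] at h3
    exact ⟨_, h3, by rw [map_mul, map_mul, h1]⟩
  rw [← hz', Ideal.Quotient.eq_zero_iff_mem]
  exact hm (hlm ▸ hz)

end BoundQuiver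
end Silting

open Silting in
theorem proposition2p2 {K : Type w} [Field K] [IsAlgClosed K]
    {V : Type u} [Fintype V] [Quiver.{v} V] [∀ a b : V, Finite (a ⟶ b)]
    (I : Ideal (PathAlgebra K V)) [I.IsTwoSided] (hI : IsAdmissible I)
    (ι : Vᵒᵖ ⥤q V) (hι : IsQuiverIso ι)
    (hιI : opIdeal I = (I.restrictScalars K).comap (mapPathAlgebra ι))
    (x : V) (hx : ι.obj (Opposite.op x) = x) :
    (∃ φ : TMinus (vertexProj I x) ≃ TPlus (vertexProj I x),
      ∀ S T : TMinus (vertexProj I x),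
        GeqClass (S : IsoClass (Kb (PathAlgebra K V ⧸ I))) T ↔
          GeqClass (φ T : IsoClass (Kb (PathAlgebra K V ⧸ I))) (φ S)) ∧
    Cardinal.mk (twoSilt (PathAlgebra K V ⧸ I)) =
      2 * Cardinal.mk (TMinus (vertexProj I x)) := by
  have := finite_quotient_of_isAdmissible hI
  obtain ⟨τ, hτ⟩ := exists_antiAutomorphism I hι hιI
  obtain ⟨ε, hε⟩ := exists_augmentation hI x
  -- Reversal keeps the trivial path trivial and `ι` fixes the vertex, so the anti-automorphism
  -- fixes the idempotent.
  have hx' : antiMap ι (vertexIdem K x) = vertexIdem K x :=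
    (antiMap_ofPath ι _).trans (congrArg (vertexIdem K) hx)
  obtain ⟨m, -, hm, -⟩ := hI
  refine exists_equiv_TMinus_TPlus τ (K := K) (Ideal.Quotient.mk I (vertexIdem K x)) _ ?_ ε ?_ ?_ m
    (prod_eq_zero_of_isAdmissible x ε hε hm)
  · have h := hτ (vertexIdem K x)
    rwa [hx'] at h
  · rw [hε, trivialCoeff_vertexIdem_self]
  · intro c
    refine ⟨Ideal.Quotient.mk I (c • vertexIdem K x), ?_⟩
    rw [hε, map_smul, trivialCoeff_vertexIdem_self, smul_eq_mul, mul_one]
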